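/- All graphs are finite, undirected and simple, on $n$ vertices, with positive rational edge weights $w$ and without isolated vertices (unweighted graphs being the case $w\equiv 1$). A fraction of the edges is a fraction of the total edge weight. Let $A$ be the weighted adjacency matrix and $D$ the diagonal matrix of weighted degrees, and let $\lambda_1\le\lambda_2\le\dots\le\lambda_n$ be the eigenvalues, with multiplicity, of the normalized Laplacian $\mathcal L=I-D^{-1/2}AD^{-1/2}$. **Theorem.** There are an absolute constant $C>0$ and a deterministic algorithm, running in time polynomial in the number of bits of the weight matrix of its input graph $G$, that on every such $G$ outputs a cut $(S,\overline S)$ with the following property. For every integer $k$ with $1\le k\le n-1$ and $\lambda_{n-k}<2$, and every real $\varepsilon\ge 0$: if the optimal cut of $G$ cuts at least a $1-\varepsilon$ fraction of the edges, then $(S,\overline S)$ cuts at least a $$1-C\,k\,\max\Big\{1,\ \log\frac{2-\lambda_{n-k}}{k\varepsilon}\Big\}\cdot\frac{\varepsilon}{2-\lambda_{n-k}}$$ fraction of the edges (for $\varepsilon=0$ the subtracted term is read as $0$). The algorithm receives only $G$, neither $k$ nor $\varepsilon$. Running time is measured on a random access machine with logarithmic cost: it works on integers with addition, subtraction, multiplication,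 division, comparison and indirect addressing, and every operation is charged according to the bit lengths of the integers it handles. -/

import Mathlib

/-! ### Weighted graphs, cuts, and the spectrum of the normalized Laplacian -/

/-- A finite undirected graph on the vertices `0, …, n - 1` with positive rational edge weights
and without isolated vertices. It is given by its weight matrix: `{u, v}` is an edge iff
`w u v ≠ 0`. (Weights are rational because the graph is the input of an algorithm.) -/
structure WGraph (n : ℕ) where
  w : Fin n → Fin n → ℚ
  symm : ∀ u v, w u v = w v u
  nonneg : ∀ u v, 0 ≤ w u v
  loopless : ∀ v, w v v = 0
  no_isolated : ∀ v, ∃ u, w u v ≠ 0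

namespace WGraph

variable {n : ℕ} (G : WGraph n)

/-- The weighted degree `w(v)` of a vertex. -/
def deg (v : Fin n) : ℚ := ∑ u, G.w u v

/-- The total weight `w(E)`; every edge is counted once. -/
def totalWeight : ℚ := ∑ u, ∑ v, if u < v then G.w u v else 0

/-- The weight `w(E(S, Sᶜ))` of the edges cut by `(S, Sᶜ)`. -/
def cutWeight (S : Finset (Fin n)) : ℚ := ∑ u ∈ S, ∑ v ∈ Sᶜ, G.w u v

/-- The (weighted) fraction of the edges that `(S, Sᶜ)` cuts. -/
def cutFraction (S : Finset (Fin n)) : ℚ := G.cutWeight S / G.totalWeight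

/-- The fraction of the edges that an optimal cut cuts. -/
def optCutFraction : ℚ := Finset.univ.sup' ⟨∅, Finset.mem_univ _⟩ G.cutFraction

/-- The weighted adjacency matrix `A`. -/
def adj : Matrix (Fin n) (Fin n) ℝ := Matrix.of fun u v => (G.w u v : ℝ)

/-- The diagonal matrix `D^{-1/2}`, for `D` the diagonal matrix of weighted degrees. -/
noncomputable def invSqrtDeg : Matrix (Fin n) (Fin n) ℝ :=
  Matrix.diagonal fun v => (Real.sqrt (G.deg v : ℝ))⁻¹

/-- The normalized Laplacian `I - D^{-1/2} A D^{-1/2}`. -/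
noncomputable def normalizedLaplacian : Matrix (Fin n) (Fin n) ℝ :=
  1 - G.invSqrtDeg * G.adj * G.invSqrtDeg

theorem normalizedLaplacian_isHermitian : G.normalizedLaplacian.IsHermitian := by
  ext u v
  simp [normalizedLaplacian, invSqrtDeg, adj, Matrix.mul_diagonal, Matrix.diagonal_mul,
    Matrix.one_apply, G.symm u v, eq_comm]
  ring

/-- The eigenvalues `λ₁ ≤ λ₂ ≤ ⋯ ≤ λₙ` of the normalized Laplacian, in increasing order with
multiplicity and numbered from `1` (Mathlib's `eigenvalues₀` is decreasing and numbered from `0`).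
The value at an index outside `1, …, n` is irrelevant. -/
noncomputable def lam (i : ℕ) : ℝ :=
  if h : 1 ≤ i ∧ i ≤ n then
    G.normalizedLaplacian_isHermitian.eigenvalues₀
      ⟨n - i, by rw [Fintype.card_fin]; omega⟩
  else 0

/-- Number of bits of the weight matrix, each entry being written as a reduced fraction. -/
def size : ℕ := ∑ u, ∑ v, (Nat.size (G.w u v).num.natAbs + Nat.size (G.w u v).den)

end WGraph

/-! ### Random access machines with logarithmic cost

Structured programs over integer registers and two-dimensional integer arrays with indirect
addressing. Every operation is charged according to the bit lengths of the integers (addresses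
included) that it handles, so polynomial cost on this machine is polynomial time on a Turing
machine. -/

namespace RAM

/-- Memory: integer registers, and integer arrays `arr a`. A program mentions only finitely many
registers and arrays. -/
structure Mem where
  reg : ℕ → ℤ
  arr : ℕ → ℤ → ℤ → ℤ

/-- Bit length of an integer, with sign. -/
def bits (z : ℤ) : ℕ := Nat.size z.natAbs + 1

inductive BinOp where
  | add | sub | mul | div | lt | eq

/-- `div` is integer division (with `x / 0 = 0`); the comparisons return `1` or `0`. -/
def BinOp.eval : BinOp → ℤ → ℤ → ℤ
  | .add, x, y => x + y
  | .sub, x, y => x - y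
  | .mul, x, y => x * y
  | .div, x, y => x / y
  | .lt, x, y => if x < y then 1 else 0
  | .eq, x, y => if x = y then 1 else 0

inductive Expr where
  | const (c : ℤ)
  | reg (x : ℕ)
  | get (a : ℕ) (i j : Expr)
  | bin (op : BinOp) (e₁ e₂ : Expr)

def Expr.eval (m : Mem) : Expr → ℤ
  | .const c => c
  | .reg x => m.reg x
  | .get a i j => m.arr a (i.eval m) (j.eval m)
  | .bin op e₁ e₂ => op.eval (e₁.eval m) (e₂.eval m)

/-- Cost of evaluating an expression. A read pays for the address and for the value, and an
arithmetic operation on numbers of `b₁` and `b₂` bits costs `b₁ * b₂`. -/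
def Expr.cost (m : Mem) : Expr → ℕ
  | .const c => bits c
  | .reg x => bits (m.reg x)
  | .get a i j => i.cost m + j.cost m + bits (i.eval m) + bits (j.eval m)
      + bits (m.arr a (i.eval m) (j.eval m))
  | .bin _ e₁ e₂ => e₁.cost m + e₂.cost m + bits (e₁.eval m) * bits (e₂.eval m)

inductive Prog where
  | skip
  /-- `reg x := e` -/
  | assign (x : ℕ) (e : Expr)
  /-- `arr a [i, j] := e` -/
  | store (a : ℕ) (i j e : Expr)
  | seq (p q : Prog)
  /-- run `p` if `e ≠ 0` and `q` if `e = 0` -/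
  | ite (e : Expr) (p q : Prog)
  /-- repeat `p` as long as `e ≠ 0` -/
  | loop (e : Expr) (p : Prog)

def Mem.setReg (m : Mem) (x : ℕ) (z : ℤ) : Mem :=
  { m with reg := fun y => if y = x then z else m.reg y }

def Mem.setArr (m : Mem) (a : ℕ) (i j z : ℤ) : Mem :=
  { m with arr := fun b i' j' => if b = a ∧ i' = i ∧ j' = j then z else m.arr b i' j' }

/-- `Exec p m m' t`: started in memory `m`, the program `p` halts in memory `m'`, at cost `t`. -/
inductive Exec : Prog → Mem → Mem → ℕ → Prop where
  | skip (m : Mem) : Exec .skip m m 1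
  | assign (m : Mem) (x : ℕ) (e : Expr) :
      Exec (.assign x e) m (m.setReg x (e.eval m)) (e.cost m + 1)
  | store (m : Mem) (a : ℕ) (i j e : Expr) :
      Exec (.store a i j e) m (m.setArr a (i.eval m) (j.eval m) (e.eval m))
        (i.cost m + j.cost m + e.cost m + bits (i.eval m) + bits (j.eval m) + 1)
  | seq {p q : Prog} {m m' m'' : Mem} {s t : ℕ} :
      Exec p m m' s → Exec q m' m'' t → Exec (.seq p q) m m'' (s + t)
  | ite_true {e : Expr} {p q : Prog} {m m' : Mem} {t : ℕ} :
      e.eval m ≠ 0 → Exec p m m' t → Exec (.ite e p q) m m' (e.cost m + t + 1)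
  | ite_false {e : Expr} {p q : Prog} {m m' : Mem} {t : ℕ} :
      e.eval m = 0 → Exec q m m' t → Exec (.ite e p q) m m' (e.cost m + t + 1)
  | loop_done {e : Expr} {p : Prog} {m : Mem} :
      e.eval m = 0 → Exec (.loop e p) m m (e.cost m + 1)
  | loop_step {e : Expr} {p : Prog} {m m' m'' : Mem} {s t : ℕ} :
      e.eval m ≠ 0 → Exec p m m' s → Exec (.loop e p) m' m'' t →
      Exec (.loop e p) m m'' (e.cost m + s + t + 1)

/-- The machine is deterministic: final memory and cost are determined by the start. -/
theorem Exec.deterministic {p : Prog} {m m₁ m₂ : Mem} {t₁ t₂ : ℕ}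
    (h₁ : Exec p m m₁ t₁) (h₂ : Exec p m m₂ t₂) : m₁ = m₂ ∧ t₁ = t₂ := by
  induction h₁ generalizing m₂ t₂ with
  | skip => cases h₂; exact ⟨rfl, rfl⟩
  | assign => cases h₂; exact ⟨rfl, rfl⟩
  | store => cases h₂; exact ⟨rfl, rfl⟩
  | seq _ _ ih ih' =>
    cases h₂ with
    | seq a b =>
      obtain ⟨rfl, rfl⟩ := ih a
      obtain ⟨rfl, rfl⟩ := ih' b
      exact ⟨rfl, rfl⟩
  | ite_true he _ ih =>
    cases h₂ with
    | ite_true _ a => obtain ⟨rfl, rfl⟩ := ih a; exact ⟨rfl, rfl⟩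
    | ite_false h _ => exact absurd h he
  | ite_false he _ ih =>
    cases h₂ with
    | ite_true h _ => exact absurd he h
    | ite_false _ a => obtain ⟨rfl, rfl⟩ := ih a; exact ⟨rfl, rfl⟩
  | loop_done he =>
    cases h₂ with
    | loop_done _ => exact ⟨rfl, rfl⟩
    | loop_step h _ _ => exact absurd he h
  | loop_step he _ _ ih ih' =>
    cases h₂ with
    | loop_done h => exact absurd h he
    | loop_step _ a b =>
      obtain ⟨rfl, rfl⟩ := ih a
      obtain ⟨rfl, rfl⟩ := ih' b
      exact ⟨rfl, rfl⟩

/-- The initial memory on input `G`: register `0` holds `n`, array `0` holds the numerators and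
array `1` the denominators of the weight matrix, everything else is `0`. -/
def input {n : ℕ} (G : WGraph n) : Mem where
  reg x := if x = 0 then (n : ℤ) else 0
  arr a i j :=
    if h : (0 ≤ i ∧ i < n) ∧ (0 ≤ j ∧ j < n) then
      let q := G.w ⟨i.toNat, by omega⟩ ⟨j.toNat, by omega⟩
      if a = 0 then q.num else if a = 1 then (q.den : ℤ) else 0
    else 0

/-- The vertex set that a final memory stands for: `v` belongs to it iff entry `(v, 0)` of
array `2` is not `0`. -/
def output (n : ℕ) (m : Mem) : Finset (Fin n) :=
  Finset.univ.filter fun v => m.arr 2 (v : ℤ) 0 ≠ 0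

end RAM

/-!
# Spectral rounding for Max Cut in terms of a higher eigenvalue

The algorithm builds the cut in `n` steps. In each step it has the remaining weights `ω`, on the
vertices not yet decided, and it looks for a vector `σ` with entries `0`, `1`, `-1` such that few of
the edges at its support are left uncut; it puts the vertices with `σ = 1` on one side, those with
`σ = -1` on the other, and removes them. The candidates for `σ` are the levels of a function `f`
with a small Rayleigh quotient `energy ω f / mass ω f`, where `energy` is the quadratic form of the
signless Laplacian and `mass` is the squared norm weighted by the degrees.

If the optimal cut misses a weight of at most `E`, then on the remaining graph its `±1` vector has
a Rayleigh quotient of at most `ρ ~ E / vol`, where `vol` is the remaining volume. A function that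
is as good up to a constant is found without knowledge of `E` among the columns of the powers
`P ^ 2 ^ j` of the walk matrix `P = (1 - D⁻¹ A) / 2`
(`exists_column_flipWalk_pow`). The powers are computed by repeated squaring with fixed point
numbers whose accuracy is exponential in `n` (`exists_column_walkApprox`).

The rounding (`exists_level_of_fewSlowParts`) is where the eigenvalue enters. Let
`α = 2 - λ_{n-k}`. By the min-max principle, of `k + 1` functions with disjoint supports one has a
Rayleigh quotient of at least `α / 2` on the original graph (`WGraph.fewSlowParts`). Breakpoints
`0 = t 0 ≤ t 1 ≤ ⋯` are placed such that the distance of `|f|` to the breakpoints has the same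
weighted square sum on each interval. If there are `O(k)` of them, `f` is close to a step function
with `O(k)` steps, and rounding `f` at a random threshold, with density proportional to the
distance to the breakpoints, loses `O(k * ρ / α)` instead of `O(√ρ)`. If there are more, most of
the pieces into which the breakpoints cut `f` have large energy for the original weights. The
energy of `f` for the remaining weights does not account for this, so the support of `f` is incident
to much weight that was removed earlier. Such boundary weight was charged as a loss when it was
removed, although only part of it need be lost, and this credit pays for the rounding.

Each step thus loses at most `κ / vol` per unit of volume that it removes, up to the credit, where
`κ ~ k * E / α`. Summation over the steps gives `κ * log (total volume / Θ)` until the volume falls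
below `Θ ~ k * E / α`, and what happens after that loses at most `Θ` (`Run.uncut_le`). With
`E = ε * total volume` this is the claimed bound. If the graph is bipartite, the loss is an integer
that is less than `1` (`Run.uncut_eq_zero`).

For the running time, every expression and program has a cost polynomial in the number of bits `B`
of the numbers that occur, valid as long as no loop is repeated more than `B` times
(`RAM.Ensures`). All numbers are bounded by a fixed power of a number `Z` with linearly many bits,
and the number of squarings is logarithmic in `Z ^ 32`.
-/

open Finset

/-! ### Quadratic forms of a weight matrix -/

namespace CutForm

variable {V : Type*} [Fintype V]

/-- The row sum of a weight matrix, i.e. the weighted degree. -/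
def rowSum {R : Type*} [CommRing R] (w : V → V → R) (u : V) : R := ∑ v, w u v

/-- The signless Dirichlet energy: the sum over the edges `{u, v}` of `w u v * (f u + f v) ^ 2`,
written as half the sum over ordered pairs. -/
noncomputable def energy (w : V → V → ℝ) (f : V → ℝ) : ℝ :=
  (1 / 2) * ∑ u, ∑ v, w u v * (f u + f v) ^ 2

/-- The `ℓ¹` analogue of `energy`. -/
noncomputable def energyL1 (w : V → V → ℝ) (f : V → ℝ) : ℝ :=
  (1 / 2) * ∑ u, ∑ v, w u v * |f u + f v|

/-- The squared norm of `f` in which a vertex counts with its degree. -/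
def mass (w : V → V → ℝ) (f : V → ℝ) : ℝ := ∑ u, rowSum w u * f u ^ 2

lemma rowSum_nonneg {w : V → V → ℝ} (hw : ∀ u v, 0 ≤ w u v) (u : V) : 0 ≤ rowSum w u :=
  sum_nonneg fun v _ => hw u v

lemma energy_nonneg {w : V → V → ℝ} (hw : ∀ u v, 0 ≤ w u v) (f : V → ℝ) : 0 ≤ energy w f := by
  unfold energy
  have : 0 ≤ ∑ u, ∑ v, w u v * (f u + f v) ^ 2 :=
    sum_nonneg fun u _ => sum_nonneg fun v _ => mul_nonneg (hw u v) (sq_nonneg _)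
  linarith

lemma mass_nonneg {w : V → V → ℝ} (hw : ∀ u v, 0 ≤ w u v) (f : V → ℝ) : 0 ≤ mass w f :=
  sum_nonneg fun u _ => mul_nonneg (rowSum_nonneg hw u) (sq_nonneg _)

lemma sum_pair_left (w : V → V → ℝ) (g : V → ℝ) :
    ∑ u, ∑ v, w u v * g u = ∑ u, rowSum w u * g u := by
  simp [rowSum, sum_mul]

lemma sum_pair_right {w : V → V → ℝ} (hs : ∀ u v, w u v = w v u) (g : V → ℝ) :
    ∑ u, ∑ v, w u v * g v = ∑ u, rowSum w u * g u := by
  rw [sum_comm, ← sum_pair_left]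
  exact sum_congr rfl fun u _ => sum_congr rfl fun v _ => by rw [hs]

/-- Passing from a weight matrix `w` to a larger one `W` costs at most twice the mass of the
missing weight. -/
lemma energy_le_energy_add {w W : V → V → ℝ} (hle : ∀ u v, w u v ≤ W u v)
    (hs : ∀ u v, w u v = w v u) (hS : ∀ u v, W u v = W v u) (f : V → ℝ) :
    energy W f ≤ energy w f + 2 * ∑ u, (rowSum W u - rowSum w u) * f u ^ 2 := by
  have h1 : ∀ u v, W u v * (f u + f v) ^ 2 ≤ w u v * (f u + f v) ^ 2 +
      (2 * (W u v * f u ^ 2) + 2 * (W u v * f v ^ 2)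
        - 2 * (w u v * f u ^ 2) - 2 * (w u v * f v ^ 2)) := by
    intro u v
    nlinarith [mul_nonneg (sub_nonneg.2 (hle u v)) (sq_nonneg (f u - f v))]
  have h2 := sum_le_sum fun u (_ : u ∈ univ) => sum_le_sum fun v (_ : v ∈ univ) => h1 u v
  simp only [sum_add_distrib, sum_sub_distrib, ← mul_sum] at h2
  have e1 := sum_pair_left W (fun u => f u ^ 2)
  have e2 := sum_pair_right hS (fun u => f u ^ 2)
  have e3 := sum_pair_left w (fun u => f u ^ 2)
  have e4 := sum_pair_right hs (fun u => f u ^ 2)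
  rw [e1, e2, e3, e4] at h2
  simp only [energy, sub_mul, sum_sub_distrib]
  linarith

/-! ### Tent functions on consecutive intervals -/

/-- The length of the part of `[a, b]` that lies below `x`. -/
def seg (a b x : ℝ) : ℝ := min x b - min x a

/-- The distance of `x` to the complement of `[a, b]`. -/
noncomputable def tent (a b x : ℝ) : ℝ := min (seg a b x) (b - a - seg a b x)

/-- The antiderivative of `tent a b` that vanishes on the left of `a`, in closed form. -/
noncomputable def bump (a b x : ℝ) : ℝ := seg a b x ^ 2 / 2 - max 0 (seg a b x - (b - a) / 2) ^ 2

lemma seg_nonneg {a b : ℝ} (h : a ≤ b) (x : ℝ) : 0 ≤ seg a b x :=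
  sub_nonneg.2 (min_le_min_left x h)

lemma seg_le {a b : ℝ} (h : a ≤ b) (x : ℝ) : seg a b x ≤ b - a := by
  unfold seg
  rcases le_total x a with h1 | h1
  · rw [min_eq_left h1, min_eq_left (h1.trans h)]; linarith
  · rw [min_eq_right h1]; linarith [min_le_right x b]

lemma seg_mono {a b : ℝ} (h : a ≤ b) {x y : ℝ} (hxy : x ≤ y) : seg a b x ≤ seg a b y := by
  unfold seg
  rcases le_total y a with h1 | h1
  · simp [min_eq_left h1, min_eq_left (h1.trans h), min_eq_left (hxy.trans h1),
      min_eq_left ((hxy.trans h1).trans h)]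
  · rw [min_eq_right h1]
    rcases le_total x a with h2 | h2
    · rw [min_eq_left h2, min_eq_left (h2.trans h)]
      linarith [le_min h1 h]
    · rw [min_eq_right h2]
      linarith [min_le_min_right b hxy]

lemma seg_zero {a b : ℝ} (ha : 0 ≤ a) (h : a ≤ b) : seg a b 0 = 0 := by
  simp [seg, ha, ha.trans h]

lemma tent_nonneg {a b : ℝ} (h : a ≤ b) (x : ℝ) : 0 ≤ tent a b x :=
  le_min (seg_nonneg h x) (sub_nonneg.2 (seg_le h x))

lemma tent_le_seg (a b x : ℝ) : tent a b x ≤ seg a b x := min_le_left _ _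

lemma abs_tent_sub_le (a b x y : ℝ) : |tent a b x - tent a b y| ≤ |seg a b x - seg a b y| := by
  refine (abs_min_sub_min_le_max _ _ _ _).trans (max_le le_rfl ?_)
  rw [show b - a - seg a b x - (b - a - seg a b y) = -(seg a b x - seg a b y) by ring, abs_neg]

lemma tent_mul_tent {a b c d : ℝ} (hab : a ≤ b) (hbc : b ≤ c) (hcd : c ≤ d) (x : ℝ) :
    tent a b x * tent c d x = 0 := by
  rcases le_total x c with h | h
  · have : tent c d x = 0 := by
      apply le_antisymm _ (tent_nonneg hcd x)
      refine (tent_le_seg _ _ _).trans ?_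
      simp [seg, min_eq_left h, min_eq_left (h.trans hcd)]
    rw [this, mul_zero]
  · have : tent a b x = 0 := by
      apply le_antisymm _ (tent_nonneg hab x)
      refine (min_le_right _ _).trans ?_
      simp [seg, min_eq_right (hbc.trans h), min_eq_right ((hab.trans hbc).trans h)]
    rw [this, zero_mul]

lemma tent_self (a x : ℝ) : tent a a x = 0 := by simp [tent, seg]

lemma continuous_tent (a x : ℝ) : Continuous fun b => tent a b x := by
  unfold tent seg; fun_prop

lemma bump_mono {a b : ℝ} (h : a ≤ b) {x y : ℝ} (hxy : x ≤ y) : bump a b x ≤ bump a b y := by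
  have h1 := seg_mono h hxy
  have h2 := seg_nonneg h x
  have h3 := seg_le h y
  unfold bump
  generalize seg a b x = p at *
  generalize seg a b y = q at *
  rcases max_cases 0 (p - (b - a) / 2) with ⟨e1, e2⟩ | ⟨e1, e2⟩ <;>
  rcases max_cases 0 (q - (b - a) / 2) with ⟨e3, e4⟩ | ⟨e3, e4⟩ <;> rw [e1, e3] <;> nlinarith

lemma bump_sub_le {a b : ℝ} (h : a ≤ b) {x y : ℝ} (hxy : x ≤ y) :
    bump a b y - bump a b x
      ≤ (seg a b y - seg a b x) * (tent a b x + (seg a b y - seg a b x)) := by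
  have h1 := seg_mono h hxy
  have h2 := seg_nonneg h x
  have h3 := seg_le h y
  unfold bump tent
  generalize seg a b x = p at *
  generalize seg a b y = q at *
  rcases max_cases 0 (p - (b - a) / 2) with ⟨e1, e2⟩ | ⟨e1, e2⟩ <;>
  rcases max_cases 0 (q - (b - a) / 2) with ⟨e3, e4⟩ | ⟨e3, e4⟩ <;>
  rcases min_cases p (b - a - p) with ⟨e5, e6⟩ | ⟨e5, e6⟩ <;> rw [e1, e3, e5] <;> nlinarith

lemma sq_tent_le_bump {a b : ℝ} (h : a ≤ b) (x : ℝ) : tent a b x ^ 2 / 2 ≤ bump a b x := by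
  have h2 := seg_nonneg h x
  have h3 := seg_le h x
  unfold bump tent
  generalize seg a b x = p at *
  rcases max_cases 0 (p - (b - a) / 2) with ⟨e1, e2⟩ | ⟨e1, e2⟩ <;>
  rcases min_cases p (b - a - p) with ⟨e5, e6⟩ | ⟨e5, e6⟩ <;> rw [e1, e5] <;> nlinarith

lemma sq_seg_le_bump {a b : ℝ} (h : a ≤ b) (x : ℝ) : seg a b x ^ 2 / 4 ≤ bump a b x := by
  have h2 := seg_nonneg h x
  have h3 := seg_le h x
  unfold bump
  generalize seg a b x = p at *
  rcases max_cases 0 (p - (b - a) / 2) with ⟨e1, e2⟩ | ⟨e1, e2⟩ <;> rw [e1] <;> nlinarith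

lemma bump_zero {a b : ℝ} (ha : 0 ≤ a) (h : a ≤ b) : bump a b 0 = 0 := by
  have : max 0 (-((b - a) / 2)) = 0 := max_eq_left (by linarith)
  simp [bump, seg_zero ha h, this]

/-! ### Tents over a sequence of breakpoints -/

/-- The distance of `x` to the breakpoints `t 0, …, t m`, for `x` between the first and the last. -/
noncomputable def tents (t : ℕ → ℝ) (m : ℕ) (x : ℝ) : ℝ := ∑ j ∈ range m, tent (t j) (t (j + 1)) x

/-- The antiderivative of `tents`. -/
noncomputable def bumps (t : ℕ → ℝ) (m : ℕ) (x : ℝ) : ℝ := ∑ j ∈ range m, bump (t j) (t (j + 1)) x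

lemma sum_seg (t : ℕ → ℝ) (m : ℕ) (x : ℝ) :
    ∑ j ∈ range m, seg (t j) (t (j + 1)) x = min x (t m) - min x (t 0) :=
  sum_range_sub (fun j => min x (t j)) m

lemma breakpoint_nonneg {t : ℕ → ℝ} (h0 : t 0 = 0) (ht : Monotone t)
    (j : ℕ) : 0 ≤ t j := h0 ▸ ht (Nat.zero_le j)

lemma breakpoint_le_succ {t : ℕ → ℝ} (ht : Monotone t)
    (j : ℕ) : t j ≤ t (j + 1) := ht (Nat.le_succ j)

lemma sum_seg_le {t : ℕ → ℝ} (h0 : t 0 = 0)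
    (m : ℕ) {x : ℝ} (hx : 0 ≤ x) :
    ∑ j ∈ range m, seg (t j) (t (j + 1)) x ≤ x := by
  rw [sum_seg, h0, min_eq_right hx, sub_zero]
  exact min_le_left _ _

lemma sum_seg_sub_le {t : ℕ → ℝ} (h0 : t 0 = 0)
    (m : ℕ) {x y : ℝ} (hx : 0 ≤ x) (hxy : x ≤ y) :
    ∑ j ∈ range m, (seg (t j) (t (j + 1)) y - seg (t j) (t (j + 1)) x) ≤ y - x := by
  rw [sum_sub_distrib, sum_seg, sum_seg, h0, min_eq_right hx, min_eq_right (hx.trans hxy)]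
  rcases le_total y (t m) with h | h
  · rw [min_eq_left h, min_eq_left (hxy.trans h)]; linarith
  · rw [min_eq_right h]
    rcases le_total x (t m) with h' | h'
    · rw [min_eq_left h']; linarith
    · rw [min_eq_right h']; linarith

lemma tents_nonneg {t : ℕ → ℝ} (ht : Monotone t)
    (m : ℕ) (x : ℝ) : 0 ≤ tents t m x :=
  sum_nonneg fun j _ => tent_nonneg (breakpoint_le_succ ht j) x

lemma tents_le {t : ℕ → ℝ} (h0 : t 0 = 0)
    (m : ℕ) {x : ℝ} (hx : 0 ≤ x) : tents t m x ≤ x :=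
  (sum_le_sum fun _ _ => tent_le_seg _ _ _).trans (sum_seg_le h0 m hx)

lemma sq_tents {t : ℕ → ℝ} (ht : Monotone t)
    (m : ℕ) (x : ℝ) :
    tents t m x ^ 2 = ∑ j ∈ range m, tent (t j) (t (j + 1)) x ^ 2 := by
  unfold tents
  rw [sq, sum_mul_sum]
  refine sum_congr rfl fun i hi => ?_
  rw [sum_eq_single_of_mem i hi, sq]
  intro j _ hij
  rcases lt_or_gt_of_ne hij with h | h
  · rw [mul_comm]
    exact tent_mul_tent (breakpoint_le_succ ht j) (ht h) (breakpoint_le_succ ht i) x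
  · exact tent_mul_tent (breakpoint_le_succ ht i) (ht h) (breakpoint_le_succ ht j) x

lemma bumps_mono {t : ℕ → ℝ} (ht : Monotone t)
    (m : ℕ) {x y : ℝ} (hxy : x ≤ y) : bumps t m x ≤ bumps t m y :=
  sum_le_sum fun j _ => bump_mono (breakpoint_le_succ ht j) hxy

lemma bumps_zero {t : ℕ → ℝ} (h0 : t 0 = 0) (ht : Monotone t)
    (m : ℕ) : bumps t m 0 = 0 :=
  sum_eq_zero fun j _ => bump_zero (breakpoint_nonneg h0 ht j) (breakpoint_le_succ ht j)

lemma bumps_nonneg {t : ℕ → ℝ} (h0 : t 0 = 0) (ht : Monotone t)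
    (m : ℕ) {x : ℝ} (hx : 0 ≤ x) : 0 ≤ bumps t m x :=
  bumps_zero h0 ht m ▸ bumps_mono ht m hx

lemma bumps_sub_le {t : ℕ → ℝ} (h0 : t 0 = 0) (ht : Monotone t)
    (m : ℕ) {x y : ℝ} (hx : 0 ≤ x) (hxy : x ≤ y) :
    bumps t m y - bumps t m x ≤ (y - x) * (tents t m x + (y - x)) := by
  have hd : ∀ j, 0 ≤ seg (t j) (t (j + 1)) y - seg (t j) (t (j + 1)) x := fun j =>
    sub_nonneg.2 (seg_mono (breakpoint_le_succ ht j) hxy)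
  have hsum := sum_seg_sub_le h0 m hx hxy
  have hT := tents_nonneg ht m x
  calc bumps t m y - bumps t m x
      = ∑ j ∈ range m, (bump (t j) (t (j + 1)) y - bump (t j) (t (j + 1)) x) := by
        rw [sum_sub_distrib]; rfl
    _ ≤ ∑ j ∈ range m, (seg (t j) (t (j + 1)) y - seg (t j) (t (j + 1)) x) *
          (tents t m x + (y - x)) := by
        refine sum_le_sum fun j hj => (bump_sub_le (breakpoint_le_succ ht j) hxy).trans ?_
        refine mul_le_mul_of_nonneg_left (add_le_add ?_ ?_) (hd j)
        · exact single_le_sum (f := fun j => tent (t j) (t (j + 1)) x)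
            (fun i _ => tent_nonneg (breakpoint_le_succ ht i) x) hj
        · exact (single_le_sum (f := fun j => seg (t j) (t (j + 1)) y - seg (t j) (t (j + 1)) x)
            (fun i _ => hd i) hj).trans hsum
    _ ≤ _ := by
        rw [← sum_mul]
        exact mul_le_mul_of_nonneg_right hsum (by linarith)

lemma sq_tents_le_bumps {t : ℕ → ℝ} (ht : Monotone t)
    (m : ℕ) (x : ℝ) : tents t m x ^ 2 / 2 ≤ bumps t m x := by
  rw [sq_tents ht, sum_div]
  exact sum_le_sum fun j _ => sq_tent_le_bump (breakpoint_le_succ ht j) x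

lemma sq_le_bumps {t : ℕ → ℝ} (h0 : t 0 = 0) (ht : Monotone t)
    (m : ℕ) {x : ℝ} (hx : 0 ≤ x) (hxm : x ≤ t m) :
    x ^ 2 ≤ 4 * m * bumps t m x := by
  have h1 : ∑ j ∈ range m, seg (t j) (t (j + 1)) x = x := by
    rw [sum_seg, h0, min_eq_right hx, min_eq_left hxm, sub_zero]
  have h2 := sq_sum_le_card_mul_sum_sq (s := range m) (f := fun j => seg (t j) (t (j + 1)) x)
  rw [h1, card_range] at h2
  have h3 : ∑ j ∈ range m, seg (t j) (t (j + 1)) x ^ 2 ≤ 4 * bumps t m x := by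
    unfold bumps
    rw [mul_sum]
    refine sum_le_sum fun j _ => ?_
    linarith [sq_seg_le_bump (breakpoint_le_succ ht j) x]
  nlinarith [mul_le_mul_of_nonneg_left h3 (Nat.cast_nonneg (α := ℝ) m)]

end CutForm

namespace CutForm

variable {V : Type*} [Fintype V]

/-! ### The rounding lemma -/

/-- The odd function that agrees with `φ` on the positive reals. -/
noncomputable def oddExt (φ : ℝ → ℝ) (x : ℝ) : ℝ := if 0 ≤ x then φ x else -φ (-x)

lemma abs_oddExt {φ : ℝ → ℝ} (hφ : ∀ x, 0 ≤ x → 0 ≤ φ x) (x : ℝ) : |oddExt φ x| = φ |x| := by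
  unfold oddExt
  split_ifs with h
  · rw [abs_of_nonneg h, abs_of_nonneg (hφ x h)]
  · rw [abs_neg, abs_of_neg (not_le.1 h), abs_of_nonneg (hφ _ (by linarith))]

lemma abs_oddExt_add (φ : ℝ → ℝ) (x y : ℝ) :
    (|x + y| = |x| + |y| ∧ |oddExt φ x + oddExt φ y| = |φ |x| + φ (|y|)|) ∨
    (|x + y| = |(|x| - |y|)| ∧ |oddExt φ x + oddExt φ y| = |φ |x| - φ (|y|)|) := by
  unfold oddExt
  split_ifs with hx hy hy
  · left
    rw [abs_of_nonneg (add_nonneg hx hy), abs_of_nonneg hx, abs_of_nonneg hy]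
    exact ⟨rfl, rfl⟩
  · right
    rw [abs_of_nonneg hx, abs_of_neg (not_le.1 hy)]
    exact ⟨by rw [sub_neg_eq_add], by rw [sub_eq_add_neg]⟩
  · right
    rw [abs_of_neg (not_le.1 hx), abs_of_nonneg hy]
    refine ⟨?_, ?_⟩
    · rw [← abs_neg]; congr 1; ring
    · rw [← abs_neg]; congr 1; ring
  · left
    rw [not_le] at hx hy
    rw [abs_of_neg (add_neg hx hy), abs_of_neg hx, abs_of_neg hy]
    refine ⟨by ring, ?_⟩
    rw [← abs_neg]; congr 1; ring

lemma abs_oddExt_bumps_add_le {t : ℕ → ℝ} (h0 : t 0 = 0) (ht : Monotone t) (m : ℕ) (x y : ℝ) :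
    |oddExt (bumps t m) x + oddExt (bumps t m) y|
      ≤ |x + y| * (tents t m |x| + tents t m |y| + |x + y|) := by
  have hT := fun z => tents_nonneg ht m z
  have key : ∀ p q : ℝ, 0 ≤ p → p ≤ q → |bumps t m p - bumps t m q|
      ≤ |p - q| * (tents t m p + tents t m q + |p - q|) := by
    intro p q hp hpq
    have h1 := bumps_sub_le h0 ht m hp hpq
    have h2 := bumps_mono ht m hpq
    rw [abs_sub_comm, abs_of_nonneg (sub_nonneg.2 h2), abs_sub_comm,
      abs_of_nonneg (sub_nonneg.2 hpq)]
    nlinarith [mul_nonneg (sub_nonneg.2 hpq) (hT q)]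
  rcases abs_oddExt_add (bumps t m) x y with ⟨h1, h2⟩ | ⟨h1, h2⟩ <;> rw [h1, h2]
  · have hz : ∀ p : ℝ, 0 ≤ p → bumps t m p ≤ p * p := by
      intro p hp
      have := bumps_sub_le h0 ht m le_rfl hp
      have h3 : tents t m 0 ≤ 0 := tents_le h0 m le_rfl
      rw [bumps_zero h0 ht] at this
      nlinarith
    have hx := abs_nonneg x
    have hy := abs_nonneg y
    rw [abs_of_nonneg (add_nonneg (bumps_nonneg h0 ht m hx) (bumps_nonneg h0 ht m hy))]
    have := hz _ hx
    have := hz _ hy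
    nlinarith [mul_nonneg (add_nonneg hx hy) (add_nonneg (hT |x|) (hT |y|)), mul_nonneg hx hy]
  · rcases le_total |x| |y| with h | h
    · exact key _ _ (abs_nonneg x) h
    · rw [abs_sub_comm (bumps t m |x|), abs_sub_comm |x|, add_comm (tents t m |x|)]
      exact key _ _ (abs_nonneg y) h

/-- The pieces into which the tents cut a function have, together, no more energy than it. -/
lemma sum_sq_oddExt_tent_add_le {t : ℕ → ℝ} (h0 : t 0 = 0) (ht : Monotone t) (m : ℕ) (x y : ℝ) :
    ∑ j ∈ range m,
      (oddExt (tent (t j) (t (j + 1))) x + oddExt (tent (t j) (t (j + 1))) y) ^ 2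
      ≤ (x + y) ^ 2 := by
  have sumsq : ∀ (g : ℕ → ℝ) (c : ℝ), (∀ j, 0 ≤ g j) → ∑ j ∈ range m, g j ≤ c →
      ∑ j ∈ range m, g j ^ 2 ≤ c ^ 2 := fun g c hg hc =>
    (sum_sq_le_sq_sum_of_nonneg fun j _ => hg j).trans
      (pow_le_pow_left₀ (sum_nonneg fun j _ => hg j) hc 2)
  have key : ∀ p q : ℝ, 0 ≤ p → p ≤ q →
      ∑ j ∈ range m, |tent (t j) (t (j + 1)) p - tent (t j) (t (j + 1)) q| ≤ |p - q| := by
    intro p q hp hpq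
    rw [abs_sub_comm, abs_of_nonneg (sub_nonneg.2 hpq)]
    refine le_trans (sum_le_sum fun j _ => ?_) (sum_seg_sub_le h0 m hp hpq)
    rw [abs_sub_comm]
    refine (abs_tent_sub_le _ _ _ _).trans_eq (abs_of_nonneg ?_)
    exact sub_nonneg.2 (seg_mono (breakpoint_le_succ ht j) hpq)
  have hcase : (|x + y| = |x| + |y| ∨ |x + y| = |(|x| - |y|)|) ∧
      ∀ j, |oddExt (tent (t j) (t (j + 1))) x + oddExt (tent (t j) (t (j + 1))) y| ≤
        if |x + y| = |x| + |y| then tent (t j) (t (j + 1)) |x| + tent (t j) (t (j + 1)) |y|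
        else |tent (t j) (t (j + 1)) |x| - tent (t j) (t (j + 1)) (|y|)| := by
    constructor
    · rcases abs_oddExt_add (fun _ => 0) x y with h | h
      · exact Or.inl h.1
      · exact Or.inr h.1
    · intro j
      have hx := tent_nonneg (breakpoint_le_succ ht j) |x|
      have hy := tent_nonneg (breakpoint_le_succ ht j) |y|
      rcases abs_oddExt_add (tent (t j) (t (j + 1))) x y with ⟨h1, h2⟩ | ⟨h1, h2⟩
      · rw [if_pos h1, h2, abs_of_nonneg (add_nonneg hx hy)]
      · rw [h2]
        split_ifs
        · exact abs_sub_le_iff.2 ⟨by linarith, by linarith⟩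
        · exact le_rfl
  simp_rw [← sq_abs (oddExt _ _ + _)]
  rw [← sq_abs (x + y)]
  obtain ⟨h1, h2⟩ := hcase
  refine sumsq _ _ (fun j => abs_nonneg _) ((sum_le_sum fun j _ => h2 j).trans ?_)
  split_ifs with h
  · rw [h, sum_add_distrib]
    exact add_le_add
      ((sum_le_sum fun _ _ => tent_le_seg _ _ _).trans (sum_seg_le h0 m (abs_nonneg x)))
      ((sum_le_sum fun _ _ => tent_le_seg _ _ _).trans (sum_seg_le h0 m (abs_nonneg y)))
  · rw [h1.resolve_left h]
    rcases le_total |x| |y| with h | h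
    · exact key _ _ (abs_nonneg x) h
    · simp_rw [abs_sub_comm (tent _ _ |x|)]
      rw [abs_sub_comm |x|]
      exact key _ _ (abs_nonneg y) h

/-- The `ℓ¹` energy of the transformed function is controlled by the energy and by the squared
distance to the breakpoints; `lam` balances the two. -/
lemma energyL1_bumps_le {w : V → V → ℝ} (hw : ∀ u v, 0 ≤ w u v) (hs : ∀ u v, w u v = w v u)
    {t : ℕ → ℝ} (h0 : t 0 = 0) (ht : Monotone t) (m : ℕ) (f : V → ℝ) {lam : ℝ} (hl : 0 < lam) :
    energyL1 w (fun u => oddExt (bumps t m) (f u))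
      ≤ (1 + lam / 2) * energy w f + (∑ u, rowSum w u * tents t m |f u| ^ 2) / lam := by
  have h1 : ∀ u v, w u v * |oddExt (bumps t m) (f u) + oddExt (bumps t m) (f v)| ≤
      (1 + lam / 2) * (w u v * (f u + f v) ^ 2) +
        (1 / lam) * (w u v * tents t m |f u| ^ 2) + (1 / lam) * (w u v * tents t m |f v| ^ 2) := by
    intro u v
    have h2 := abs_oddExt_bumps_add_le h0 ht m (f u) (f v)
    rw [← sq_abs (f u + f v)]
    set D := |f u + f v|
    set p := tents t m |f u|
    set q := tents t m |f v|
    have h3 : D * (p + q + D) ≤ (1 + lam / 2) * D ^ 2 + 1 / lam * p ^ 2 + 1 / lam * q ^ 2 := by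
      have e : (1 + lam / 2) * D ^ 2 + 1 / lam * p ^ 2 + 1 / lam * q ^ 2 - D * (p + q + D)
          = ((lam * D - (p + q)) ^ 2 + (p - q) ^ 2) / (2 * lam) := by
        field_simp; ring
      have : 0 ≤ ((lam * D - (p + q)) ^ 2 + (p - q) ^ 2) / (2 * lam) := by positivity
      linarith
    calc _ ≤ w u v * ((1 + lam / 2) * D ^ 2 + 1 / lam * p ^ 2 + 1 / lam * q ^ 2) :=
          mul_le_mul_of_nonneg_left (h2.trans h3) (hw u v)
      _ = _ := by ring
  have h2 := sum_le_sum fun u (_ : u ∈ univ) => sum_le_sum fun v (_ : v ∈ univ) => h1 u v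
  simp only [sum_add_distrib, ← mul_sum] at h2
  rw [sum_pair_left w (fun u => tents t m |f u| ^ 2),
    sum_pair_right hs (fun u => tents t m |f u| ^ 2)] at h2
  simp only [energyL1, energy]
  rw [div_eq_mul_one_div _ lam]
  linarith

/-- Breakpoints `0 = t 0 ≤ t 1 ≤ ⋯` for which each interval but the last one carries a squared
distance of exactly `θ`, the last one carries at most `θ`, and everything is covered. -/
lemma exists_breakpoints {D : V → ℝ} (hD : ∀ u, 0 ≤ D u) (f : V → ℝ) {θ : ℝ} (hθ : 0 < θ) :
    ∃ (m : ℕ) (t : ℕ → ℝ), t 0 = 0 ∧ Monotone t ∧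
      (∀ j < m, ∑ u, D u * tent (t j) (t (j + 1)) |f u| ^ 2 = θ) ∧
      ∑ u, D u * tent (t m) (t (m + 1)) |f u| ^ 2 ≤ θ ∧ ∀ u, |f u| ≤ t (m + 1) := by
  classical
  let E : ℝ → ℝ → ℝ := fun a b => ∑ u, D u * tent a b |f u| ^ 2
  let M : ℝ := ∑ u, |f u|
  have hM : ∀ u, |f u| ≤ M := fun u =>
    single_le_sum (f := fun u => |f u|) (fun i _ => abs_nonneg _) (mem_univ u)
  have hM0 : 0 ≤ M := sum_nonneg fun u _ => abs_nonneg _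
  let nxt : ℝ → ℝ := fun a => if h : ∃ b, a ≤ b ∧ E a b = θ then h.choose else a + M
  have hn1 : ∀ a, a ≤ nxt a := by
    intro a
    simp only [nxt]
    split_ifs with h
    · exact h.choose_spec.1
    · linarith
  have hn2 : ∀ a, E a (nxt a) ≤ θ ∧ (E a (nxt a) = θ ∨ nxt a = a + M) := by
    intro a
    simp only [nxt]
    split_ifs with h
    · exact ⟨h.choose_spec.2.le, Or.inl h.choose_spec.2⟩
    · refine ⟨?_, Or.inr rfl⟩
      by_contra hcon
      rw [not_le] at hcon
      have hc : ContinuousOn (E a) (Set.Icc a (a + M)) := by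
        apply Continuous.continuousOn
        exact continuous_finsetSum _ fun u _ =>
          continuous_const.mul ((continuous_tent a _).pow 2)
      have hE : E a a = 0 := by simp [E, tent_self]
      obtain ⟨b, hb, hb'⟩ := intermediate_value_Icc (by linarith) hc
        (show θ ∈ Set.Icc (E a a) (E a (a + M)) from ⟨by rw [hE]; exact hθ.le, hcon.le⟩)
      exact h ⟨b, hb.1, hb'⟩
  let t : ℕ → ℝ := fun j => nxt^[j] 0
  have ts : ∀ j, t (j + 1) = nxt (t j) := fun j => Function.iterate_succ_apply' nxt j 0
  have t0 : t 0 = 0 := rfl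
  have tm : Monotone t := monotone_nat_of_le_succ fun j => by rw [ts]; exact hn1 _
  have hex : ∃ m, E (t m) (t (m + 1)) ≠ θ := by
    by_contra! hall
    obtain ⟨m, hm⟩ := exists_nat_gt ((∑ u, D u * |f u| ^ 2) / θ)
    have h1 : (m : ℝ) * θ ≤ ∑ u, D u * |f u| ^ 2 := by
      calc (m : ℝ) * θ = ∑ j ∈ range m, E (t j) (t (j + 1)) := by
            rw [sum_congr rfl fun j _ => hall j]; simp
        _ = ∑ u, D u * tents t m |f u| ^ 2 := by
            simp only [E]
            rw [sum_comm]
            exact sum_congr rfl fun u _ => by rw [sq_tents tm, mul_sum]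
        _ ≤ _ := sum_le_sum fun u _ => mul_le_mul_of_nonneg_left
            (pow_le_pow_left₀ (tents_nonneg tm m _) (tents_le t0 m (abs_nonneg _)) 2) (hD u)
    rw [div_lt_iff₀ hθ] at hm
    linarith
  refine ⟨Nat.find hex, t, t0, tm, fun j hj => not_not.1 (Nat.find_min hex hj), ?_, fun u => ?_⟩
  · rw [ts]; exact (hn2 _).1
  · have h1 := (hn2 (t (Nat.find hex))).2
    rw [← ts] at h1
    rw [h1.resolve_left (Nat.find_spec hex)]
    linarith [hM u, breakpoint_nonneg t0 tm (Nat.find hex)]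

end CutForm

namespace CutForm

/-! ### Levels of a function -/

variable {V : Type*}

/-- The signed indicator of the vertices at which `g` is at least `s` in absolute value. (For
`s = 0` it is the sign of `g`.) -/
def level {R : Type*} [Ring R] [LinearOrder R] (s : R) (g : V → R) (x : V) : R :=
  (if s ≤ g x then 1 else 0) - (if g x ≤ -s then 1 else 0)

lemma level_cases {R : Type*} [Ring R] [LinearOrder R] (s : R) (g : V → R) (x : V) :
    level s g x = 0 ∨ level s g x = 1 ∨ level s g x = -1 := by
  unfold level
  split_ifs <;> simp

lemma level_eq_one {s : ℝ} (hs : 0 < s) {g : V → ℝ} {x : V} (h : s ≤ g x) : level s g x = 1 := by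
  unfold level
  rw [if_pos h, if_neg (by linarith), sub_zero]

lemma level_eq_neg_one {s : ℝ} (hs : 0 < s) {g : V → ℝ} {x : V} (h : g x ≤ -s) :
    level s g x = -1 := by
  unfold level
  rw [if_pos h, if_neg (by linarith), zero_sub]

lemma level_eq_zero {s : ℝ} {g : V → ℝ} {x : V} (h : |g x| < s) : level s g x = 0 := by
  obtain ⟨h1, h2⟩ := abs_lt.1 h
  unfold level
  rw [if_neg (by linarith), if_neg (by linarith), sub_zero]

/-- A level of `g` is a level of `f` if `g` and `f` have the same signs on it and it is the set
where `|f|` is at least `s'`. -/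
lemma level_congr {s s' : ℝ} (hs : 0 < s) (hs' : 0 < s') {f g : V → ℝ}
    (h : ∀ x, s ≤ |g x| ↔ s' ≤ |f x|) (hsgn : ∀ x, s ≤ |g x| → 0 < f x * g x) :
    level s g = level s' f := by
  funext x
  by_cases hx : s ≤ |g x|
  · have hf := (h x).1 hx
    have hp := hsgn x hx
    rcases pos_and_pos_or_neg_and_neg_of_mul_pos hp with ⟨h1, h2⟩ | ⟨h1, h2⟩
    · rw [abs_of_pos h1] at hf
      rw [abs_of_pos h2] at hx
      rw [level_eq_one hs hx, level_eq_one hs' hf]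
    · rw [abs_of_neg h1] at hf
      rw [abs_of_neg h2] at hx
      rw [level_eq_neg_one hs (by linarith), level_eq_neg_one hs' (by linarith)]
  · have hf := fun h' => hx ((h x).2 h')
    rw [level_eq_zero (not_le.1 hx), level_eq_zero (not_le.1 hf)]

variable [Fintype V]

/-- A function is a positive combination of its levels, and `energyL1` as well as weighted `ℓ¹`
norms are additive over the levels. Hence an inequality between them that holds for `g` holds for
one of the levels of `g`. -/
lemma exists_level_of_energyL1_le (w : V → V → ℝ) (β : V → ℝ) {g : V → ℝ} (hg : g ≠ 0)
    (h : energyL1 w g ≤ ∑ u, β u * |g u|) :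
    ∃ u, g u ≠ 0 ∧ energyL1 w (level |g u| g) ≤ ∑ x, β x * |level (|g u|) g x| := by
  classical
  by_contra! hcon
  refine absurd h (not_le.2 ?_)
  clear h
  induction hN : #{u | g u ≠ 0} using Nat.strong_induction_on generalizing g with
  | _ N ih =>
    have hne : ({u | g u ≠ 0} : Finset V).Nonempty := by
      obtain ⟨u, hu⟩ := Function.ne_iff.1 hg
      exact ⟨u, by simpa using hu⟩
    -- Subtract the level of the least nonzero value `|g u₀|`: the support of the rest is smaller,
    -- and the levels of the rest are levels of `g`.
    obtain ⟨u₀, hu₀, hmin⟩ := exists_min_image _ (fun u => |g u|) hne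
    simp only [mem_filter, mem_univ, true_and] at hu₀ hmin
    set a := |g u₀| with ha
    have ha0 : 0 < a := abs_pos.2 hu₀
    set σ := level a g with hσ
    have hcase : ∀ x, (g x = 0 ∧ σ x = 0) ∨ (a ≤ g x ∧ σ x = 1) ∨ (g x ≤ -a ∧ σ x = -1) := by
      intro x
      by_cases hx : g x = 0
      · exact Or.inl ⟨hx, level_eq_zero (by simpa [hx] using ha0)⟩
      · rcases le_abs.1 (hmin x hx) with h1 | h1
        · exact Or.inr (Or.inl ⟨h1, level_eq_one ha0 h1⟩)
        · exact Or.inr (Or.inr ⟨by linarith, level_eq_neg_one ha0 (by linarith)⟩)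
    set g' : V → ℝ := fun x => g x - a * σ x with hg'
    have habs : ∀ x, |g x| = |g' x| + a * |σ x| := by
      intro x
      simp only [hg']
      rcases hcase x with ⟨h1, h2⟩ | ⟨h1, h2⟩ | ⟨h1, h2⟩ <;> rw [h2]
      · simp [h1]
      · rw [abs_of_nonneg (by linarith), abs_of_nonneg (by linarith)]; simp
      · rw [abs_of_nonpos (by linarith), abs_of_nonpos (by linarith)]; simp
    have habs2 : ∀ x y, |g x + g y| = |g' x + g' y| + a * |σ x + σ y| := by
      intro x y
      simp only [hg']
      rcases hcase x with ⟨h1, h2⟩ | ⟨h1, h2⟩ | ⟨h1, h2⟩ <;>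
      rcases hcase y with ⟨h3, h4⟩ | ⟨h3, h4⟩ | ⟨h3, h4⟩ <;> rw [h2, h4]
      · simp [h1, h3]
      · rw [h1, abs_of_nonneg (by linarith), abs_of_nonneg (by linarith)]; simp
      · rw [h1, abs_of_nonpos (by linarith), abs_of_nonpos (by linarith)]; simp
      · rw [h3, abs_of_nonneg (by linarith), abs_of_nonneg (by linarith)]; simp
      · rw [abs_of_nonneg (by linarith), abs_of_nonneg (by linarith)]; norm_num; ring
      · simp
      · rw [h3, abs_of_nonpos (by linarith), abs_of_nonpos (by linarith)]; simp
      · simp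
      · rw [abs_of_nonpos (by linarith), abs_of_nonpos (by linarith)]; norm_num; ring
    have e1 : energyL1 w g = energyL1 w g' + a * energyL1 w σ := by
      simp only [energyL1, habs2, mul_add, sum_add_distrib, mul_left_comm _ a, ← mul_sum]
    have e2 : ∑ u, β u * |g u| = ∑ u, β u * |g' u| + a * ∑ u, β u * |σ u| := by
      simp only [habs, mul_add, sum_add_distrib, mul_left_comm _ a, ← mul_sum]
    have h1 := mul_lt_mul_of_pos_left (hcon u₀ hu₀) ha0
    rw [e1, e2]
    by_cases hz : g' = 0
    · have z1 : energyL1 w g' = 0 := by simp [energyL1, hz]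
      have z2 : ∑ u, β u * |g' u| = 0 := by simp [hz]
      rw [z1, z2]
      simpa using h1
    · have hsup : ∀ x, g' x ≠ 0 → g x ≠ 0 := by
        intro x hx h0
        apply hx
        rcases hcase x with ⟨h1, h2⟩ | ⟨h1, h2⟩ | ⟨h1, h2⟩
        · simp [hg', h1, h2]
        · linarith
        · linarith
      have hu₀' : g' u₀ = 0 := by
        have := habs u₀
        rcases hcase u₀ with ⟨h1, h2⟩ | ⟨h1, h2⟩ | ⟨h1, h2⟩
        · exact absurd h1 hu₀
        · rw [h2, ← ha] at this; simpa using this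
        · rw [h2, ← ha] at this; simpa using this
      have hσabs : ∀ x, g x ≠ 0 → |σ x| = 1 := by
        intro x hx
        rcases hcase x with ⟨h1, h2⟩ | ⟨h1, h2⟩ | ⟨h1, h2⟩
        · exact absurd h1 hx
        · simp [h2]
        · simp [h2]
      have hlev : ∀ u, g' u ≠ 0 → level |g' u| g' = level |g u| g := by
        intro u hu
        have hu1 : 0 < |g' u| := abs_pos.2 hu
        refine level_congr hu1 (abs_pos.2 (hsup u hu)) (fun x => ?_) (fun x hx => ?_)
        · rw [habs x, habs u, hσabs u (hsup u hu)]
          by_cases hx : g x = 0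
          · have h2 : σ x = 0 := by
              rcases hcase x with ⟨_, h2⟩ | ⟨h1, _⟩ | ⟨h1, _⟩
              · exact h2
              · linarith
              · linarith
            rw [h2]
            simp only [hg', hx, h2, mul_zero, sub_zero, abs_zero, add_zero, mul_one]
            constructor <;> intro <;> linarith
          · rw [hσabs x hx]
            constructor <;> intro <;> linarith
        · have hx' : g' x ≠ 0 := abs_pos.1 (hu1.trans_le hx)
          have h3 : g' x * σ x = |g' x| := by
            simp only [hg']
            rcases hcase x with ⟨h1, h2⟩ | ⟨h1, h2⟩ | ⟨h1, h2⟩ <;> rw [h2]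
            · simp [h1]
            · rw [abs_of_nonneg (by linarith), mul_one]
            · rw [abs_of_nonpos (by linarith)]; ring
          have h4 : g x = g' x + a * σ x := by simp [hg']
          rw [h4, add_mul, mul_assoc, mul_comm (σ x), h3]
          have := abs_pos.2 hx'
          have := mul_self_nonneg (g' x)
          positivity
      have h2 := ih (#{u | g' u ≠ 0}) (by
          rw [← hN]
          refine card_lt_card ⟨fun x => by simpa using hsup x, fun hc => ?_⟩
          have := hc (show u₀ ∈ _ by simpa using hu₀)
          simp [hu₀'] at this) hz (fun u hu => by rw [hlev u hu]; exact hcon u (hsup u hu)) rfl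
      linarith

/-- The energy of a vector with entries `0`, `1`, `-1` is at most twice its `ℓ¹` energy. -/
lemma energy_level_le {w : V → V → ℝ} (hw : ∀ u v, 0 ≤ w u v) (s : ℝ) (g : V → ℝ) :
    energy w (level s g) ≤ 2 * energyL1 w (level s g) := by
  unfold energy energyL1
  rw [mul_left_comm, mul_sum univ _ (2 : ℝ)]
  refine mul_le_mul_of_nonneg_left (sum_le_sum fun u _ => ?_) (by norm_num)
  rw [mul_sum]
  refine sum_le_sum fun v _ => ?_
  rw [mul_left_comm]
  refine mul_le_mul_of_nonneg_left ?_ (hw u v)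
  rcases level_cases s g u with h | h | h <;> rcases level_cases s g v with h' | h' | h' <;>
    rw [h, h'] <;> norm_num

/-- If the transformed function satisfies an `ℓ¹` inequality, some level of the original function
satisfies it. -/
lemma exists_level_of_energyL1_bumps_le {w : V → V → ℝ} (hw : ∀ u v, 0 ≤ w u v)
    {t : ℕ → ℝ} (h0 : t 0 = 0) (ht : Monotone t) (m : ℕ) {f : V → ℝ} (β : V → ℝ)
    (hne : ∃ u, bumps t m |f u| ≠ 0)
    (h : energyL1 w (fun u => oddExt (bumps t m) (f u)) ≤ ∑ u, β u * bumps t m |f u|) :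
    ∃ u, f u ≠ 0 ∧ 2 * energy w (level |f u| f) ≤ ∑ x, 4 * β x * level (|f u|) f x ^ 2 := by
  set g : V → ℝ := fun u => oddExt (bumps t m) (f u) with hg
  have habs : ∀ x, |g x| = bumps t m |f x| := fun x =>
    abs_oddExt (fun x hx => bumps_nonneg h0 ht m hx) (f x)
  have hg0 : g ≠ 0 := by
    obtain ⟨u, hu⟩ := hne
    intro hz
    apply hu
    rw [← habs, hz]
    simp
  obtain ⟨u₀, hu₀, hlev⟩ := exists_level_of_energyL1_le w β hg0 (by simpa only [habs] using h)
  -- The level of `g` at `u₀` is the level of `f` at its vertex of least `|f|`.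
  obtain ⟨u₁, hu₁, hmin⟩ := exists_min_image ({x | |g u₀| ≤ |g x|} : Finset V) (fun x => |f x|)
    ⟨u₀, by simp⟩
  simp only [mem_filter, mem_univ, true_and] at hu₁ hmin
  have hg₀ : 0 < |g u₀| := abs_pos.2 hu₀
  have hf₁ : 0 < |f u₁| := by
    refine abs_pos.2 fun hz => ?_
    have := habs u₁
    rw [hz, abs_zero, bumps_zero h0 ht] at this
    linarith
  have heq : level |g u₀| g = level |f u₁| f := by
    refine level_congr hg₀ hf₁ (fun x => ⟨hmin x, fun hx => hu₁.trans ?_⟩) (fun x hx => ?_)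
    · rw [habs, habs]
      exact bumps_mono ht m hx
    · have hp := hg₀.trans_le hx
      have h1 : f x * g x = |f x| * |g x| := by
        rw [habs]
        simp only [hg, oddExt]
        split_ifs with hc
        · rw [abs_of_nonneg hc]
        · rw [abs_of_neg (not_le.1 hc)]; ring
      rw [h1]
      refine mul_pos (abs_pos.2 fun hz => ?_) hp
      rw [habs, hz, abs_zero, bumps_zero h0 ht] at hp
      exact lt_irrefl _ hp
  refine ⟨u₁, abs_pos.1 hf₁, ?_⟩
  rw [heq] at hlev
  have h1 := energy_level_le hw (|f u₁|) f
  have h2 : ∑ x, 4 * β x * level (|f u₁|) f x ^ 2 = 4 * ∑ x, β x * |level (|f u₁|) f x| := by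
    rw [mul_sum]
    refine sum_congr rfl fun x _ => ?_
    rcases level_cases (|f u₁|) f x with h | h | h <;> rw [h] <;> simp
  rw [h2]
  linarith

end CutForm

namespace CutForm

/-! ### Rounding in the presence of few slow parts -/

variable {V : Type*} [Fintype V]

/-- `FewSlowParts W k a`: among any `k + 1` functions with disjoint supports one has Rayleigh
quotient at least `a`. For the weights of a graph this is how a bound on the `(k + 1)`-st eigenvalue
is used. -/
def FewSlowParts (W : V → V → ℝ) (k : ℕ) (a : ℝ) : Prop :=
  ∀ ψ : Fin (k + 1) → V → ℝ, (∀ i j, i ≠ j → ∀ u, ψ i u * ψ j u = 0) →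
    (∀ i, 0 < mass W (ψ i)) → ∃ i, a * mass W (ψ i) ≤ energy W (ψ i)

/-- All but `k` of the functions with disjoint supports have large energy. -/
lemma FewSlowParts.sum_energy_ge {W : V → V → ℝ} (hW : ∀ u v, 0 ≤ W u v) {k : ℕ} {a θ : ℝ}
    (h : FewSlowParts W k a) (ha : 0 ≤ a) (hθ : 0 < θ) (m : ℕ) (ψ : ℕ → V → ℝ)
    (hdisj : ∀ i j, i ≠ j → ∀ u, ψ i u * ψ j u = 0) (hmass : ∀ j < m, mass W (ψ j) = θ) :
    ((m : ℝ) - k) * (a * θ) ≤ ∑ j ∈ range m, energy W (ψ j) := by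
  classical
  set J := (range m).filter fun j => energy W (ψ j) < a * θ with hJ
  have hcard : #J ≤ k := by
    by_contra! hc
    obtain ⟨e⟩ : Nonempty (Fin (k + 1) ↪ J) := Function.Embedding.nonempty_of_card_le (by
      simpa using hc)
    have hm : ∀ i, (e i : ℕ) < m := fun i => by
      have := (e i).2
      simp only [hJ, mem_filter, mem_range] at this
      exact this.1
    obtain ⟨i, hi⟩ := h (fun i => ψ (e i))
      (fun i j hij => hdisj _ _ fun hc => hij (e.injective (Subtype.ext hc)))
      (fun i => by rw [hmass _ (hm i)]; exact hθ)
    rw [hmass _ (hm i)] at hi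
    have := (e i).2
    simp only [hJ, mem_filter, mem_range] at this
    linarith [this.2]
  have haθ : 0 ≤ a * θ := by positivity
  rw [← sum_filter_add_sum_filter_not (range m) fun j => energy W (ψ j) < a * θ]
  have h1 : 0 ≤ ∑ j ∈ J, energy W (ψ j) := sum_nonneg fun j _ => energy_nonneg hW _
  set J' := (range m).filter fun j => ¬ energy W (ψ j) < a * θ with hJ'
  have h2 : (#J' : ℝ) * (a * θ) ≤ ∑ j ∈ J', energy W (ψ j) := by
    rw [← nsmul_eq_mul]
    refine card_nsmul_le_sum _ _ _ fun j hj => ?_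
    simp only [hJ', mem_filter, not_lt] at hj
    exact hj.2
  have h3 : #J + #J' = m := by
    have := card_filter_add_card_filter_not (s := range m) fun j => energy W (ψ j) < a * θ
    rwa [card_range] at this
  have h4 : (m : ℝ) - k ≤ #J' := by
    have h5 : (#J : ℝ) + #J' = m := by exact_mod_cast h3
    have h6 : (#J : ℝ) ≤ k := by exact_mod_cast hcard
    linarith
  have := mul_le_mul_of_nonneg_right h4 haθ
  linarith

lemma sum_energy_oddExt_tent_le {w : V → V → ℝ} (hw : ∀ u v, 0 ≤ w u v) {t : ℕ → ℝ} (h0 : t 0 = 0)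
    (ht : Monotone t) (m : ℕ) (f : V → ℝ) :
    ∑ j ∈ range m, energy w (fun u => oddExt (tent (t j) (t (j + 1))) (f u)) ≤ energy w f := by
  unfold energy
  rw [← mul_sum, sum_comm]
  refine mul_le_mul_of_nonneg_left (sum_le_sum fun u _ => ?_) (by norm_num)
  rw [sum_comm]
  refine sum_le_sum fun v _ => ?_
  rw [← mul_sum]
  exact mul_le_mul_of_nonneg_left (sum_sq_oddExt_tent_add_le h0 ht m _ _) (hw u v)

/-- Rounding a function of small Rayleigh quotient for the remaining weights `w`, when the original
weights `W ≥ w` have few slow parts. The weight that `W` has in excess of `w` was paid for already,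
and half of it may be spent. The number of breakpoints that the function needs is either `O(k)`, in
which case it is close to a step function and rounding between the steps is cheap, or so large that
the slow parts have much excess weight, which pays for everything. -/
theorem exists_level_of_fewSlowParts {w W : V → V → ℝ} (hw : ∀ u v, 0 ≤ w u v)
    (hle : ∀ u v, w u v ≤ W u v) (hs : ∀ u v, w u v = w v u) (hS : ∀ u v, W u v = W v u)
    {k : ℕ} (hk : 1 ≤ k) {α : ℝ} (hα : 0 < α) (hα2 : α ≤ 2) (hspec : FewSlowParts W k (α / 2))
    {f : V → ℝ} (hf : 0 < mass w f) {ρ : ℝ} (hρ : 0 < ρ) (hfρ : energy w f ≤ ρ * mass w f) :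
    ∃ u, f u ≠ 0 ∧ 2 * energy w (level |f u| f)
      ≤ ∑ x, (rowSum W x - rowSum w x) * level (|f u|) f x ^ 2
        + 144 * (2 ^ 16 + 1) * (k * ρ / α) * mass w (level |f u| f) := by
  set F := mass w f with hF
  set K : ℝ := 2 ^ 16 with hK
  have hk' : (1 : ℝ) ≤ k := by exact_mod_cast hk
  -- The squared distance per interval is chosen such that `m` intervals with `m > 2 * k`, of which
  -- half have energy at least `α * θ / 2`, cannot be paid for by the energy of `f`.
  set θ : ℝ := K * ρ * F / (k * α ^ 2) with hθdef
  have hθ : 0 < θ := by positivity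
  have hkθ : k * α ^ 2 * θ = K * ρ * F := by rw [hθdef]; field_simp
  have hW : ∀ u v, 0 ≤ W u v := fun u v => (hw u v).trans (hle u v)
  obtain ⟨m, t, h0, ht, hpiece, hlast, hcov⟩ :=
    exists_breakpoints (D := rowSum W) (rowSum_nonneg hW) f hθ
  set ϕ : V → ℝ := fun u => tents t (m + 1) |f u| with hϕ
  set h : V → ℝ := fun u => bumps t (m + 1) |f u| with hh
  have hh0 : ∀ u, 0 ≤ h u := fun u => bumps_nonneg h0 ht _ (abs_nonneg _)
  have hd0 := rowSum_nonneg hw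
  have hb0 : ∀ u, 0 ≤ rowSum W u - rowSum w u := fun u =>
    sub_nonneg.2 (sum_le_sum fun v _ => hle u v)
  set B : ℝ := ∑ u, (rowSum W u - rowSum w u) * ϕ u ^ 2 with hB
  have hB0 : 0 ≤ B := sum_nonneg fun u _ => mul_nonneg (hb0 u) (sq_nonneg _)
  -- The total squared distance to the breakpoints.
  have hErrW : ∑ u, rowSum W u * ϕ u ^ 2 ≤ (m + 1) * θ := by
    calc ∑ u, rowSum W u * ϕ u ^ 2
        = ∑ j ∈ range (m + 1), ∑ u, rowSum W u * tent (t j) (t (j + 1)) |f u| ^ 2 := by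
          rw [sum_comm]
          exact sum_congr rfl fun u _ => by rw [hϕ]; simp only; rw [sq_tents ht, mul_sum]
      _ ≤ ∑ j ∈ range (m + 1), θ := by
          refine sum_le_sum fun j hj => ?_
          rcases Nat.lt_succ_iff_lt_or_eq.1 (mem_range.1 hj) with hj | rfl
          · exact (hpiece j hj).le
          · exact hlast
      _ = (m + 1) * θ := by simp
  have hErr : ∑ u, rowSum w u * ϕ u ^ 2 ≤ (m + 1) * θ :=
    (sum_le_sum fun u _ => mul_le_mul_of_nonneg_right (sub_nonneg.1 (hb0 u)) (sq_nonneg _)).trans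
      hErrW
  have hFh : F ≤ 4 * (m + 1) * ∑ u, rowSum w u * h u := by
    rw [hF, mass, mul_sum]
    refine sum_le_sum fun u _ => ?_
    have := sq_le_bumps h0 ht (m + 1) (abs_nonneg (f u)) (hcov u)
    rw [sq_abs] at this
    push_cast at this
    calc rowSum w u * f u ^ 2 ≤ rowSum w u * (4 * (m + 1) * h u) :=
          mul_le_mul_of_nonneg_left this (hd0 u)
      _ = _ := by ring
  have hBh : B ≤ 2 * ∑ u, (rowSum W u - rowSum w u) * h u := by
    rw [hB, mul_sum]
    refine sum_le_sum fun u _ => ?_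
    have := sq_tents_le_bumps ht (m + 1) |f u|
    calc _ ≤ (rowSum W u - rowSum w u) * (2 * h u) :=
          mul_le_mul_of_nonneg_left (by simp only [hϕ, hh]; linarith) (hb0 u)
      _ = _ := by ring
  set P : ℝ := ∑ u, rowSum w u * h u with hP
  set R : ℝ := ∑ u, (rowSum W u - rowSum w u) * h u with hR
  have hP0 : 0 ≤ P := sum_nonneg fun u _ => mul_nonneg (hd0 u) (hh0 u)
  have hR0 : 0 ≤ R := sum_nonneg fun u _ => mul_nonneg (hb0 u) (hh0 u)
  have hne : ∃ u, h u ≠ 0 := by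
    by_contra! hz
    have : P = 0 := by simp [hP, hz]
    rw [this, mul_zero] at hFh
    linarith
  -- The inequality for the transformed function.
  have key : energyL1 w (fun u => oddExt (bumps t (m + 1)) (f u))
      ≤ 1 / 4 * R + 36 * (K + 1) * (k * ρ / α) * P := by
    have hgen := fun lam (hl : 0 < lam) => energyL1_bumps_le hw hs h0 ht (m + 1) f hl
    have hα1 : 1 ≤ 2 / α := by rw [le_div_iff₀ hα]; linarith
    have hρF : 0 < ρ * F := mul_pos hρ hf
    have hEn := energy_nonneg hw f
    by_cases hm : m ≤ 2 * k
    · have hm' : (m : ℝ) ≤ 2 * k := by exact_mod_cast hm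
      -- Few breakpoints: the total squared distance is `O(k * θ)`, which is `O(ρ * F / α ^ 2)`.
      refine (hgen (1 / α) (by positivity)).trans ?_
      have h1 : (∑ u, rowSum w u * ϕ u ^ 2) / (1 / α) ≤ 3 * K * ρ * F / α := by
        rw [div_div_eq_mul_div, div_one, le_div_iff₀ hα]
        calc (∑ u, rowSum w u * ϕ u ^ 2) * α * α ≤ ((m + 1) * θ) * α * α := by gcongr
          _ ≤ ((3 * k) * θ) * α * α := by gcongr; linarith
          _ = 3 * (k * α ^ 2 * θ) := by ring
          _ = _ := by rw [hkθ]; ring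
      have h2 : (1 + 1 / α / 2) * energy w f ≤ 3 * ρ * F / α := by
        calc (1 + 1 / α / 2) * energy w f ≤ (2 / α + 1 / α / 2) * (ρ * F) := by gcongr
          _ = 2.5 * ρ * F / α := by ring
          _ ≤ _ := by gcongr; norm_num
      have h3 : F ≤ 12 * k * P := hFh.trans (by
        apply mul_le_mul_of_nonneg_right _ hP0
        linarith)
      calc _ ≤ 3 * ρ * F / α + 3 * K * ρ * F / α := add_le_add h2 h1
        _ = 3 * (K + 1) * ρ / α * F := by ring
        _ ≤ 3 * (K + 1) * ρ / α * (12 * k * P) := by gcongr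
        _ = 36 * (K + 1) * (k * ρ / α) * P := by ring
        _ ≤ _ := by linarith
    · rw [not_le] at hm
      have hm' : 2 * (k : ℝ) ≤ m := by exact_mod_cast hm.le
      have hm1 : (1 : ℝ) ≤ m := by linarith
      -- Most of the pieces of `f` have large energy for `W`.
      have hBm : m * α * θ ≤ 16 * B := by
        have h1 := hspec.sum_energy_ge hW (by positivity) hθ m
          (fun j u => oddExt (tent (t j) (t (j + 1))) (f u)) ?_ ?_
        · have h2 : ∑ j ∈ range m, energy W (fun u => oddExt (tent (t j) (t (j + 1))) (f u))
              ≤ energy w f + 2 * B := by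
            calc _ ≤ ∑ j ∈ range m, (energy w (fun u => oddExt (tent (t j) (t (j + 1))) (f u))
                  + 2 * ∑ u, (rowSum W u - rowSum w u) *
                    oddExt (tent (t j) (t (j + 1))) (f u) ^ 2) :=
                  sum_le_sum fun j _ => energy_le_energy_add hle hs hS _
              _ ≤ _ := by
                  rw [sum_add_distrib]
                  refine add_le_add (sum_energy_oddExt_tent_le hw h0 ht m f) ?_
                  rw [← mul_sum, sum_comm]
                  refine mul_le_mul_of_nonneg_left (sum_le_sum fun u _ => ?_) (by norm_num)
                  rw [← mul_sum]
                  refine mul_le_mul_of_nonneg_left ?_ (hb0 u)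
                  simp only [hϕ]
                  rw [sq_tents ht, sum_range_succ]
                  refine le_add_of_le_of_nonneg (sum_le_sum fun j _ => ?_) (sq_nonneg _)
                  rw [← sq_abs, abs_oddExt fun x _ => tent_nonneg (breakpoint_le_succ ht j) x]
          have h3 : (m : ℝ) / 2 ≤ m - k := by linarith
          have h4 : (m : ℝ) / 2 * (α / 2 * θ) ≤ (m - k) * (α / 2 * θ) := by gcongr
          have h5 : 8 * (ρ * F) ≤ m * α * θ / 2 := by
            have : 2 * (k * α ^ 2 * θ) ≤ 2 * (m * α * θ) := by
              have : (2 * k) * (α * α * θ) ≤ m * (2 * α * θ) := by gcongr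
              linarith
            rw [hkθ] at this
            have : 16 * (ρ * F) ≤ K * ρ * F := by
              rw [mul_assoc]; gcongr; norm_num [hK]
            linarith
          nlinarith
        · intro i j hij u
          have hgen2 : ∀ i j, i < j → tent (t i) (t (i + 1)) |f u| *
              tent (t j) (t (j + 1)) |f u| = 0 := fun i j hij =>
            tent_mul_tent (breakpoint_le_succ ht i) (ht hij) (breakpoint_le_succ ht j) _
          rw [← abs_eq_zero, abs_mul,
            abs_oddExt fun x _ => tent_nonneg (breakpoint_le_succ ht i) x,
            abs_oddExt fun x _ => tent_nonneg (breakpoint_le_succ ht j) x]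
          rcases lt_or_gt_of_ne hij with hlt | hlt
          · exact hgen2 i j hlt
          · rw [mul_comm]; exact hgen2 j i hlt
        · intro j hj
          rw [← hpiece j hj, mass]
          refine sum_congr rfl fun u _ => ?_
          rw [← sq_abs, abs_oddExt fun x _ => tent_nonneg (breakpoint_le_succ ht j) x]
      have hρB : ρ * F ≤ 8 * α * B / K := by
        rw [le_div_iff₀ (by positivity)]
        have : (2 * k) * (α ^ 2 * θ) ≤ m * (α ^ 2 * θ) := by gcongr
        have h2 : α * (m * α * θ) ≤ α * (16 * B) := by gcongr
        nlinarith [hkθ]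
      refine (hgen (512 / α) (by positivity)).trans ?_
      have h1 : (∑ u, rowSum w u * ϕ u ^ 2) / (512 / α) ≤ B / 16 := by
        rw [div_div_eq_mul_div, div_le_iff₀ (by norm_num)]
        calc (∑ u, rowSum w u * ϕ u ^ 2) * α ≤ ((m + 1) * θ) * α := by gcongr
          _ ≤ ((m + m) * θ) * α := by gcongr
          _ = 2 * (m * α * θ) := by ring
          _ ≤ B / 16 * 512 := by linarith
      have h2 : (1 + 512 / α / 2) * energy w f ≤ B / 16 := by
        calc (1 + 512 / α / 2) * energy w f ≤ (1 + 512 / α / 2) * (8 * α * B / K) := by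
              gcongr; exact hfρ.trans hρB
          _ = (8 * (α + 256)) / K * B := by field_simp; ring
          _ ≤ (1 / 16) * B := by
              refine mul_le_mul_of_nonneg_right ?_ hB0
              rw [div_le_iff₀ (by positivity), hK]
              linarith
          _ = _ := by ring
      have h3 : 0 ≤ 36 * (K + 1) * (k * ρ / α) * P := by positivity
      linarith
  obtain ⟨u, hu, hlev⟩ := exists_level_of_energyL1_bumps_le hw h0 ht (m + 1)
    (fun u => 1 / 4 * (rowSum W u - rowSum w u) + 36 * (K + 1) * (k * ρ / α) * rowSum w u)
    (f := f) hne (by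
      refine key.trans_eq ?_
      simp only [add_mul, sum_add_distrib, hR, hP, mul_sum, mul_assoc, hh])
  refine ⟨u, hu, hlev.trans_eq ?_⟩
  rw [mass, mul_sum, ← sum_add_distrib]
  exact sum_congr rfl fun x _ => by ring

/-- Rounding by a random threshold, as in Cheeger's inequality: one breakpoint. -/
theorem exists_level_of_energy_le_sq {w : V → V → ℝ} (hw : ∀ u v, 0 ≤ w u v)
    (hs : ∀ u v, w u v = w v u) {f : V → ℝ} (hf : 0 < mass w f) {η : ℝ} (hη : 0 < η) (hη1 : η ≤ 1)
    (hfη : energy w f ≤ η ^ 2 * mass w f) :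
    ∃ u, f u ≠ 0 ∧ 2 * energy w (level |f u| f) ≤ 48 * η * mass w (level |f u| f) := by
  set M : ℝ := ∑ u, |f u|
  have hM : ∀ u, |f u| ≤ M := fun u =>
    single_le_sum (f := fun u => |f u|) (fun i _ => abs_nonneg _) (mem_univ u)
  have hM0 : 0 ≤ M := sum_nonneg fun u _ => abs_nonneg _
  set t : ℕ → ℝ := fun j => j * M
  have h0 : t 0 = 0 := by simp [t]
  have ht : Monotone t := fun i j hij =>
    mul_le_mul_of_nonneg_right (Nat.cast_le.2 hij) hM0
  have ht1 : t 1 = M := by simp [t]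
  have hd0 := rowSum_nonneg hw
  have h1 := energyL1_bumps_le hw hs h0 ht 1 f (one_div_pos.2 hη)
  have h2 : ∑ u, rowSum w u * tents t 1 |f u| ^ 2 ≤ mass w f := by
    refine sum_le_sum fun u _ => mul_le_mul_of_nonneg_left ?_ (hd0 u)
    rw [← sq_abs (f u)]
    exact pow_le_pow_left₀ (tents_nonneg ht 1 _) (tents_le h0 1 (abs_nonneg _)) 2
  have h3 : mass w f ≤ 4 * ∑ u, rowSum w u * bumps t 1 |f u| := by
    rw [mass, mul_sum]
    refine sum_le_sum fun u _ => ?_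
    have := sq_le_bumps h0 ht 1 (abs_nonneg (f u)) (by rw [ht1]; exact hM u)
    rw [sq_abs] at this
    push_cast at this
    calc rowSum w u * f u ^ 2 ≤ rowSum w u * (4 * 1 * bumps t 1 |f u|) :=
          mul_le_mul_of_nonneg_left this (hd0 u)
      _ = _ := by ring
  have hne : ∃ u, bumps t 1 |f u| ≠ 0 := by
    by_contra! hz
    simp only [hz, mul_zero, sum_const_zero] at h3
    linarith
  have key : energyL1 w (fun u => oddExt (bumps t 1) (f u)) ≤ 3 * η * mass w f := by
    refine h1.trans ?_
    calc _ ≤ (1 + 1 / η / 2) * (η ^ 2 * mass w f) + mass w f / (1 / η) := by gcongr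
      _ = (η ^ 2 + η / 2 + η) * mass w f := by field_simp
      _ ≤ _ := by
        apply mul_le_mul_of_nonneg_right _ hf.le
        nlinarith
  obtain ⟨u, hu, hlev⟩ := exists_level_of_energyL1_bumps_le hw h0 ht 1
    (fun u => 12 * η * rowSum w u) (f := f) hne (by
      refine key.trans ?_
      calc 3 * η * mass w f ≤ 3 * η * (4 * ∑ u, rowSum w u * bumps t 1 |f u|) := by gcongr
        _ = _ := by
          rw [mul_sum, mul_sum]
          exact sum_congr rfl fun u _ => by ring)
  refine ⟨u, hu, hlev.trans_eq ?_⟩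
  rw [mass, mul_sum]
  exact sum_congr rfl fun x _ => by ring

end CutForm

namespace CutForm

/-! ### Eigenvalues and functions with disjoint supports -/

variable {V : Type*} [Fintype V]

lemma exists_eq_zero_of_ne {ι : Type*} [Nonempty ι] {a : ι → ℝ}
    (h : ∀ i j, i ≠ j → a i * a j = 0) : ∃ i, ∀ j, j ≠ i → a j = 0 := by
  by_cases hz : ∃ i, a i ≠ 0
  · obtain ⟨i, hi⟩ := hz
    exact ⟨i, fun j hj => (mul_eq_zero.1 (h j i hj)).resolve_right hi⟩
  · push Not at hz
    exact ⟨Classical.arbitrary ι, fun j _ => hz j⟩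

lemma sq_sum_add_sum_le {ι : Type*} [Fintype ι] [Nonempty ι] {a b : ι → ℝ}
    (ha : ∀ i j, i ≠ j → a i * a j = 0) (hb : ∀ i j, i ≠ j → b i * b j = 0) :
    (∑ i, a i + ∑ i, b i) ^ 2 ≤ 2 * ∑ i, (a i + b i) ^ 2 := by
  classical
  obtain ⟨i, hi⟩ := exists_eq_zero_of_ne ha
  obtain ⟨j, hj⟩ := exists_eq_zero_of_ne hb
  rw [sum_eq_single i (fun x _ hx => hi x hx) (by simp),
    sum_eq_single j (fun x _ hx => hj x hx) (by simp)]
  by_cases hij : i = j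
  · subst hij
    have := single_le_sum (f := fun x => (a x + b x) ^ 2) (fun x _ => sq_nonneg _) (mem_univ i)
    nlinarith [sq_nonneg (a i + b i)]
  · have : ∑ x ∈ {i, j}, (a x + b x) ^ 2 ≤ ∑ x, (a x + b x) ^ 2 :=
      sum_le_sum_of_subset_of_nonneg (subset_univ _) fun x _ _ => sq_nonneg _
    rw [sum_pair hij, hi j (Ne.symm hij), hj i hij] at this
    nlinarith [sq_nonneg (a i - b j)]

/-- An edge meets at most two of several functions with disjoint supports. -/
lemma energy_sum_le {w : V → V → ℝ} (hw : ∀ u v, 0 ≤ w u v) {k : ℕ} {ψ : Fin (k + 1) → V → ℝ}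
    (hψ : ∀ i j, i ≠ j → ∀ u, ψ i u * ψ j u = 0) (c : Fin (k + 1) → ℝ) :
    energy w (fun u => ∑ i, c i * ψ i u) ≤ 2 * ∑ i, c i ^ 2 * energy w (ψ i) := by
  have h1 : ∀ u v, w u v * (∑ i, c i * ψ i u + ∑ i, c i * ψ i v) ^ 2
      ≤ ∑ i, 2 * c i ^ 2 * (w u v * (ψ i u + ψ i v) ^ 2) := by
    intro u v
    have hd : ∀ u i j, i ≠ j → c i * ψ i u * (c j * ψ j u) = 0 := fun u i j hij => by
      rw [mul_mul_mul_comm, hψ i j hij u, mul_zero]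
    refine (mul_le_mul_of_nonneg_left (sq_sum_add_sum_le (hd u) (hd v)) (hw u v)).trans_eq ?_
    rw [mul_sum, mul_sum]
    exact sum_congr rfl fun i _ => by ring
  unfold energy
  calc _ ≤ 1 / 2 * ∑ u, ∑ v, ∑ i, 2 * c i ^ 2 * (w u v * (ψ i u + ψ i v) ^ 2) :=
        mul_le_mul_of_nonneg_left (sum_le_sum fun u _ => sum_le_sum fun v _ => h1 u v) (by norm_num)
    _ = _ := by
        have : ∀ u, ∑ v, ∑ i, 2 * c i ^ 2 * (w u v * (ψ i u + ψ i v) ^ 2) =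
            ∑ i, ∑ v, 2 * c i ^ 2 * (w u v * (ψ i u + ψ i v) ^ 2) := fun u => sum_comm
        simp only [this]
        rw [sum_comm]
        simp only [mul_sum]
        refine sum_congr rfl fun i _ => sum_congr rfl fun u _ => sum_congr rfl fun v _ => by ring

lemma mass_sum {w : V → V → ℝ} {k : ℕ} {ψ : Fin (k + 1) → V → ℝ}
    (hψ : ∀ i j, i ≠ j → ∀ u, ψ i u * ψ j u = 0) (c : Fin (k + 1) → ℝ) :
    mass w (fun u => ∑ i, c i * ψ i u) = ∑ i, c i ^ 2 * mass w (ψ i) := by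
  simp only [mass, mul_sum]
  rw [sum_comm]
  refine sum_congr rfl fun u _ => ?_
  rw [sq, sum_mul_sum, mul_sum]
  refine sum_congr rfl fun i _ => ?_
  rw [sum_eq_single i _ (by simp)]
  · ring
  · intro j _ hij
    rw [mul_mul_mul_comm, hψ i j (Ne.symm hij) u, mul_zero]

lemma energy_const_mul (c : ℝ) (w : V → V → ℝ) (f : V → ℝ) :
    energy (fun u v => c * w u v) f = c * energy w f := by
  simp only [energy, mul_sum]
  exact sum_congr rfl fun u _ => sum_congr rfl fun v _ => by ring

lemma mass_const_mul (c : ℝ) (w : V → V → ℝ) (f : V → ℝ) :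
    mass (fun u v => c * w u v) f = c * mass w f := by
  simp only [mass, rowSum, mul_sum, sum_mul]
  exact sum_congr rfl fun u _ => sum_congr rfl fun v _ => by ring

lemma FewSlowParts.const_mul {w : V → V → ℝ} {k : ℕ} {a : ℝ} (h : FewSlowParts w k a) {c : ℝ}
    (hc : 0 < c) : FewSlowParts (fun u v => c * w u v) k a := by
  intro ψ hψ hm
  simp only [mass_const_mul, energy_const_mul] at hm ⊢
  obtain ⟨i, hi⟩ := h ψ hψ fun i => pos_of_mul_pos_right (hm i) hc.le
  exact ⟨i, by nlinarith [mul_le_mul_of_nonneg_left hi hc.le]⟩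

lemma energy_eq_mass_add {w : V → V → ℝ} (hs : ∀ u v, w u v = w v u) (f : V → ℝ) :
    energy w f = mass w f + ∑ u, ∑ v, w u v * (f u * f v) := by
  have h : ∀ u v, w u v * (f u + f v) ^ 2
      = w u v * f u ^ 2 + w u v * f v ^ 2 + 2 * (w u v * (f u * f v)) := fun u v => by ring
  simp only [energy, h, sum_add_distrib, ← mul_sum]
  rw [sum_pair_left w (fun u => f u ^ 2), sum_pair_right hs (fun u => f u ^ 2), mass]
  ring

end CutForm

namespace WGraph

open CutForm

variable {n : ℕ} (G : WGraph n)

/-- The weights as real numbers. -/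
def realW (u v : Fin n) : ℝ := G.w u v

lemma realW_nonneg (u v : Fin n) : 0 ≤ G.realW u v := Rat.cast_nonneg.2 (G.nonneg u v)

lemma realW_symm (u v : Fin n) : G.realW u v = G.realW v u := by rw [realW, realW, G.symm]

lemma rowSum_realW (u : Fin n) : rowSum G.realW u = G.deg u := by
  simp only [rowSum, realW, deg, Rat.cast_sum]
  exact sum_congr rfl fun v _ => by rw [G.symm]

lemma deg_pos (u : Fin n) : 0 < G.deg u := by
  obtain ⟨v, hv⟩ := G.no_isolated u
  exact (lt_of_le_of_ne (G.nonneg v u) hv.symm).trans_le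
    (single_le_sum (f := fun v => G.w v u) (fun i _ => G.nonneg i u) (mem_univ v))

lemma dotProduct_normalizedLaplacian (f : Fin n → ℝ) :
    (fun u => Real.sqrt (G.deg u) * f u) ⬝ᵥ
        (G.normalizedLaplacian.mulVec fun u => Real.sqrt (G.deg u) * f u)
      = 2 * mass G.realW f - energy G.realW f := by
  have hd : ∀ u, 0 < Real.sqrt (G.deg u : ℝ) := fun u =>
    Real.sqrt_pos.2 (Rat.cast_pos.2 (G.deg_pos u))
  have h1 : (G.normalizedLaplacian.mulVec fun u => Real.sqrt (G.deg u) * f u)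
      = fun u => Real.sqrt (G.deg u) * f u
        - (Real.sqrt (G.deg u : ℝ))⁻¹ * ∑ v, G.realW u v * f v := by
    funext u
    rw [normalizedLaplacian, Matrix.sub_mulVec, Matrix.one_mulVec, Pi.sub_apply]
    congr 1
    rw [Matrix.mulVec, dotProduct, mul_sum]
    refine sum_congr rfl fun v _ => ?_
    rw [invSqrtDeg, Matrix.mul_diagonal, Matrix.diagonal_mul, adj, Matrix.of_apply, realW]
    field_simp [(hd v).ne']
  rw [h1, energy_eq_mass_add G.realW_symm, mass, dotProduct]
  have h2 : ∀ u, Real.sqrt (G.deg u) * f u * (Real.sqrt (G.deg u) * f u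
        - (Real.sqrt (G.deg u : ℝ))⁻¹ * ∑ v, G.realW u v * f v)
      = rowSum G.realW u * f u ^ 2 - ∑ v, G.realW u v * (f u * f v) := by
    intro u
    rw [rowSum_realW]
    have e1 : Real.sqrt (G.deg u) * Real.sqrt (G.deg u) = (G.deg u : ℝ) :=
      Real.mul_self_sqrt (Rat.cast_nonneg.2 (G.deg_pos u).le)
    have e2 : Real.sqrt (G.deg u : ℝ) * (Real.sqrt (G.deg u : ℝ))⁻¹ = 1 :=
      mul_inv_cancel₀ (hd u).ne'
    have e3 : ∑ v, G.realW u v * (f u * f v) = f u * ∑ v, G.realW u v * f v := by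
      rw [mul_sum]; exact sum_congr rfl fun v _ => by ring
    rw [e3]
    linear_combination f u ^ 2 * e1 - (f u * ∑ v, G.realW u v * f v) * e2
  simp only [h2, sum_sub_distrib]
  ring

/-- The eigenvalue `λ_{n-k}` bounds the Rayleigh quotients of `k + 1` functions with disjoint
supports: a combination of them is orthogonal to the eigenvectors of the `k` largest eigenvalues. -/
theorem fewSlowParts {k : ℕ} (hk : k < n) :
    FewSlowParts G.realW k ((2 - G.lam (n - k)) / 2) := by
  intro ψ hψ hm
  by_contra! hcon
  set hA := G.normalizedLaplacian_isHermitian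
  set A := G.normalizedLaplacian with hAdef
  have hcard : Fintype.card (Fin n) = n := Fintype.card_fin n
  have hlam : G.lam (n - k) = hA.eigenvalues₀ ⟨k, by omega⟩ := by
    rw [lam, dif_pos ⟨by omega, by omega⟩]
    congr 2
    omega
  set b := hA.eigenvectorBasis
  set e : Fin (Fintype.card (Fin n)) ≃ Fin n := Fintype.equivOfCardEq (Fintype.card_fin _)
  let Y : (Fin (k + 1) → ℝ) → Fin n → ℝ := fun c u => Real.sqrt (G.deg u) * ∑ i, c i * ψ i u
  let L : (Fin (k + 1) → ℝ) →ₗ[ℝ] (Fin k → ℝ) :=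
    { toFun := fun c i => Y c ⬝ᵥ ⇑(b (e ⟨i, by omega⟩))
      map_add' := by
        intro c c'
        funext i
        simp only [Y, dotProduct, Pi.add_apply, add_mul, mul_add, sum_add_distrib]
      map_smul' := by
        intro r c
        funext i
        simp only [Y, dotProduct, Pi.smul_apply, smul_eq_mul, RingHom.id_apply, mul_sum, sum_mul]
        exact sum_congr rfl fun u _ => sum_congr rfl fun j _ => by ring }
  have hker : LinearMap.ker L ≠ ⊥ := LinearMap.ker_ne_bot_of_finrank_lt (by simp)
  obtain ⟨c, hc, hc0⟩ := (Submodule.ne_bot_iff _).1 hker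
  have hcL : ∀ i : Fin k, Y c ⬝ᵥ ⇑(b (e ⟨i, by omega⟩)) = 0 := fun i =>
    congrFun (LinearMap.mem_ker.1 hc) i
  set y := Y c with hy
  have hinner : ∀ p q : EuclideanSpace ℝ (Fin n), inner ℝ p q = (p : Fin n → ℝ) ⬝ᵥ q := by
    intro p q
    rw [EuclideanSpace.inner_eq_star_dotProduct, dotProduct_comm]
    rfl
  have hparse : ∀ q : Fin n → ℝ, y ⬝ᵥ q = ∑ i, (y ⬝ᵥ ⇑(b i)) * (⇑(b i) ⬝ᵥ q) := by
    intro q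
    have := b.sum_inner_mul_inner (WithLp.toLp 2 y) (WithLp.toLp 2 q)
    simp only [hinner] at this
    exact this.symm
  have hAy : y ⬝ᵥ A.mulVec y = ∑ i, hA.eigenvalues i * (y ⬝ᵥ ⇑(b i)) ^ 2 := by
    rw [hparse]
    refine sum_congr rfl fun i _ => ?_
    have h1 : ⇑(b i) ⬝ᵥ A.mulVec y = A.mulVec ⇑(b i) ⬝ᵥ y := by
      rw [Matrix.dotProduct_mulVec, ← Matrix.mulVec_transpose]
      congr 2
    rw [h1, hA.mulVec_eigenvectorBasis, smul_dotProduct, dotProduct_comm, smul_eq_mul]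
    ring
  have hle : y ⬝ᵥ A.mulVec y ≤ G.lam (n - k) * (y ⬝ᵥ y) := by
    rw [hAy, hparse y, mul_sum]
    refine sum_le_sum fun i _ => ?_
    rw [dotProduct_comm ⇑(b i) y, ← sq]
    by_cases hi : (e.symm i : ℕ) < k
    · have h0 := hcL ⟨e.symm i, hi⟩
      simp only [Fin.eta, Equiv.apply_symm_apply] at h0
      rw [h0]
      simp
    · refine mul_le_mul_of_nonneg_right ?_ (sq_nonneg _)
      rw [hlam]
      exact hA.eigenvalues₀_antitone (Fin.mk_le_of_le_val (not_lt.1 hi))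
  have hyy : y ⬝ᵥ y = mass G.realW fun u => ∑ i, c i * ψ i u := by
    rw [mass, dotProduct]
    refine sum_congr rfl fun u _ => ?_
    rw [rowSum_realW]
    have e1 : Real.sqrt (G.deg u) * Real.sqrt (G.deg u) = (G.deg u : ℝ) :=
      Real.mul_self_sqrt (Rat.cast_nonneg.2 (G.deg_pos u).le)
    simp only [hy, Y]
    linear_combination (∑ i, c i * ψ i u) ^ 2 * e1
  have hq := G.dotProduct_normalizedLaplacian fun u => ∑ i, c i * ψ i u
  change y ⬝ᵥ A.mulVec y = _ at hq
  rw [hq, hyy] at hle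
  have h1 := energy_sum_le G.realW_nonneg hψ c
  rw [mass_sum hψ c] at hle
  obtain ⟨i₀, hi₀⟩ := Function.ne_iff.1 hc0
  have h2 : ∑ i, c i ^ 2 * energy G.realW (ψ i)
      < ∑ i, c i ^ 2 * ((2 - G.lam (n - k)) / 2 * mass G.realW (ψ i)) := by
    refine sum_lt_sum (fun i _ => mul_le_mul_of_nonneg_left (hcon i).le (sq_nonneg _))
      ⟨i₀, mem_univ _, mul_lt_mul_of_pos_left (hcon i₀)
        (lt_of_le_of_ne (sq_nonneg _) (pow_ne_zero 2 hi₀).symm)⟩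
  have h3 : ∑ i, c i ^ 2 * ((2 - G.lam (n - k)) / 2 * mass G.realW (ψ i))
      = (2 - G.lam (n - k)) / 2 * ∑ i, c i ^ 2 * mass G.realW (ψ i) := by
    rw [mul_sum]; exact sum_congr rfl fun i _ => by ring
  rw [h3] at h2
  linarith

/-- `FewSlowParts` for single vertices bounds the constant, because edges have two ends. -/
lemma two_sub_lam_le_two {k : ℕ} (hk : k < n) : 2 - G.lam (n - k) ≤ 2 := by
  classical
  have hmass : ∀ j : Fin n, mass G.realW (Pi.single j 1) = rowSum G.realW j := by
    intro j
    rw [mass, sum_eq_single j (fun u _ hu => by simp [hu]) (by simp)]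
    simp
  obtain ⟨i, hi⟩ := G.fewSlowParts hk (fun i => Pi.single ⟨i, by omega⟩ 1)
    (fun i j hij u => by
      have hne : (⟨i, by omega⟩ : Fin n) ≠ ⟨j, by omega⟩ := fun h =>
        hij (Fin.ext (by simpa using h))
      by_cases hu : u = ⟨i, by omega⟩
      · subst hu
        rw [Pi.single_eq_of_ne hne, mul_zero]
      · rw [Pi.single_eq_of_ne hu, zero_mul])
    (fun i => by
      rw [hmass, rowSum_realW]
      exact Rat.cast_pos.2 (G.deg_pos _))
  set j : Fin n := ⟨i, by omega⟩
  rw [energy_eq_mass_add G.realW_symm, hmass] at hi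
  have h0 : ∑ u, ∑ v, G.realW u v * ((Pi.single j 1 : Fin n → ℝ) u * (Pi.single j 1 : Fin n → ℝ) v)
      = 0 := by
    refine sum_eq_zero fun u _ => sum_eq_zero fun v _ => ?_
    by_cases hu : u = j
    · by_cases hv : v = j
      · rw [hu, hv, realW, G.loopless]; simp
      · simp [hv]
    · simp [hu]
  rw [h0] at hi
  have hd : 0 < rowSum G.realW j := by
    rw [rowSum_realW]; exact Rat.cast_pos.2 (G.deg_pos _)
  nlinarith

end WGraph

namespace CutForm

variable {V : Type*} [Fintype V]

/-! ### Power iteration -/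

/-- Log-convex sequences grow at least as fast as in their first step. -/
lemma pow_mul_le_of_logConvex {s : ℕ → ℝ} (h0 : ∀ i, 0 ≤ s i)
    (hc : ∀ i, s (i + 1) ^ 2 ≤ s i * s (i + 2)) {c : ℝ} (hc0 : 0 ≤ c) (h1 : c * s 0 ≤ s 1) (T : ℕ) :
    c ^ T * s 0 ≤ s T := by
  have hstep : ∀ i, c * s i ≤ s (i + 1) := by
    intro i
    induction i with
    | zero => exact h1
    | succ i ih =>
      rcases (h0 (i + 1)).eq_or_lt with hz | hz
      · rw [← hz, mul_zero]; exact h0 _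
      · have h2 := hc i
        have hi : 0 < s i := by
          refine lt_of_le_of_ne (h0 i) fun hi => ?_
          rw [← hi, zero_mul] at h2
          nlinarith
        have : s i * (c * s (i + 1)) ≤ s i * s (i + 2) := by nlinarith
        exact le_of_mul_le_mul_left this hi
  induction T with
  | zero => simp
  | succ T ih =>
    calc c ^ (T + 1) * s 0 = c * (c ^ T * s 0) := by ring
      _ ≤ c * s T := by gcongr
      _ ≤ _ := hstep T

/-- Log-convex sequences grow at most as fast as in their last step. -/
lemma le_pow_mul_of_logConvex {s : ℕ → ℝ} (h0 : ∀ i, 0 ≤ s i)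
    (hc : ∀ i, s (i + 1) ^ 2 ≤ s i * s (i + 2)) {r : ℝ} (hr : 0 ≤ r) {T : ℕ}
    (h1 : s (T + 1) ≤ r * s T) : s T ≤ r ^ T * s 0 := by
  induction T with
  | zero => simp
  | succ T ih =>
    have h2 : s (T + 1) ≤ r * s T := by
      rcases (h0 (T + 1)).eq_or_lt with hz | hz
      · rw [← hz]; exact mul_nonneg hr (h0 T)
      · have : s (T + 1) * s (T + 1) ≤ s (T + 1) * (r * s T) := by
          nlinarith [hc T, mul_le_mul_of_nonneg_left h1 (h0 T)]
        exact le_of_mul_le_mul_left this hz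
    calc s (T + 1) ≤ r * s T := h2
      _ ≤ r * (r ^ T * s 0) := by gcongr; exact ih h2
      _ = _ := by ring

lemma eq_zero_of_rowSum_eq_zero {w : V → V → ℝ} (hw : ∀ u v, 0 ≤ w u v) {u : V}
    (h : rowSum w u = 0) (v : V) : w u v = 0 :=
  (sum_eq_zero_iff_of_nonneg fun v _ => hw u v).1 h v (mem_univ v)

/-- The inner product that belongs to `mass`. -/
def massInner (w : V → V → ℝ) (f g : V → ℝ) : ℝ := ∑ u, rowSum w u * (f u * g u)

lemma massInner_self (w : V → V → ℝ) (f : V → ℝ) : massInner w f f = mass w f := by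
  simp only [massInner, mass, sq]

lemma sq_massInner_le {w : V → V → ℝ} (hw : ∀ u v, 0 ≤ w u v) (f g : V → ℝ) :
    massInner w f g ^ 2 ≤ mass w f * mass w g :=
  sum_sq_le_sum_mul_sum_of_sq_le_mul _
    (fun u _ => mul_nonneg (rowSum_nonneg hw u) (sq_nonneg _))
    (fun u _ => mul_nonneg (rowSum_nonneg hw u) (sq_nonneg _)) fun u _ => le_of_eq (by ring)

variable [DecidableEq V]

/-- The matrix `(1 - D⁻¹ A) / 2` of the lazy walk that changes the sign in every step. The row of
an isolated vertex is `0`. -/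
noncomputable def flipWalk (w : V → V → ℝ) : Matrix V V ℝ :=
  Matrix.of fun u v => ((if u = v then rowSum w u else 0) - w u v) / (2 * rowSum w u)

lemma rowSum_mul_flipWalk {w : V → V → ℝ} (hw : ∀ u v, 0 ≤ w u v) (f : V → ℝ) (u : V) :
    rowSum w u * (flipWalk w).mulVec f u = (rowSum w u * f u - ∑ v, w u v * f v) / 2 := by
  have h1 : (flipWalk w).mulVec f u
      = (rowSum w u * f u - ∑ v, w u v * f v) / (2 * rowSum w u) := by
    simp only [flipWalk, Matrix.mulVec, dotProduct, Matrix.of_apply, div_mul_eq_mul_div, ← sum_div,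
      sub_mul, ite_mul, zero_mul, sum_sub_distrib, sum_ite_eq, mem_univ, if_true]
  rw [h1]
  rcases (rowSum_nonneg hw u).eq_or_lt with h | h
  · have : ∑ v, w u v * f v = 0 := sum_eq_zero fun v _ => by
      rw [eq_zero_of_rowSum_eq_zero hw h.symm, zero_mul]
    rw [← h, this]
    simp
  · field_simp

lemma massInner_flipWalk_comm {w : V → V → ℝ} (hw : ∀ u v, 0 ≤ w u v) (hs : ∀ u v, w u v = w v u)
    (f g : V → ℝ) :
    massInner w ((flipWalk w).mulVec f) g = massInner w f ((flipWalk w).mulVec g) := by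
  have h1 : ∀ f g : V → ℝ, massInner w ((flipWalk w).mulVec f) g
      = (∑ u, rowSum w u * (f u * g u) - ∑ u, ∑ v, w u v * (f v * g u)) / 2 := by
    intro f g
    rw [massInner, ← sum_sub_distrib, sum_div]
    refine sum_congr rfl fun u _ => ?_
    rw [← mul_assoc, rowSum_mul_flipWalk hw]
    have : ∑ v, w u v * (f v * g u) = (∑ v, w u v * f v) * g u := by
      rw [sum_mul]; exact sum_congr rfl fun v _ => by ring
    rw [this]
    ring
  have h2 : massInner w f ((flipWalk w).mulVec g) = massInner w ((flipWalk w).mulVec g) f :=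
    sum_congr rfl fun u _ => by ring
  rw [h2, h1, h1]
  congr 2
  · exact sum_congr rfl fun u _ => by ring
  · rw [sum_comm]
    exact sum_congr rfl fun u _ => sum_congr rfl fun v _ => by rw [hs]; ring

lemma energy_eq_flipWalk {w : V → V → ℝ} (hw : ∀ u v, 0 ≤ w u v) (hs : ∀ u v, w u v = w v u)
    (f : V → ℝ) : energy w f = 2 * (mass w f - massInner w f ((flipWalk w).mulVec f)) := by
  rw [energy_eq_mass_add hs]
  have : massInner w f ((flipWalk w).mulVec f)
      = (mass w f - ∑ u, ∑ v, w u v * (f u * f v)) / 2 := by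
    rw [massInner, mass, ← sum_sub_distrib, sum_div]
    refine sum_congr rfl fun u _ => ?_
    rw [mul_left_comm, rowSum_mul_flipWalk hw]
    have : ∑ v, w u v * (f u * f v) = f u * ∑ v, w u v * f v := by
      rw [mul_sum]; exact sum_congr rfl fun v _ => by ring
    rw [this]
    ring
  rw [this]
  ring

/-- As an operator, the walk matrix is at least its square. -/
lemma mass_flipWalk_le {w : V → V → ℝ} (hw : ∀ u v, 0 ≤ w u v) (hs : ∀ u v, w u v = w v u)
    (f : V → ℝ) :
    mass w ((flipWalk w).mulVec f) ≤ massInner w f ((flipWalk w).mulVec f) := by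
  rw [← sub_nonneg, mass, massInner, ← sum_sub_distrib]
  have h1 : ∀ u, (rowSum w u * f u ^ 2 - ∑ v, w u v * f v ^ 2) / 4
      ≤ rowSum w u * (f u * (flipWalk w).mulVec f u)
        - rowSum w u * (flipWalk w).mulVec f u ^ 2 := by
    intro u
    have h2 := rowSum_mul_flipWalk hw f u
    rcases (rowSum_nonneg hw u).eq_or_lt with h | h
    · have : ∑ v, w u v * f v ^ 2 = 0 := sum_eq_zero fun v _ => by
        rw [eq_zero_of_rowSum_eq_zero hw h.symm, zero_mul]
      rw [← h, this]
      simp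
    · set p := (flipWalk w).mulVec f u
      set d := rowSum w u
      have h3 : (∑ v, w u v * f v) ^ 2 ≤ d * ∑ v, w u v * f v ^ 2 :=
        sum_sq_le_sum_mul_sum_of_sq_le_mul _ (fun v _ => hw u v)
          (fun v _ => mul_nonneg (hw u v) (sq_nonneg _)) fun v _ => le_of_eq (by ring)
      have h4 : ∑ v, w u v * f v = d * (f u - 2 * p) := by linarith
      rw [h4] at h3
      have h5 : d * (f u - 2 * p) ^ 2 ≤ ∑ v, w u v * f v ^ 2 := by
        refine le_of_mul_le_mul_left ?_ h
        linarith
      nlinarith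
  refine le_trans (le_of_eq ?_) (sum_le_sum fun u _ => h1 u)
  rw [← sum_div, sum_sub_distrib, sum_pair_right hs (fun u => f u ^ 2)]
  simp

lemma mass_pow_logConvex {w : V → V → ℝ} (hw : ∀ u v, 0 ≤ w u v) (hs : ∀ u v, w u v = w v u)
    (g : V → ℝ) (i : ℕ) :
    mass w ((flipWalk w ^ (i + 1)).mulVec g) ^ 2
      ≤ mass w ((flipWalk w ^ i).mulVec g) * mass w ((flipWalk w ^ (i + 2)).mulVec g) := by
  have h1 : ∀ j, (flipWalk w ^ (j + 1)).mulVec g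
      = (flipWalk w).mulVec ((flipWalk w ^ j).mulVec g) := fun j => by
    rw [Matrix.mulVec_mulVec, ← pow_succ']
  rw [← massInner_self, h1 i, massInner_flipWalk_comm hw hs, ← h1 i, ← h1 (i + 1)]
  exact sq_massInner_le hw _ _

lemma massInner_pow_comm {w : V → V → ℝ} (hw : ∀ u v, 0 ≤ w u v) (hs : ∀ u v, w u v = w v u)
    (T : ℕ) (f g : V → ℝ) :
    massInner w ((flipWalk w ^ T).mulVec f) g = massInner w f ((flipWalk w ^ T).mulVec g) := by
  induction T generalizing f g with
  | zero => simp
  | succ T ih =>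
    rw [pow_succ', ← Matrix.mulVec_mulVec, massInner_flipWalk_comm hw hs, ih, Matrix.mulVec_mulVec,
      ← pow_succ, ← pow_succ']

/-- If some vector has a small Rayleigh quotient, a column of a high power of the walk matrix
has one as well, up to a constant factor. -/
theorem exists_column_flipWalk_pow {w : V → V → ℝ} (hw : ∀ u v, 0 ≤ w u v)
    (hs : ∀ u v, w u v = w v u) {x : V → ℝ} {δ : ℝ} (hδ : 0 < δ)
    (hδ4 : δ ≤ 1 / 4) (hvol : 0 < mass w x) (hxδ : energy w x ≤ 2 * δ * mass w x) {T : ℕ}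
    (hT : Fintype.card V ≤ δ * T) :
    ∃ v, 0 < rowSum w v ∧
      (1 - δ) ^ (2 * T) * rowSum w v
        ≤ Fintype.card V * mass w ((flipWalk w ^ T).mulVec (Pi.single v 1)) ∧
      energy w ((flipWalk w ^ T).mulVec (Pi.single v 1))
        ≤ 12 * δ * mass w ((flipWalk w ^ T).mulVec (Pi.single v 1)) := by
  set P := flipWalk w with hP
  set vol := mass w x with hvoldef
  set n : ℝ := (Fintype.card V : ℝ) with hn
  have hV : Nonempty V := by
    by_contra hV
    rw [not_nonempty_iff] at hV
    rw [hvoldef, mass, univ_eq_empty, sum_empty] at hvol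
    exact lt_irrefl _ hvol
  have hn0 : 0 < n := by rw [hn]; exact_mod_cast Fintype.card_pos
  -- The masses of `P ^ i x` are log-convex in `i`, so they decay at most as fast as in the first
  -- step.
  have hxT : (1 - δ) ^ (2 * T) * vol ≤ mass w ((P ^ T).mulVec x) := by
    have := pow_mul_le_of_logConvex (s := fun i => mass w ((P ^ i).mulVec x))
      (fun i => mass_nonneg hw _) (mass_pow_logConvex hw hs x) (c := (1 - δ) ^ 2) (sq_nonneg _) ?_ T
    · rw [← pow_mul] at this
      simpa using this
    · simp only [pow_zero, pow_one, Matrix.one_mulVec]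
      have h1 := energy_eq_flipWalk hw hs x
      have h2 : (1 - δ) * vol ≤ massInner w x (P.mulVec x) := by linarith
      have h3 := sq_massInner_le hw x (P.mulVec x)
      have h4 : ((1 - δ) * vol) ^ 2 ≤ massInner w x (P.mulVec x) ^ 2 :=
        pow_le_pow_left₀ (mul_nonneg (by linarith) hvol.le) h2 2
      refine le_of_mul_le_mul_left ?_ hvol
      calc vol * ((1 - δ) ^ 2 * vol) = ((1 - δ) * vol) ^ 2 := by ring
        _ ≤ _ := h4.trans h3
  set c : ℝ := (1 - δ) ^ (2 * T) with hc
  have hc0 : 0 < c := pow_pos (by linarith) _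
  obtain ⟨v, -, hv⟩ : ∃ v ∈ (univ : Finset V), c * vol / n ≤ rowSum w v * (P ^ T).mulVec x v ^ 2 := by
    refine exists_le_of_sum_le univ_nonempty ?_
    rw [sum_const, card_univ, nsmul_eq_mul, mul_div_cancel₀ _ hn0.ne']
    exact hxT
  have hdv : 0 < rowSum w v := by
    have : 0 < rowSum w v * (P ^ T).mulVec x v ^ 2 := lt_of_lt_of_le (by positivity) hv
    exact pos_of_mul_pos_left this (sq_nonneg _)
  set f := (P ^ T).mulVec (Pi.single v 1) with hf
  have hmass : c * rowSum w v ≤ n * mass w f := by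
    have h1 : massInner w f x = rowSum w v * (P ^ T).mulVec x v := by
      rw [hf, massInner_pow_comm hw hs, massInner, sum_eq_single v (fun u _ hu => by simp [hu])
        (by simp)]
      simp [hP]
    have h2 := sq_massInner_le hw f x
    rw [h1] at h2
    rw [div_le_iff₀ hn0] at hv
    refine le_of_mul_le_mul_right ?_ hvol
    calc c * rowSum w v * vol = rowSum w v * (c * vol) := by ring
      _ ≤ rowSum w v * (rowSum w v * (P ^ T).mulVec x v ^ 2 * n) := by gcongr
      _ = n * (rowSum w v * (P ^ T).mulVec x v) ^ 2 := by ring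
      _ ≤ n * (mass w f * vol) := by gcongr
      _ = _ := by ring
  refine ⟨v, hdv, hmass, ?_⟩
  -- Otherwise the last step shrinks the mass by more than `1 - 6 * δ`, by log-convexity all steps
  -- do, and after `T ≥ n / δ` steps the mass would be below its lower bound.
  by_contra! hcon
  set s : ℕ → ℝ := fun i => mass w ((P ^ i).mulVec (Pi.single v 1)) with hs'
  have hs0 : ∀ i, 0 ≤ s i := fun i => mass_nonneg hw _
  have hsT : s T = mass w f := rfl
  have hsT0 : 0 < s T := by
    rw [hsT]
    exact pos_of_mul_pos_right ((mul_pos hc0 hdv).trans_le hmass) hn0.le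
  have hdrop : s (T + 1) < (1 - 6 * δ) * s T := by
    have h1 := mass_flipWalk_le hw hs f
    have h2 := energy_eq_flipWalk hw hs f
    have h3 : s (T + 1) = mass w (P.mulVec f) := by
      rw [hs', hf, Matrix.mulVec_mulVec, ← pow_succ']
    rw [h3, hsT]
    linarith
  have hr : 0 < 1 - 6 * δ := pos_of_mul_pos_left ((hs0 _).trans_lt hdrop) hsT0.le
  have hlast := le_pow_mul_of_logConvex hs0 (mass_pow_logConvex hw hs _) hr.le hdrop.le
  have hs00 : s 0 = rowSum w v := by
    simp only [hs', pow_zero, Matrix.one_mulVec, mass]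
    rw [sum_eq_single v (fun u _ hu => by simp [hu]) (by simp)]
    simp
  rw [hs00] at hlast
  have h1 : c ≤ n * (1 - 6 * δ) ^ T := by
    refine le_of_mul_le_mul_right ?_ hdv
    calc c * rowSum w v ≤ n * s T := hmass
      _ ≤ n * ((1 - 6 * δ) ^ T * rowSum w v) := by gcongr
      _ = _ := by ring
  have h2 : (1 - 2 * δ) ^ T ≤ c := by
    rw [hc, pow_mul]
    exact pow_le_pow_left₀ (by linarith) (by nlinarith) T
  have h3 : (1 - 6 * δ) ^ T ≤ (1 - 2 * δ) ^ T * (1 - 4 * δ) ^ T := by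
    rw [← mul_pow]
    exact pow_le_pow_left₀ hr.le (by nlinarith) T
  have h4 : 0 < (1 - 2 * δ) ^ T := pow_pos (by linarith) T
  have h5 : 1 ≤ n * (1 - 4 * δ) ^ T := by
    refine le_of_mul_le_mul_left ?_ h4
    calc (1 - 2 * δ) ^ T * 1 ≤ n * (1 - 6 * δ) ^ T := by linarith
      _ ≤ n * ((1 - 2 * δ) ^ T * (1 - 4 * δ) ^ T) := by gcongr
      _ = _ := by ring
  have h6 : (1 - 4 * δ) ^ T ≤ Real.exp (-n) := by
    calc (1 - 4 * δ) ^ T ≤ Real.exp (-(4 * δ)) ^ T :=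
          pow_le_pow_left₀ (by linarith) (Real.one_sub_le_exp_neg _) T
      _ = Real.exp (T * -(4 * δ)) := (Real.exp_nat_mul _ _).symm
      _ ≤ _ := Real.exp_le_exp.2 (by nlinarith)
  have h7 : n * Real.exp (-n) < 1 := by
    rw [Real.exp_neg, ← div_eq_mul_inv, div_lt_one (Real.exp_pos n)]
    linarith [Real.add_one_le_exp n]
  have := mul_le_mul_of_nonneg_left h6 hn0.le
  linarith

end CutForm

namespace CutForm

/-! ### Fixed point approximation of the walk matrix -/

lemma abs_ediv_sub_le (a : ℤ) {b : ℤ} (hb : 0 ≤ b) : |((a / b : ℤ) : ℝ) - (a : ℝ) / b| ≤ 1 := by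
  rcases hb.eq_or_lt with rfl | hb
  · simp
  · have h1 : (0 : ℝ) < b := by exact_mod_cast hb
    have h2 : ((a / b : ℤ) : ℝ) * b ≤ a := by exact_mod_cast Int.ediv_mul_le a hb.ne'
    have h3 : (a : ℝ) < ((a / b : ℤ) + 1) * b := by exact_mod_cast Int.lt_ediv_add_one_mul_self a hb
    rw [abs_le]
    constructor
    · have : (a : ℝ) / b ≤ (a / b : ℤ) + 1 := by rw [div_le_iff₀ h1]; exact h3.le
      linarith
    · have : ((a / b : ℤ) : ℝ) ≤ (a : ℝ) / b := by rw [le_div_iff₀ h1]; exact h2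
      linarith

variable {V : Type*} [Fintype V]

/-- Integer weights as real weights. -/
def castW (ω : V → V → ℤ) (u v : V) : ℝ := ω u v

lemma rowSum_castW (ω : V → V → ℤ) (u : V) : rowSum (castW ω) u = rowSum ω u := by
  simp [rowSum, castW]

/-- One squaring step on matrices with entries in units of `1 / N`. -/
def squareMatrix (N : ℤ) (X : V → V → ℤ) (u v : V) : ℤ := (∑ l, X u l * X l v) / N

section RowNorm

variable {A B : Matrix V V ℝ} {a b : ℝ}

lemma sum_abs_mul_le (hA : ∀ u, ∑ v, |A u v| ≤ a) (hB : ∀ u, ∑ v, |B u v| ≤ b) (hb : 0 ≤ b)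
    (u : V) : ∑ v, |(A * B) u v| ≤ a * b := by
  calc ∑ v, |(A * B) u v| ≤ ∑ v, ∑ l, |A u l| * |B l v| := by
        refine sum_le_sum fun v _ => ?_
        rw [Matrix.mul_apply]
        refine (abs_sum_le_sum_abs _ _).trans_eq (sum_congr rfl fun l _ => abs_mul _ _)
    _ = ∑ l, |A u l| * ∑ v, |B l v| := by
        rw [sum_comm]; exact sum_congr rfl fun l _ => (mul_sum _ _ _).symm
    _ ≤ ∑ l, |A u l| * b := sum_le_sum fun l _ => mul_le_mul_of_nonneg_left (hB l) (abs_nonneg _)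
    _ = (∑ l, |A u l|) * b := (sum_mul _ _ _).symm
    _ ≤ _ := mul_le_mul_of_nonneg_right (hA u) hb

lemma sum_abs_mul_self_sub_le {e : ℝ} (hA : ∀ u, ∑ v, |A u v| ≤ 1)
    (hBA : ∀ u, ∑ v, |(B - A) u v| ≤ e) (he0 : 0 ≤ e) (he : e ≤ 1) (u : V) :
    ∑ v, |(B * B - A * A) u v| ≤ 3 * e := by
  have h1 : B * B - A * A = (A * (B - A) + (B - A) * A) + (B - A) * (B - A) := by noncomm_ring
  have h2 := sum_abs_mul_le hA hBA he0 u
  have h3 := sum_abs_mul_le hBA hA zero_le_one u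
  have h4 := sum_abs_mul_le hBA hBA he0 u
  calc ∑ v, |(B * B - A * A) u v| ≤ ∑ v, (|(A * (B - A)) u v| + |((B - A) * A) u v|
        + |((B - A) * (B - A)) u v|) := by
        refine sum_le_sum fun v _ => ?_
        rw [h1]
        exact (abs_add_le _ _).trans (add_le_add (abs_add_le _ _) le_rfl)
    _ ≤ 1 * e + e * 1 + e * e := by
        rw [sum_add_distrib, sum_add_distrib]
        exact add_le_add (add_le_add h2 h3) h4
    _ ≤ _ := by nlinarith

end RowNorm

lemma mass_const_mul_right (c : ℝ) (w : V → V → ℝ) (f : V → ℝ) :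
    mass w (fun u => c * f u) = c ^ 2 * mass w f := by
  simp only [mass, mul_sum]
  exact sum_congr rfl fun u _ => by ring

lemma energy_const_mul_right (c : ℝ) (w : V → V → ℝ) (f : V → ℝ) :
    energy w (fun u => c * f u) = c ^ 2 * energy w f := by
  simp only [energy, mul_sum]
  exact sum_congr rfl fun u _ => sum_congr rfl fun v _ => by ring

variable [DecidableEq V]

/-- The walk matrix, with entries in units of `1 / N`, rounded down. -/
def startMatrix (N : ℤ) (ω : V → V → ℤ) (u v : V) : ℤ :=
  ((if u = v then N * rowSum ω u else 0) - N * ω u v) / (2 * rowSum ω u)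

/-- Approximation of the power `2 ^ j` of the walk matrix, with entries in units of `1 / N`. -/
def walkApprox (N : ℤ) (ω : V → V → ℤ) (j : ℕ) : V → V → ℤ := (squareMatrix N)^[j] (startMatrix N ω)

lemma walkApprox_succ (N : ℤ) (ω : V → V → ℤ) (j : ℕ) :
    walkApprox N ω (j + 1) = squareMatrix N (walkApprox N ω j) :=
  Function.iterate_succ_apply' _ _ _

lemma walkApprox_eq_zero (N : ℤ) {ω : V → V → ℤ} {u : V} (hu : rowSum ω u = 0) (j : ℕ) (v : V) :
    walkApprox N ω j u v = 0 := by
  induction j generalizing v with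
  | zero => simp [walkApprox, startMatrix, hu]
  | succ j ih => rw [walkApprox_succ, squareMatrix]; simp [ih]

lemma sum_abs_flipWalk_le {w : V → V → ℝ} (hw : ∀ u v, 0 ≤ w u v) (u : V) :
    ∑ v, |flipWalk w u v| ≤ 1 := by
  have hd := rowSum_nonneg hw u
  have h1 : ∀ v, |flipWalk w u v| ≤ ((if u = v then rowSum w u else 0) + w u v) / (2 * rowSum w u) := by
    intro v
    rw [flipWalk, Matrix.of_apply, abs_div, abs_of_nonneg (by positivity : 0 ≤ 2 * rowSum w u)]
    gcongr
    have := hw u v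
    split_ifs <;> exact abs_le.2 ⟨by linarith, by linarith⟩
  refine (sum_le_sum fun v _ => h1 v).trans ?_
  rw [← sum_div, sum_add_distrib, sum_ite_eq, if_pos (mem_univ u)]
  refine div_le_one_of_le₀ ?_ (by positivity)
  rw [two_mul]
  rfl

lemma sum_abs_flipWalk_pow_le {w : V → V → ℝ} (hw : ∀ u v, 0 ≤ w u v) (i : ℕ) (u : V) :
    ∑ v, |(flipWalk w ^ i) u v| ≤ 1 := by
  induction i generalizing u with
  | zero =>
    simp only [pow_zero, Matrix.one_apply]
    rw [sum_eq_single u (fun v _ hv => by simp [Ne.symm hv]) (by simp)]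
    simp
  | succ i ih =>
    rw [pow_succ]
    simpa using sum_abs_mul_le ih (sum_abs_flipWalk_le hw) zero_le_one u

lemma sum_abs_walkApprox_sub_le {N : ℤ} (hN : 0 < N) {ω : V → V → ℤ} (hω : ∀ u v, 0 ≤ ω u v) (j : ℕ)
    (hj : 4 ^ j * (Fintype.card V : ℝ) ≤ N) (u : V) :
    ∑ v, |(walkApprox N ω j u v : ℝ) / N - (flipWalk (castW ω) ^ 2 ^ j) u v|
      ≤ 4 ^ j * (Fintype.card V) / N := by
  have hN' : (0 : ℝ) < N := by exact_mod_cast hN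
  have hw : ∀ u v, 0 ≤ castW ω u v := fun u v => by simpa [castW] using hω u v
  -- Rounding an entry down costs `1 / N`.
  have hround : ∀ (p q : ℤ), 0 ≤ q → |((p / q : ℤ) : ℝ) / N - (p / N) / q| ≤ 1 / N := by
    intro p q hq
    rw [div_right_comm, ← sub_div, abs_div, abs_of_pos hN']
    exact div_le_div_of_nonneg_right (abs_ediv_sub_le p hq) hN'.le
  induction j generalizing u with
  | zero =>
    have h1 : ∀ v, |(walkApprox N ω 0 u v : ℝ) / N - (flipWalk (castW ω) ^ 2 ^ 0) u v| ≤ 1 / N := by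
      intro v
      have hd : 0 ≤ 2 * rowSum ω u := mul_nonneg (by norm_num) (sum_nonneg fun v _ => hω u v)
      refine (hround ((if u = v then N * rowSum ω u else 0) - N * ω u v) _ hd).trans' (le_of_eq ?_)
      congr 2
      simp only [pow_zero, pow_one, flipWalk, Matrix.of_apply, rowSum_castW, castW]
      push_cast
      congr 1
      split_ifs
      · field_simp
      · field_simp
        ring
    refine (sum_le_sum fun v _ => h1 v).trans_eq ?_
    rw [sum_const, card_univ, nsmul_eq_mul, pow_zero, one_mul, mul_one_div]
  | succ j ih =>
    set n : ℝ := (Fintype.card V : ℝ) with hn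
    have hn0 : 0 ≤ n := Nat.cast_nonneg _
    have hj' : 4 ^ j * n ≤ N := by
      refine le_trans ?_ hj
      rw [pow_succ]
      nlinarith [mul_nonneg (pow_nonneg (by norm_num : (0 : ℝ) ≤ 4) j) hn0]
    have ih' := ih hj'
    set A := flipWalk (castW ω) ^ 2 ^ j with hA
    set B : Matrix V V ℝ := Matrix.of fun u v => (walkApprox N ω j u v : ℝ) / N with hB
    set e : ℝ := 4 ^ j * n / N with he
    have he0 : 0 ≤ e := by positivity
    have he1 : e ≤ 1 := div_le_one_of_le₀ hj' hN'.le
    have hsq := sum_abs_mul_self_sub_le (A := A) (B := B) (sum_abs_flipWalk_pow_le hw _)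
      (fun u => ih' u) he0 he1 u
    have hpow : flipWalk (castW ω) ^ 2 ^ (j + 1) = A * A := by rw [hA, ← pow_add, pow_succ, mul_two]
    have h1 : ∀ v, |(walkApprox N ω (j + 1) u v : ℝ) / N - (A * A) u v|
        ≤ 1 / N + |(B * B - A * A) u v| := by
      intro v
      have h2 := hround (∑ l, walkApprox N ω j u l * walkApprox N ω j l v) N hN.le
      have h3 : ((∑ l, walkApprox N ω j u l * walkApprox N ω j l v : ℤ) : ℝ) / N / N
          = (B * B) u v := by
        rw [Matrix.mul_apply, Int.cast_sum, sum_div, sum_div]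
        refine sum_congr rfl fun l _ => ?_
        simp only [hB, Matrix.of_apply, Int.cast_mul]
        field_simp
      rw [h3] at h2
      rw [walkApprox_succ, Matrix.sub_apply]
      exact (abs_sub_le _ ((B * B) u v) _).trans (add_le_add h2 le_rfl)
    rw [hpow]
    calc _ ≤ ∑ v, (1 / (N : ℝ) + |(B * B - A * A) u v|) := sum_le_sum fun v _ => h1 v
      _ ≤ n / N + 3 * e := by
          rw [sum_add_distrib, sum_const, card_univ, nsmul_eq_mul, mul_one_div]
          exact add_le_add le_rfl hsq
      _ ≤ e + 3 * e := by
          have : 1 ≤ (4 : ℝ) ^ j := one_le_pow₀ (by norm_num)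
          have : n / N ≤ e := by
            rw [he]; gcongr; nlinarith
          linarith
      _ = _ := by rw [he, pow_succ]; ring

lemma abs_walkApprox_le {N : ℤ} (hN : 0 < N) {ω : V → V → ℤ} (hω : ∀ u v, 0 ≤ ω u v) {j : ℕ}
    (hj : 4 ^ j * (Fintype.card V : ℝ) ≤ N) (u v : V) : |walkApprox N ω j u v| ≤ 2 * N := by
  have hN' : (0 : ℝ) < N := by exact_mod_cast hN
  have hw : ∀ u v, 0 ≤ castW ω u v := fun u v => by simpa [castW] using hω u v
  have h1 := (single_le_sum (f := fun v => |(walkApprox N ω j u v : ℝ) / N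
    - (flipWalk (castW ω) ^ 2 ^ j) u v|) (fun _ _ => abs_nonneg _) (mem_univ v)).trans
    (sum_abs_walkApprox_sub_le hN hω j hj u)
  have h2 := (single_le_sum (f := fun v => |(flipWalk (castW ω) ^ 2 ^ j) u v|)
    (fun _ _ => abs_nonneg _) (mem_univ v)).trans (sum_abs_flipWalk_pow_le hw (2 ^ j) u)
  have h3 : 4 ^ j * (Fintype.card V : ℝ) / N ≤ 1 := div_le_one_of_le₀ hj hN'.le
  have h4 : |(walkApprox N ω j u v : ℝ) / N| ≤ 2 := by
    have := abs_sub_abs_le_abs_sub ((walkApprox N ω j u v : ℝ) / N)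
      ((flipWalk (castW ω) ^ 2 ^ j) u v)
    linarith
  rw [abs_div, abs_of_pos hN', div_le_iff₀ hN'] at h4
  exact_mod_cast h4

lemma energy_le_two_mul_mass {w : V → V → ℝ} (hw : ∀ u v, 0 ≤ w u v) (hs : ∀ u v, w u v = w v u)
    (f : V → ℝ) : energy w f ≤ 2 * mass w f := by
  have h1 := energy_eq_flipWalk hw hs f
  have h2 := mass_flipWalk_le hw hs f
  have h3 := mass_nonneg hw ((flipWalk w).mulVec f)
  linarith

/-- A small perturbation changes the Rayleigh quotient by at most a constant factor. -/
lemma energy_le_of_close {w : V → V → ℝ} (hw : ∀ u v, 0 ≤ w u v) (hs : ∀ u v, w u v = w v u)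
    {f g : V → ℝ} {δ e : ℝ} (hδ : 0 < δ) (hδ4 : δ ≤ 1 / 4) (hf : 0 < mass w f)
    (hfδ : energy w f ≤ 12 * δ * mass w f) (hfg : ∀ u, (g u - f u) ^ 2 ≤ e)
    (he : (∑ u, rowSum w u) * e ≤ δ * mass w f / 4) :
    0 < mass w g ∧ energy w g ≤ 60 * δ * mass w g := by
  have hmerr : mass w (fun u => g u - f u) ≤ δ * mass w f / 4 := by
    refine le_trans ?_ he
    rw [sum_mul]
    exact sum_le_sum fun u _ => mul_le_mul_of_nonneg_left (hfg u) (rowSum_nonneg hw u)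
  have hmg : mass w f ≤ 2 * mass w g + 2 * mass w (fun u => g u - f u) := by
    simp only [mass, mul_sum]
    rw [← sum_add_distrib]
    refine sum_le_sum fun u _ => ?_
    nlinarith [mul_nonneg (rowSum_nonneg hw u) (sq_nonneg (2 * g u - f u))]
  have heg : energy w g ≤ 2 * energy w f + 2 * energy w (fun u => g u - f u) := by
    simp only [energy, mul_sum]
    rw [← sum_add_distrib]
    refine sum_le_sum fun u _ => ?_
    rw [← sum_add_distrib]
    refine sum_le_sum fun v _ => ?_
    nlinarith [mul_nonneg (hw u v) (sq_nonneg (2 * (f u + f v) - (g u + g v)))]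
  have h2 := energy_le_two_mul_mass hw hs fun u => g u - f u
  have hδμ : δ * mass w f ≤ mass w f / 4 := by nlinarith
  have h1 : 7 / 16 * mass w f ≤ mass w g := by linarith
  refine ⟨by linarith, ?_⟩
  calc energy w g ≤ 25 * (δ * mass w f) := by linarith
    _ ≤ 60 * δ * (7 / 16 * mass w f) := by nlinarith [mul_pos hδ hf]
    _ ≤ _ := by gcongr

/-- After `2 n / δ` steps of decay by `1 - δ` a quantity is still polynomial in `2 ^ (-n)`. -/
lemma one_le_pow_mul_pow {n T : ℕ} {δ z : ℝ} (hδ : 0 < δ) (hδ4 : δ ≤ 1 / 4) (hT : δ * T ≤ 2 * n)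
    (hz : 2 ^ n ≤ z) : 1 ≤ (1 - δ) ^ (2 * T) * z ^ 12 := by
  have h1 : Real.exp (-(8 * n)) ≤ (1 - δ) ^ (2 * T) := by
    have h2 : Real.exp (-(2 * δ)) ≤ 1 - δ := by
      rw [Real.exp_neg]
      refine inv_le_of_inv_le₀ (by linarith) ?_
      refine le_trans ?_ (Real.add_one_le_exp (2 * δ))
      rw [inv_le_iff_one_le_mul₀ (by linarith)]
      nlinarith
    calc Real.exp (-(8 * n)) ≤ Real.exp ((2 * T : ℕ) * -(2 * δ)) := by
          refine Real.exp_le_exp.2 ?_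
          push_cast
          linarith
      _ = Real.exp (-(2 * δ)) ^ (2 * T) := Real.exp_nat_mul _ _
      _ ≤ _ := pow_le_pow_left₀ (Real.exp_pos _).le h2 _
  have h5 : Real.exp 8 ≤ 2 ^ 12 := by
    have h6 : Real.exp 8 = Real.exp 1 ^ 8 := by rw [← Real.exp_nat_mul]; norm_num
    rw [h6]
    calc Real.exp 1 ^ 8 ≤ 2.7182818286 ^ 8 :=
          pow_le_pow_left₀ (Real.exp_pos _).le Real.exp_one_lt_d9.le 8
      _ ≤ _ := by norm_num
  have h4 : Real.exp (8 * n) ≤ z ^ 12 := by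
    calc Real.exp (8 * n) = Real.exp 8 ^ n := by rw [← Real.exp_nat_mul, mul_comm]
      _ ≤ (2 ^ 12) ^ n := pow_le_pow_left₀ (Real.exp_pos _).le h5 n
      _ = (2 ^ n) ^ 12 := by rw [← pow_mul, ← pow_mul, mul_comm]
      _ ≤ z ^ 12 := by gcongr
  calc (1 : ℝ) ≤ Real.exp (-(8 * n)) * z ^ 12 := by
        rw [Real.exp_neg, inv_mul_eq_div, one_le_div (Real.exp_pos _)]
        exact h4
    _ ≤ _ := by
        have : 0 ≤ z ^ 12 := le_trans (Real.exp_pos _).le h4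
        gcongr

/-- Among the columns of the matrices that the algorithm computes there is one with a Rayleigh
quotient of the order of the minimum `δ`, provided that `δ` is not too small. -/
theorem exists_column_walkApprox {Z : ℤ} (hZn : (2 : ℤ) ^ Fintype.card V ≤ Z) {ω : V → V → ℤ}
    (hω : ∀ u v, 0 ≤ ω u v) (hs : ∀ u v, ω u v = ω v u) (hZω : ∑ u, ∑ v, ω u v ≤ Z)
    (hvol : 0 < ∑ u, ∑ v, ω u v) {x : V → ℝ} (hx : ∀ u, x u ^ 2 = 1) {δ : ℝ} (hδ4 : δ ≤ 1 / 4)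
    (hδZ : 1 ≤ δ * (Z : ℝ) ^ 20) (hxδ : energy (castW ω) x ≤ 2 * δ * mass (castW ω) x) :
    ∃ j v, (2 : ℤ) ^ j < Z ^ 32 ∧
      0 < mass (castW ω) (fun u => (walkApprox (Z ^ 128) ω j u v : ℝ)) ∧
      energy (castW ω) (fun u => (walkApprox (Z ^ 128) ω j u v : ℝ))
        ≤ 60 * δ * mass (castW ω) (fun u => (walkApprox (Z ^ 128) ω j u v : ℝ)) := by
  set n := Fintype.card V with hn
  set w := castW ω with hwdef
  have hw : ∀ u v, 0 ≤ w u v := fun u v => by simpa [hwdef, castW] using hω u v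
  have hws : ∀ u v, w u v = w v u := fun u v => by simp only [hwdef, castW, hs]
  have hV : Nonempty V := by
    by_contra hV
    rw [not_nonempty_iff] at hV
    simp at hvol
  have hn1 : 1 ≤ n := Fintype.card_pos
  set z : ℝ := (Z : ℝ) with hz
  have hzn : (2 : ℝ) ^ n ≤ z := by rw [hz]; exact_mod_cast hZn
  have hz2 : 2 ≤ z := by
    refine le_trans ?_ hzn
    simpa using pow_le_pow_right₀ (by norm_num : (1 : ℝ) ≤ 2) hn1
  have hz1 : 1 ≤ z := by linarith
  have hz0 : 0 < z := by linarith
  have hnz : (n : ℝ) ≤ z := by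
    refine le_trans ?_ hzn
    exact_mod_cast Nat.lt_two_pow_self.le
  have hδ0 : 0 < δ := by
    by_contra! h
    have := mul_nonpos_of_nonpos_of_nonneg h (pow_nonneg hz0.le 20)
    linarith
  have hxm : mass w x = ∑ u, ∑ v, w u v := by simp [mass, hx, rowSum]
  have hcast : ∑ u, ∑ v, w u v = ((∑ u, ∑ v, ω u v : ℤ) : ℝ) := by simp [hwdef, castW]
  have hvol' : 0 < mass w x := by rw [hxm, hcast]; exact_mod_cast hvol
  have hvolz : ∑ u, rowSum w u ≤ z := by
    have : ∑ u, rowSum w u = ((∑ u, ∑ v, ω u v : ℤ) : ℝ) := hcast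
    rw [this, hz]; exact_mod_cast hZω
  -- The power of two between `n / δ` and `2 n / δ`.
  obtain ⟨j, hj1, hj2⟩ : ∃ j : ℕ, (n : ℝ) ≤ δ * 2 ^ j ∧ δ * 2 ^ j ≤ 2 * n := by
    have hex : ∃ j : ℕ, (n : ℝ) ≤ δ * 2 ^ j := by
      obtain ⟨j, hj⟩ := pow_unbounded_of_one_lt (n / δ) (by norm_num : (1 : ℝ) < 2)
      exact ⟨j, by rw [div_lt_iff₀ hδ0] at hj; linarith⟩
    classical
    refine ⟨Nat.find hex, Nat.find_spec hex, ?_⟩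
    rcases Nat.eq_zero_or_pos (Nat.find hex) with h0 | h0
    · rw [h0]
      have : (1 : ℝ) ≤ n := by exact_mod_cast hn1
      linarith
    · have := Nat.find_min hex (Nat.sub_lt h0 one_pos)
      rw [not_le] at this
      obtain ⟨i, hi⟩ := Nat.exists_eq_succ_of_ne_zero h0.ne'
      rw [hi, Nat.succ_sub_one] at this
      rw [hi, pow_succ]
      linarith
  have hjz : (2 : ℝ) ^ j ≤ z ^ 22 := by
    have h1 : 2 ^ j ≤ (δ * 2 ^ j) * z ^ 20 := by
      calc (2 : ℝ) ^ j = 1 * 2 ^ j := by ring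
        _ ≤ (δ * z ^ 20) * 2 ^ j := by gcongr
        _ = _ := by ring
    calc (2 : ℝ) ^ j ≤ (δ * 2 ^ j) * z ^ 20 := h1
      _ ≤ (2 * n) * z ^ 20 := by gcongr
      _ ≤ (z * z) * z ^ 20 := by gcongr
      _ = _ := by ring
  obtain ⟨v, hdv, hmass, hen⟩ := exists_column_flipWalk_pow hw hws hδ0 hδ4 hvol' hxδ (T := 2 ^ j)
    (by push_cast; exact hj1)
  set f := (flipWalk w ^ 2 ^ j).mulVec (Pi.single v 1) with hf
  have hfu : ∀ u, f u = (flipWalk w ^ 2 ^ j) u v := fun u => by rw [hf]; simp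
  set N : ℤ := Z ^ 128 with hN
  have hNz : (N : ℝ) = z ^ 128 := by simp [hN, hz]
  have hN0 : 0 < N := by
    have : (0 : ℝ) < N := by rw [hNz]; positivity
    exact_mod_cast this
  have hN0' : (0 : ℝ) < N := by exact_mod_cast hN0
  have h4j : 4 ^ j * (n : ℝ) ≤ z ^ 45 := by
    have : (4 : ℝ) ^ j = 2 ^ j * 2 ^ j := by rw [← mul_pow]; norm_num
    rw [this]
    calc (2 : ℝ) ^ j * 2 ^ j * n ≤ z ^ 22 * z ^ 22 * z := by gcongr
      _ = _ := by ring
  have h4N : 4 ^ j * (n : ℝ) ≤ N := h4j.trans (by rw [hNz]; exact pow_le_pow_right₀ hz1 (by norm_num))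
  have happ := sum_abs_walkApprox_sub_le hN0 hω j h4N
  set g : V → ℝ := fun u => (walkApprox N ω j u v : ℝ) with hg
  set g' : V → ℝ := fun u => g u / N with hg'
  set e : ℝ := 4 ^ j * n / N with he
  have he0 : 0 ≤ e := by positivity
  have hge : ∀ u, (g' u - f u) ^ 2 ≤ e ^ 2 := by
    intro u
    rw [← sq_abs]
    refine pow_le_pow_left₀ (abs_nonneg _) ?_ 2
    rw [hfu]
    exact (single_le_sum (f := fun v => |(walkApprox N ω j u v : ℝ) / N
      - (flipWalk (castW ω) ^ 2 ^ j) u v|) (fun _ _ => abs_nonneg _) (mem_univ v)).trans (happ u)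
  set μ := mass w f with hμ
  have hez : z * e ^ 2 * z ^ 36 ≤ 1 := by
    have h1 : e * z ^ 83 ≤ 1 := by
      rw [he, div_mul_eq_mul_div, div_le_one hN0', hNz]
      calc 4 ^ j * (n : ℝ) * z ^ 83 ≤ z ^ 45 * z ^ 83 := by gcongr
        _ = _ := by ring
    calc z * e ^ 2 * z ^ 36 = e ^ 2 * z ^ 37 := by ring
      _ ≤ e ^ 2 * z ^ 166 := by gcongr; norm_num
      _ = (e * z ^ 83) ^ 2 := by ring
      _ ≤ 1 := pow_le_one₀ (by positivity) h1
  have hμz : 1 ≤ μ * z ^ 13 := by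
    have h3 := one_le_pow_mul_pow (T := 2 ^ j) hδ0 hδ4 (by push_cast; exact hj2) hzn
    have hdv1 : 1 ≤ rowSum w v := by
      rw [hwdef, rowSum_castW] at hdv ⊢
      have : 0 < rowSum ω v := by exact_mod_cast hdv
      exact_mod_cast this
    calc (1 : ℝ) ≤ (1 - δ) ^ (2 * 2 ^ j) * z ^ 12 := h3
      _ ≤ ((1 - δ) ^ (2 * 2 ^ j) * rowSum w v) * z ^ 12 := by
          gcongr
          exact le_mul_of_one_le_right (pow_nonneg (by linarith) _) hdv1
      _ ≤ (n * μ) * z ^ 12 := by gcongr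
      _ ≤ (z * μ) * z ^ 12 := by gcongr; exact mass_nonneg hw _
      _ = _ := by ring
  have hμ0 : 0 < μ := by
    by_contra! h
    have := mul_nonpos_of_nonpos_of_nonneg h (pow_nonneg hz0.le 13)
    linarith
  -- The rounding error is negligible.
  have herr : z * e ^ 2 ≤ δ * μ / 4 := by
    have h1 : 1 ≤ (δ * μ) * z ^ 33 := by
      calc (1 : ℝ) = 1 * 1 := by ring
        _ ≤ (δ * z ^ 20) * (μ * z ^ 13) := by gcongr
        _ = _ := by ring
    have h2 : (4 : ℝ) ≤ z ^ 3 := by nlinarith [sq_nonneg z, pow_le_pow_left₀ (by norm_num) hz2 3]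
    have h3 : 0 < z ^ 33 := by positivity
    refine le_of_mul_le_mul_right ?_ h3
    have h4 : z * e ^ 2 * z ^ 33 * 4 ≤ 1 := by
      calc z * e ^ 2 * z ^ 33 * 4 ≤ z * e ^ 2 * z ^ 33 * z ^ 3 := by gcongr
        _ = z * e ^ 2 * z ^ 36 := by ring
        _ ≤ 1 := hez
    linarith
  obtain ⟨hg1, hg2⟩ := energy_le_of_close hw hws hδ0 hδ4 hμ0 hen hge
    ((mul_le_mul_of_nonneg_right hvolz (sq_nonneg e)).trans herr)
  have hscale : g = fun u => N * g' u := by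
    funext u
    simp only [hg']
    field_simp
  refine ⟨j, v, ?_, ?_, ?_⟩
  · have : (2 : ℝ) ^ j < z ^ 32 := hjz.trans_lt (pow_lt_pow_right₀ (by linarith) (by norm_num))
    rw [hz] at this
    exact_mod_cast this
  · change 0 < mass w g
    rw [hscale, mass_const_mul_right]
    positivity
  · change energy w g ≤ 60 * δ * mass w g
    rw [hscale, mass_const_mul_right, energy_const_mul_right, mul_left_comm]
    exact mul_le_mul_of_nonneg_left hg2 (by positivity)

end CutForm

namespace CutForm

/-! ### Iterated removal of signed vertex sets -/

variable {V : Type*}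

/-- The weights that remain when the vertices in the support of `σ` are removed. -/
def removeSupport (ω : V → V → ℤ) (σ : V → ℤ) (u v : V) : ℤ :=
  if σ u = 0 ∧ σ v = 0 then ω u v else 0

lemma removeSupport_nonneg {ω : V → V → ℤ} {σ : V → ℤ} (hω : ∀ u v, 0 ≤ ω u v) (u v : V) :
    0 ≤ removeSupport ω σ u v := by
  unfold removeSupport
  split_ifs
  · exact hω u v
  · exact le_rfl

lemma removeSupport_symm {ω : V → V → ℤ} {σ : V → ℤ} (hs : ∀ u v, ω u v = ω v u)
    (u v : V) :
    removeSupport ω σ u v = removeSupport ω σ v u := by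
  simp only [removeSupport, hs u v, and_comm]

lemma removeSupport_le {ω : V → V → ℤ} {σ : V → ℤ} (hω : ∀ u v, 0 ≤ ω u v) (u v : V) :
    removeSupport ω σ u v ≤ ω u v := by
  unfold removeSupport
  split_ifs
  · exact le_rfl
  · exact hω u v

variable [Fintype V]

/-- What removing the signed set `σ` costs: each uncut edge inside counts `8`, each edge that leaves
the set counts `2`, and the weight removed earlier at the vertices of the set is deducted. -/
def cutCost (W ω : V → V → ℤ) (σ : V → ℤ) : ℤ :=
  ∑ u, ∑ v, (ω u v * (σ u + σ v) ^ 2 - (W u v - ω u v) * σ u ^ 2)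

/-- The degree sum of the signed set `σ`. -/
def cutMass (ω : V → V → ℤ) (σ : V → ℤ) : ℤ := ∑ u, ∑ v, ω u v * σ u ^ 2

/-- Twice the total weight of the edges. -/
def total (ω : V → V → ℤ) : ℤ := ∑ u, ∑ v, ω u v

/-- Twice the weight of the edges that `S` does not cut. -/
def uncut [DecidableEq V] (ω : V → V → ℤ) (S : Finset V) : ℤ :=
  ∑ u, ∑ v, if (u ∈ S ↔ v ∈ S) then ω u v else 0

/-- The removed weight at the vertices that are not isolated in the remaining graph. -/
def boundary (W ω : V → V → ℤ) : ℤ :=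
  ∑ u, if rowSum ω u = 0 then 0 else ∑ v, (W u v - ω u v)

section Remove

variable {W ω : V → V → ℤ} {σ : V → ℤ}

lemma int_eq_zero_of_rowSum_eq_zero (hω : ∀ u v, 0 ≤ ω u v) {u : V} (h : rowSum ω u = 0) (v : V) :
    ω u v = 0 :=
  (sum_eq_zero_iff_of_nonneg fun v _ => hω u v).1 h v (mem_univ v)

lemma rowSum_removeSupport_of_ne {u : V} (h : σ u ≠ 0) : rowSum (removeSupport ω σ) u = 0 :=
  sum_eq_zero fun _ _ => if_neg fun hc => h hc.1

lemma rowSum_removeSupport_of_eq (hω : ∀ u v, 0 ≤ ω u v) {u : V} (h : rowSum ω u = 0) :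
    rowSum (removeSupport ω σ) u = 0 :=
  sum_eq_zero fun v _ => by
    rw [removeSupport, int_eq_zero_of_rowSum_eq_zero hω h, ite_self]

lemma sum_removeSupport_add_le (hω : ∀ u v, 0 ≤ ω u v) (hσ : ∀ u, σ u = 0 ∨ σ u = 1 ∨ σ u = -1) :
    total (removeSupport ω σ) + cutMass ω σ ≤ total ω := by
  rw [total, total, cutMass, ← sum_add_distrib]
  refine sum_le_sum fun u _ => ?_
  rw [← sum_add_distrib]
  refine sum_le_sum fun v _ => ?_
  have := hω u v
  unfold removeSupport
  rcases hσ u with h | h | h <;> rw [h] <;> split_ifs <;> simp_all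

lemma uncut_sub_removeSupport_le [DecidableEq V] (hω : ∀ u v, 0 ≤ ω u v)
    (hσ : ∀ u, σ u = 0 ∨ σ u = 1 ∨ σ u = -1) {T : Finset V}
    (hT1 : ∀ u, σ u = 1 → u ∈ T) (hT2 : ∀ u, σ u = -1 → u ∉ T) :
    uncut (fun u v => W u v - removeSupport ω σ u v) T
      ≤ uncut (fun u v => W u v - ω u v) T + ∑ u, ∑ v, ω u v * (σ u + σ v) ^ 2 := by
  simp only [uncut]
  rw [← sum_add_distrib]
  refine sum_le_sum fun u _ => ?_
  rw [← sum_add_distrib]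
  refine sum_le_sum fun v _ => ?_
  have h0 := hω u v
  unfold removeSupport
  have h1u := hT1 u
  have h1v := hT1 v
  have h2u := hT2 u
  have h2v := hT2 v
  rcases hσ u with h | h | h <;> rcases hσ v with h' | h' | h' <;> simp only [h, h'] at * <;>
    norm_num at * <;> split_ifs <;> (try tauto) <;> nlinarith

lemma two_mul_sum_cross_le (hω : ∀ u v, 0 ≤ ω u v) (hs : ∀ u v, ω u v = ω v u)
    (hσ : ∀ u, σ u = 0 ∨ σ u = 1 ∨ σ u = -1) :
    2 * ∑ u, ∑ v, ω u v * ((1 - σ u ^ 2) * σ v ^ 2) ≤ ∑ u, ∑ v, ω u v * (σ u + σ v) ^ 2 := by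
  have h1 : ∑ u, ∑ v, ω u v * ((1 - σ u ^ 2) * σ v ^ 2)
      = ∑ u, ∑ v, ω u v * ((1 - σ v ^ 2) * σ u ^ 2) := by
    rw [sum_comm]
    exact sum_congr rfl fun u _ => sum_congr rfl fun v _ => by rw [hs]
  rw [two_mul]
  nth_rewrite 2 [h1]
  rw [← sum_add_distrib]
  refine sum_le_sum fun u _ => ?_
  rw [← sum_add_distrib]
  refine sum_le_sum fun v _ => ?_
  have h0 := hω u v
  rcases hσ u with h | h | h <;> rcases hσ v with h' | h' | h' <;> rw [h, h'] <;> linarith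

lemma boundary_removeSupport_le (hω : ∀ u v, 0 ≤ ω u v) (hs : ∀ u v, ω u v = ω v u)
    (hle : ∀ u v, ω u v ≤ W u v) (hσ : ∀ u, σ u = 0 ∨ σ u = 1 ∨ σ u = -1)
    (hσ0 : ∀ u, rowSum ω u = 0 → σ u = 0) :
    2 * boundary W (removeSupport ω σ) ≤ 2 * boundary W ω
      - 2 * ∑ u, ∑ v, (W u v - ω u v) * σ u ^ 2 + ∑ u, ∑ v, ω u v * (σ u + σ v) ^ 2 := by
  have h1 : boundary W (removeSupport ω σ) ≤ boundary W ω
      - ∑ u, ∑ v, (W u v - ω u v) * σ u ^ 2 + ∑ u, ∑ v, ω u v * ((1 - σ u ^ 2) * σ v ^ 2) := by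
    simp only [boundary]
    rw [← sum_sub_distrib, ← sum_add_distrib]
    refine sum_le_sum fun u _ => ?_
    rcases hσ u with h | h
    · have h2 : ∑ v, (W u v - removeSupport ω σ u v)
          ≤ ∑ v, (W u v - ω u v) + ∑ v, ω u v * ((1 - σ u ^ 2) * σ v ^ 2) := by
        rw [← sum_add_distrib]
        refine sum_le_sum fun v _ => ?_
        have h0 := hω u v
        unfold removeSupport
        rcases hσ v with h' | h' | h' <;> simp [h, h']
      have h3 : 0 ≤ ∑ v, ω u v * ((1 - σ u ^ 2) * σ v ^ 2) :=
        sum_nonneg fun v _ => mul_nonneg (hω u v) (by rw [h]; nlinarith [sq_nonneg (σ v)])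
      have h4 : 0 ≤ ∑ v, (W u v - ω u v) := sum_nonneg fun v _ => sub_nonneg.2 (hle u v)
      have h5 : ∑ v, (W u v - ω u v) * σ u ^ 2 = 0 := by simp [h]
      rw [h5]
      by_cases hr : rowSum ω u = 0
      · rw [if_pos hr, if_pos (rowSum_removeSupport_of_eq hω hr)]
        linarith
      · rw [if_neg hr]
        split_ifs <;> linarith
    · have hu : σ u ≠ 0 := by rcases h with h | h <;> rw [h] <;> norm_num
      have h2 : σ u ^ 2 = 1 := by rcases h with h | h <;> rw [h] <;> norm_num
      rw [if_pos (rowSum_removeSupport_of_ne hu), if_neg fun hr => hu (hσ0 u hr)]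
      simp [h2]
  have h2 := two_mul_sum_cross_le hω hs hσ
  linarith

end Remove

variable [DecidableEq V]

/-- The signed sets among which the algorithm chooses: the levels of the columns of the computed
matrices. -/
def candidate (Z : ℤ) (ω : V → V → ℤ) (j : ℕ) (v s : V) : V → ℤ :=
  level |walkApprox (Z ^ 128) ω j s v| fun u => walkApprox (Z ^ 128) ω j u v

/-- `σ` is a candidate of least cost in relation to its mass, or `0` if all candidates have
mass `0`. -/
structure BestCandidate (Z : ℤ) (W ω : V → V → ℤ) (σ : V → ℤ) : Prop where
  eq_zero_or : σ = 0 ∨ ∃ j v s, σ = candidate Z ω j v s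
  le_of_pos : ∀ j v s, (2 : ℤ) ^ j < Z ^ 32 → 0 < cutMass ω (candidate Z ω j v s) →
    0 < cutMass ω σ ∧ cutCost W ω σ * cutMass ω (candidate Z ω j v s)
      ≤ cutCost W ω (candidate Z ω j v s) * cutMass ω σ

/-- `Run Z W i ω S`: after `i` removals the remaining weights are `ω` and the first side of the cut
is `S`. -/
inductive Run (Z : ℤ) (W : V → V → ℤ) : ℕ → (V → V → ℤ) → Finset V → Prop
  | start : Run Z W 0 W ∅
  | step {i : ℕ} {ω : V → V → ℤ} {S : Finset V} {σ : V → ℤ} : Run Z W i ω S →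
      BestCandidate Z W ω σ → Run Z W (i + 1) (removeSupport ω σ) (S ∪ ({u | σ u = 1} : Finset V))

lemma candidate_cases (Z : ℤ) (ω : V → V → ℤ) (j : ℕ) (v s u : V) :
    candidate Z ω j v s u = 0 ∨ candidate Z ω j v s u = 1 ∨ candidate Z ω j v s u = -1 :=
  level_cases _ _ _

lemma candidate_eq_zero (Z : ℤ) {ω : V → V → ℤ} {u : V} (hu : rowSum ω u = 0) (j : ℕ) (v s : V) :
    candidate Z ω j v s u = 0 := by
  rw [candidate, level, walkApprox_eq_zero _ hu]
  have h := abs_nonneg (walkApprox (Z ^ 128) ω j s v)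
  by_cases h0 : |walkApprox (Z ^ 128) ω j s v| ≤ 0
  · rw [if_pos h0, if_pos (by linarith), sub_self]
  · rw [if_neg h0, if_neg (by linarith), sub_self]

lemma BestCandidate.cases {Z : ℤ} {W ω : V → V → ℤ} {σ : V → ℤ} (h : BestCandidate Z W ω σ) (u : V) :
    σ u = 0 ∨ σ u = 1 ∨ σ u = -1 := by
  rcases h.eq_zero_or with rfl | ⟨j, v, s, rfl⟩
  · exact Or.inl rfl
  · exact candidate_cases Z ω j v s u

lemma BestCandidate.eq_zero {Z : ℤ} {W ω : V → V → ℤ} {σ : V → ℤ} (h : BestCandidate Z W ω σ) {u : V}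
    (hu : rowSum ω u = 0) : σ u = 0 := by
  rcases h.eq_zero_or with rfl | ⟨j, v, s, rfl⟩
  · rfl
  · exact candidate_eq_zero Z hu j v s

/-- `ω` can arise from the weights `W` by removing edges. -/
structure RemainingWeights (W ω : V → V → ℤ) : Prop where
  nonneg : ∀ u v, 0 ≤ ω u v
  symm : ∀ u v, ω u v = ω v u
  le : ∀ u v, ω u v ≤ W u v

lemma Run.remainingWeights {Z : ℤ} {W : V → V → ℤ} (hW : ∀ u v, 0 ≤ W u v)
    (hS : ∀ u v, W u v = W v u) {i : ℕ} {ω : V → V → ℤ} {S : Finset V} (h : Run Z W i ω S) :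
    RemainingWeights W ω := by
  induction h with
  | start => exact ⟨hW, hS, fun _ _ => le_rfl⟩
  | step _ _ ih => exact ⟨removeSupport_nonneg ih.nonneg, removeSupport_symm ih.symm,
      fun u v => (removeSupport_le ih.nonneg u v).trans (ih.le u v)⟩

lemma Run.rowSum_eq_zero {Z : ℤ} {W : V → V → ℤ} (hW : ∀ u v, 0 ≤ W u v)
    (hS : ∀ u v, W u v = W v u) {i : ℕ} {ω : V → V → ℤ} {S : Finset V} (h : Run Z W i ω S) {u : V}
    (hu : u ∈ S) : rowSum ω u = 0 := by
  induction h with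
  | start => simp at hu
  | step h _ ih =>
    rcases mem_union.1 hu with hu | hu
    · exact rowSum_removeSupport_of_eq (h.remainingWeights hW hS).nonneg (ih hu)
    · simp only [mem_filter, mem_univ, true_and] at hu
      exact rowSum_removeSupport_of_ne (by rw [hu]; norm_num)

/-- The loss of the final cut. As long as the remaining volume is at least `Θ`, each step pays for
its cost by `κ` times the fraction of the volume that it removes, and by half of the weight that it
takes from the boundary; the latter was paid for when it became part of the boundary. -/
theorem Run.uncut_le {Z : ℤ} {W : V → V → ℤ} (hW : ∀ u v, 0 ≤ W u v) (hS : ∀ u v, W u v = W v u)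
    {Θ κ : ℝ} (hΘ : 0 < Θ) (hκ : 0 ≤ κ) (hΘV : Θ ≤ (total W : ℝ))
    (hgood : ∀ ω σ, RemainingWeights W ω → Θ ≤ (total ω : ℝ) →
      BestCandidate Z W ω σ → 0 < cutMass ω σ ∧
        (cutCost W ω σ : ℝ) ≤ κ / (total ω : ℝ) * cutMass ω σ)
    {ω : V → V → ℤ} {S : Finset V} (h : Run Z W (Fintype.card V) ω S) :
    (uncut W S : ℝ)
      ≤ 2 * κ * (1 + Real.log ((total W : ℝ) / Θ)) + Θ := by
  set bound := 2 * κ * (1 + Real.log ((total W : ℝ) / Θ)) + Θ with hbound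
  have hlogΘ : 0 ≤ Real.log ((total W : ℝ) / Θ) := Real.log_nonneg (by rwa [one_le_div hΘ])
  -- Final cuts that are compatible with the decisions made so far.
  let Compat : (V → V → ℤ) → Finset V → Finset V → Prop := fun ω S T =>
    ∀ u, rowSum ω u = 0 → (u ∈ T ↔ u ∈ S)
  -- As long as the volume is at least `Θ`, `l` bounds the loss so far, and together with the
  -- boundary, which is the credit for later steps, it is paid for by the logarithm of the decrease
  -- of the volume. Each step decides a new vertex, so the volume eventually falls below `Θ`; from
  -- then on at most `Θ` more can be lost.
  have inv : ∀ i ω S, Run Z W i ω S →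
      (Θ ≤ (total ω : ℝ) ∧ i ≤ #{u | rowSum ω u = 0} ∧ ∃ l : ℝ,
        (∀ T, Compat ω S T → (uncut (fun u v => W u v - ω u v) T : ℝ) ≤ l) ∧
        l + 2 * boundary W ω ≤ 2 * κ * Real.log ((total W : ℝ) / (total ω : ℝ))) ∨
      ∀ T, Compat ω S T → (uncut W T : ℝ) ≤ bound := by
    intro i ω S h
    induction h with
    | start =>
      left
      refine ⟨hΘV, Nat.zero_le _, 0, fun T _ => by simp [uncut], ?_⟩
      have h1 : (total W : ℝ) ≠ 0 := (hΘ.trans_le hΘV).ne'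
      rw [div_self h1, Real.log_one]
      simp [boundary]
    | @step i ω S σ hrun hbest ih =>
      have hrw := hrun.remainingWeights hW hS
      have hσ := hbest.cases
      set ω' := removeSupport ω σ with hω'
      set S' := S ∪ ({u | σ u = 1} : Finset V) with hS'
      have hcompat : ∀ T, Compat ω' S' T → Compat ω S T := by
        intro T hT u hu
        rw [hT u (rowSum_removeSupport_of_eq hrw.nonneg hu), hS', mem_union, mem_filter,
          hbest.eq_zero hu]
        simp
      rcases ih with ⟨hv, hi, l, hl, hinv⟩ | ih
      · obtain ⟨hm, hc⟩ := hgood ω σ hrw hv hbest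
        have hv0 : 0 < (total ω : ℝ) := hΘ.trans_le hv
        set E : ℤ := ∑ u, ∑ v, ω u v * (σ u + σ v) ^ 2 with hE
        set b : ℤ := ∑ u, ∑ v, (W u v - ω u v) * σ u ^ 2 with hb
        have hcost : cutCost W ω σ = E - b := by simp only [cutCost, sum_sub_distrib, hE, hb]
        have hl' : ∀ T, Compat ω' S' T →
            (uncut (fun u v => W u v - ω' u v) T : ℝ) ≤ l + E := by
          intro T hT
          have h1 := uncut_sub_removeSupport_le (W := W) hrw.nonneg hσ (T := T)
            (fun u hu => by
              rw [hT u (rowSum_removeSupport_of_ne (by rw [hu]; norm_num)), hS', mem_union]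
              exact Or.inr (by simp [hu]))
            (fun u hu => by
              rw [hT u (rowSum_removeSupport_of_ne (by rw [hu]; norm_num)), hS', mem_union]
              rintro (h2 | h2)
              · have := hbest.eq_zero (hrun.rowSum_eq_zero hW hS h2)
                rw [hu] at this
                norm_num at this
              · simp [hu] at h2)
          have h2 : (uncut (fun u v => W u v - ω' u v) T : ℝ)
              ≤ uncut (fun u v => W u v - ω u v) T + E := by exact_mod_cast h1
          linarith [hl T (hcompat T hT)]
        have hb' : 2 * (boundary W ω' : ℝ) ≤ 2 * boundary W ω - 2 * b + E := by
          exact_mod_cast boundary_removeSupport_le hrw.nonneg hrw.symm hrw.le hσ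
            fun u hu => hbest.eq_zero hu
        have hcost' : (cutCost W ω σ : ℝ) = E - b := by exact_mod_cast hcost
        have hstep : (total ω' : ℝ) + cutMass ω σ ≤ (total ω : ℝ) := by
          exact_mod_cast sum_removeSupport_add_le hrw.nonneg hσ
        have hrw' := (Run.step hrun hbest).remainingWeights hW hS
        have hv'0 : 0 ≤ (total ω' : ℝ) := by
          have : 0 ≤ total ω' := sum_nonneg fun u _ => sum_nonneg fun v _ => hrw'.nonneg u v
          exact_mod_cast this
        have hbd0 : 0 ≤ (boundary W ω' : ℝ) := by
          have : 0 ≤ boundary W ω' := sum_nonneg fun u _ => by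
            split_ifs
            · exact le_rfl
            · exact sum_nonneg fun v _ => sub_nonneg.2 (hrw'.le u v)
          exact_mod_cast this
        have hfrac : (cutCost W ω σ : ℝ) ≤ κ * (1 - (total ω' : ℝ) / (total ω : ℝ)) := by
          calc (cutCost W ω σ : ℝ) ≤ κ / (total ω : ℝ) * cutMass ω σ := hc
            _ ≤ κ / (total ω : ℝ) * ((total ω : ℝ) - (total ω' : ℝ)) := by gcongr; linarith
            _ = _ := by field_simp
        by_cases hvΘ : Θ ≤ (total ω' : ℝ)
        · left
          have hv'0 : 0 < (total ω' : ℝ) := hΘ.trans_le hvΘ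
          refine ⟨hvΘ, ?_, l + E, hl', ?_⟩
          · have : ({u | rowSum ω u = 0} : Finset V) ⊂ ({u | rowSum ω' u = 0} : Finset V) := by
              refine ⟨fun u hu => ?_, fun hsub => ?_⟩
              · simp only [mem_filter, mem_univ, true_and] at hu ⊢
                exact rowSum_removeSupport_of_eq hrw.nonneg hu
              · have hz : σ = 0 := by
                  funext u
                  by_contra hu
                  have h1 : u ∈ ({u | rowSum ω u = 0} : Finset V) := hsub (by
                    simp only [mem_filter, mem_univ, true_and]
                    exact rowSum_removeSupport_of_ne hu)
                  simp only [mem_filter, mem_univ, true_and] at h1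
                  exact hu (hbest.eq_zero h1)
                rw [hz] at hm
                simp [cutMass] at hm
            exact Nat.succ_le_of_lt (hi.trans_lt (card_lt_card this))
          · have hlog : 1 - (total ω' : ℝ) / (total ω : ℝ) ≤ Real.log ((total ω : ℝ) / (total ω' : ℝ)) := by
              have := Real.one_sub_inv_le_log_of_pos (div_pos hv0 hv'0)
              rwa [inv_div] at this
            have hadd : Real.log ((total W : ℝ) / (total ω' : ℝ))
                = Real.log ((total W : ℝ) / (total ω : ℝ)) + Real.log ((total ω : ℝ) / (total ω' : ℝ)) := by
              rw [← Real.log_mul (div_pos (hΘ.trans_le hΘV) hv0).ne' (div_pos hv0 hv'0).ne']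
              congr 1
              field_simp
            rw [hadd]
            nlinarith [mul_le_mul_of_nonneg_left hlog hκ]
        · right
          intro T hT
          rw [not_le] at hvΘ
          have h1 : (uncut W T : ℝ) ≤ uncut (fun u v => W u v - ω' u v) T + (total ω' : ℝ) := by
            have : uncut W T ≤ uncut (fun u v => W u v - ω' u v) T + total ω' := by
              simp only [uncut, total]
              rw [← sum_add_distrib]
              refine sum_le_sum fun u _ => ?_
              rw [← sum_add_distrib]
              refine sum_le_sum fun v _ => ?_
              have := hrw'.nonneg u v
              split_ifs <;> linarith
            exact_mod_cast this
          have h2 := hl' T hT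
          have h3 : Real.log ((total W : ℝ) / (total ω : ℝ)) ≤ Real.log ((total W : ℝ) / Θ) := by
            refine Real.log_le_log (div_pos (hΘ.trans_le hΘV) hv0) ?_
            exact div_le_div_of_nonneg_left (hΘ.trans_le hΘV).le hΘ hv
          have h4 := mul_le_mul_of_nonneg_left h3 hκ
          have h5 : κ * (1 - (total ω' : ℝ) / (total ω : ℝ)) ≤ κ := by
            have : 0 ≤ (total ω' : ℝ) / (total ω : ℝ) := by positivity
            nlinarith
          rw [hbound]
          linarith
      · exact Or.inr fun T hT => ih T (hcompat T hT)
  rcases inv _ ω S h with ⟨hv, hi, -⟩ | hfin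
  · exfalso
    have huniv : ({u | rowSum ω u = 0} : Finset V) = univ :=
      eq_univ_of_card _ (le_antisymm (card_le_univ _) hi)
    have h0 : total ω = 0 := sum_eq_zero fun u _ => by
      have : u ∈ ({u | rowSum ω u = 0} : Finset V) := by rw [huniv]; exact mem_univ u
      exact (mem_filter.1 this).2
    rw [h0, Int.cast_zero] at hv
    linarith
  · exact hfin S fun u _ => Iff.rfl

end CutForm

namespace CutForm

/-! ### The loss of a run -/

variable {V : Type*}

lemma level_cast (s : ℤ) (g : V → ℤ) :
    level (s : ℝ) (fun u => (g u : ℝ)) = fun u => ((level s g u : ℤ) : ℝ) := by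
  funext u
  simp only [level]
  push_cast
  congr 1 <;> congr 1 <;> norm_cast

/-- The vector with entries `1` on `T` and `-1` elsewhere. -/
def signs [DecidableEq V] (T : Finset V) (u : V) : ℝ := if u ∈ T then 1 else -1

lemma signs_sq [DecidableEq V] (T : Finset V) (u : V) : signs T u ^ 2 = 1 := by
  unfold signs
  split_ifs <;> norm_num

variable [Fintype V]

lemma mass_cast (ω : V → V → ℤ) (σ : V → ℤ) :
    mass (castW ω) (fun u => (σ u : ℝ)) = cutMass ω σ := by
  simp [mass, cutMass, rowSum, castW, sum_mul]

lemma cutCost_cast (W ω : V → V → ℤ) (σ : V → ℤ) :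
    (cutCost W ω σ : ℝ) = 2 * energy (castW ω) (fun u => (σ u : ℝ))
      - ∑ u, (rowSum (castW W) u - rowSum (castW ω) u) * (σ u : ℝ) ^ 2 := by
  have h1 : 2 * energy (castW ω) (fun u => (σ u : ℝ))
      = ∑ u, ∑ v, castW ω u v * ((σ u : ℝ) + σ v) ^ 2 := by
    rw [energy, ← mul_assoc]
    norm_num
  rw [h1, cutCost, ← sum_sub_distrib]
  push_cast
  refine sum_congr rfl fun u _ => ?_
  rw [rowSum, rowSum, ← sum_sub_distrib, sum_mul, ← sum_sub_distrib]
  rfl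

lemma energy_mono {w W : V → V → ℝ} (h : ∀ u v, w u v ≤ W u v) (f : V → ℝ) :
    energy w f ≤ energy W f := by
  unfold energy
  gcongr with u _ v _
  exact h u v

lemma cutMass_pos {ω : V → V → ℤ} (hω : ∀ u v, 0 ≤ ω u v) {σ : V → ℤ} {u : V} (hu : σ u ≠ 0)
    (hr : rowSum ω u ≠ 0) : 0 < cutMass ω σ := by
  have h1 : 0 < rowSum ω u := lt_of_le_of_ne (sum_nonneg fun v _ => hω u v) hr.symm
  have h2 : 0 < rowSum ω u * σ u ^ 2 := by positivity
  have h3 : rowSum ω u * σ u ^ 2 ≤ cutMass ω σ := by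
    rw [rowSum, sum_mul]
    exact single_le_sum (f := fun u => ∑ v, ω u v * σ u ^ 2)
      (fun u _ => sum_nonneg fun v _ => mul_nonneg (hω u v) (sq_nonneg _)) (mem_univ u)
  linarith

lemma RemainingWeights.total_le {W ω : V → V → ℤ} (h : RemainingWeights W ω) : total ω ≤ total W :=
  sum_le_sum fun u _ => sum_le_sum fun v _ => h.le u v

lemma two_le_of_total_pos {Z : ℤ} {W : V → V → ℤ} (hZn : (2 : ℤ) ^ Fintype.card V ≤ Z) (h : total W ≠ 0) : 2 ≤ Z := by
  have : Nonempty V := by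
    by_contra hV
    rw [not_nonempty_iff] at hV
    simp [total] at h
  refine le_trans ?_ hZn
  simpa using pow_le_pow_right₀ (by norm_num : (1 : ℤ) ≤ 2) (Fintype.card_pos (α := V))

variable [DecidableEq V]

lemma energy_signs (W : V → V → ℤ) (T : Finset V) :
    energy (castW W) (signs T) = 2 * uncut W T := by
  simp only [energy, uncut, castW, signs]
  push_cast
  rw [mul_sum, mul_sum]
  refine sum_congr rfl fun u _ => ?_
  rw [mul_sum, mul_sum]
  refine sum_congr rfl fun v _ => ?_
  by_cases hu : u ∈ T <;> by_cases hv : v ∈ T <;> simp [hu, hv] <;> ring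

lemma mass_signs (ω : V → V → ℤ) (T : Finset V) : mass (castW ω) (signs T) = total ω := by
  simp [mass, signs_sq, total, rowSum, castW]

/-- It suffices to find one good level among the columns of small Rayleigh quotient. -/
lemma BestCandidate.le_of_exists {Z : ℤ} {W ω : V → V → ℤ} (hrw : RemainingWeights W ω) {σ : V → ℤ}
    (h : BestCandidate Z W ω σ) {c : ℝ} {j : ℕ} {v : V} (hj : (2 : ℤ) ^ j < Z ^ 32)
    (hex : ∃ s, (walkApprox (Z ^ 128) ω j s v : ℝ) ≠ 0 ∧
      2 * energy (castW ω) (level |(walkApprox (Z ^ 128) ω j s v : ℝ)|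
          fun u => (walkApprox (Z ^ 128) ω j u v : ℝ))
        ≤ ∑ x, (rowSum (castW W) x - rowSum (castW ω) x) *
            level |(walkApprox (Z ^ 128) ω j s v : ℝ)|
              (fun u => (walkApprox (Z ^ 128) ω j u v : ℝ)) x ^ 2
          + c * mass (castW ω) (level |(walkApprox (Z ^ 128) ω j s v : ℝ)|
              fun u => (walkApprox (Z ^ 128) ω j u v : ℝ))) :
    0 < cutMass ω σ ∧ (cutCost W ω σ : ℝ) ≤ c * cutMass ω σ := by
  obtain ⟨s, hs0, hs⟩ := hex
  have hlev : level |(walkApprox (Z ^ 128) ω j s v : ℝ)|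
      (fun u => (walkApprox (Z ^ 128) ω j u v : ℝ)) = fun u => (candidate Z ω j v s u : ℝ) := by
    rw [← Int.cast_abs, level_cast]
    rfl
  rw [hlev, mass_cast] at hs
  have hcost : (cutCost W ω (candidate Z ω j v s) : ℝ)
      ≤ c * cutMass ω (candidate Z ω j v s) := by
    rw [cutCost_cast]
    linarith
  have hs1 : walkApprox (Z ^ 128) ω j s v ≠ 0 := by exact_mod_cast hs0
  have hcs : candidate Z ω j v s s ≠ 0 := by
    unfold candidate level
    have h1 := abs_pos.2 hs1
    rcases lt_or_gt_of_ne hs1 with hlt | hlt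
    · rw [abs_of_neg hlt, if_neg (by linarith), if_pos (by linarith)]
      norm_num
    · rw [abs_of_pos hlt, if_pos le_rfl, if_neg (by linarith)]
      norm_num
  have hr : rowSum ω s ≠ 0 := fun hr => hs1 (walkApprox_eq_zero _ hr j v)
  have hpos := cutMass_pos hrw.nonneg hcs hr
  obtain ⟨hσ, hle⟩ := h.le_of_pos j v s hj hpos
  refine ⟨hσ, ?_⟩
  have hpos' : (0 : ℝ) < cutMass ω (candidate Z ω j v s) := by exact_mod_cast hpos
  have hσ' : (0 : ℝ) < cutMass ω σ := by exact_mod_cast hσ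
  have hle' : (cutCost W ω σ : ℝ) * cutMass ω (candidate Z ω j v s)
      ≤ cutCost W ω (candidate Z ω j v s) * cutMass ω σ := by exact_mod_cast hle
  refine le_of_mul_le_mul_right ?_ hpos'
  calc (cutCost W ω σ : ℝ) * cutMass ω (candidate Z ω j v s)
      ≤ cutCost W ω (candidate Z ω j v s) * cutMass ω σ := hle'
    _ ≤ c * cutMass ω (candidate Z ω j v s) * cutMass ω σ := by gcongr
    _ = _ := by ring

section Runs

variable {Z : ℤ} {W : V → V → ℤ}

/-- The loss in terms of an upper bound on the energy of the optimal cut. -/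
theorem Run.uncut_le_of_fewSlowParts (hZn : (2 : ℤ) ^ Fintype.card V ≤ Z) (hZW : total W ≤ Z)
    (hW : ∀ u v, 0 ≤ W u v) (hS : ∀ u v, W u v = W v u) {k : ℕ} (hk : 1 ≤ k) {α : ℝ} (hα : 0 < α)
    (hα2 : α ≤ 2) (hspec : FewSlowParts (castW W) k (α / 2)) {T : Finset V} {E : ℝ} (hE1 : 1 ≤ E)
    (hE : 2 * (uncut W T : ℝ) ≤ E) (hEW : 4 * k * E / α ≤ total W) {ω : V → V → ℤ} {S : Finset V}
    (h : Run Z W (Fintype.card V) ω S) :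
    (uncut W S : ℝ) ≤ 2 * (30 * (144 * (2 ^ 16 + 1)) * (k * E / α)) *
      (1 + Real.log (total W / (4 * k * E / α))) + 4 * k * E / α := by
  have hk' : (1 : ℝ) ≤ k := by exact_mod_cast hk
  have hE0 : 0 < E := by linarith
  refine h.uncut_le hW hS (by positivity) (by positivity) hEW ?_
  intro ω σ hrw hvol hbest
  have hΘ : 2 * E ≤ 4 * k * E / α := by
    rw [le_div_iff₀ hα]
    nlinarith
  have hv0 : (0 : ℝ) < total ω := by linarith
  -- On the remaining graph the optimal cut has Rayleigh quotient at most `2 * δ`.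
  set δ : ℝ := E / (2 * total ω) with hδ
  have hδ0 : 0 < δ := by positivity
  have hδv : 2 * δ * total ω = E := by rw [hδ]; field_simp
  have hvZ : (total ω : ℝ) ≤ Z := by exact_mod_cast hrw.total_le.trans hZW
  have hv0' : 0 < total ω := by exact_mod_cast hv0
  have hZ2 : (2 : ℝ) ≤ Z := by
    exact_mod_cast two_le_of_total_pos (W := ω) hZn hv0'.ne'
  have hw : ∀ u v, 0 ≤ castW ω u v := fun u v => Int.cast_nonneg (hrw.nonneg u v)
  have hws : ∀ u v, castW ω u v = castW ω v u := fun u v => by rw [castW, castW, hrw.symm]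
  have hle : ∀ u v, castW ω u v ≤ castW W u v := fun u v => Int.cast_le.2 (hrw.le u v)
  have hSc : ∀ u v, castW W u v = castW W v u := fun u v => by rw [castW, castW, hS]
  obtain ⟨j, v, hj, hm, hen⟩ := exists_column_walkApprox hZn hrw.nonneg hrw.symm
    (hrw.total_le.trans hZW) hv0' (signs_sq T) (δ := δ)
    (by rw [hδ, div_le_iff₀ (by positivity)]; linarith)
    (by
      rw [hδ, div_mul_eq_mul_div, one_le_div (by positivity)]
      calc 2 * (total ω : ℝ) ≤ Z * Z := by gcongr
        _ = (Z : ℝ) ^ 2 := by ring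
        _ ≤ (Z : ℝ) ^ 20 := pow_le_pow_right₀ (by linarith) (by norm_num)
        _ ≤ E * (Z : ℝ) ^ 20 := le_mul_of_one_le_left (by positivity) hE1)
    (by
      rw [mass_signs, hδv]
      exact (energy_mono hle _).trans (by rw [energy_signs]; exact hE))
  obtain ⟨s, hs0, hs⟩ := exists_level_of_fewSlowParts hw hle hws hSc hk hα hα2 hspec hm
    (by positivity : 0 < 60 * δ) hen
  refine hbest.le_of_exists hrw hj ⟨s, hs0, hs.trans_eq ?_⟩
  congr 2
  rw [hδ]
  field_simp
  ring

/-- If all edges can be cut, the run cuts all edges. -/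
theorem Run.uncut_eq_zero (hZn : (2 : ℤ) ^ Fintype.card V ≤ Z) (hZW : total W ≤ Z)
    (hW : ∀ u v, 0 ≤ W u v) (hS : ∀ u v, W u v = W v u) (hpos : 0 < total W) {T : Finset V}
    (hT : uncut W T = 0) {ω : V → V → ℤ} {S : Finset V} (h : Run Z W (Fintype.card V) ω S) :
    uncut W S ≤ 0 := by
  have key := h.uncut_le hW hS (Θ := 1 / 2) (κ := 0) (by norm_num) le_rfl
    (by
      have : (1 : ℝ) ≤ total W := by exact_mod_cast hpos
      linarith) ?_
  · rw [mul_zero, zero_mul, zero_add] at key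
    by_contra! hc
    have : (1 : ℝ) ≤ uncut W S := by exact_mod_cast hc
    linarith
  intro ω σ hrw hvol hbest
  have hv0 : (0 : ℝ) < total ω := by linarith
  have hv0' : 0 < total ω := by exact_mod_cast hv0
  have hvZ : (total ω : ℝ) ≤ Z := by exact_mod_cast hrw.total_le.trans hZW
  have hZ2 : (2 : ℝ) ≤ Z := by
    exact_mod_cast two_le_of_total_pos (W := ω) hZn hv0'.ne'
  have hz0 : (0 : ℝ) < Z := by linarith
  have hw : ∀ u v, 0 ≤ castW ω u v := fun u v => Int.cast_nonneg (hrw.nonneg u v)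
  have hws : ∀ u v, castW ω u v = castW ω v u := fun u v => by rw [castW, castW, hrw.symm]
  have hle : ∀ u v, castW ω u v ≤ castW W u v := fun u v => Int.cast_le.2 (hrw.le u v)
  -- The columns approximate a bipartition up to `Z ^ (-20)`; rounding loses a square root.
  set η : ℝ := 8 / (Z : ℝ) ^ 10 with hη
  obtain ⟨j, v, hj, hm, hen⟩ := exists_column_walkApprox hZn hrw.nonneg hrw.symm
    (hrw.total_le.trans hZW) hv0' (signs_sq T) (δ := 1 / (Z : ℝ) ^ 20)
    (by
      rw [div_le_div_iff₀ (by positivity) (by norm_num)]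
      have : (2 : ℝ) ^ 20 ≤ (Z : ℝ) ^ 20 := pow_le_pow_left₀ (by norm_num) hZ2 20
      norm_num at this
      linarith)
    (by rw [div_mul_cancel₀ _ (by positivity)])
    (by
      refine (energy_mono hle _).trans ?_
      rw [energy_signs, hT, mass_signs]
      rw [Int.cast_zero, mul_zero]
      positivity)
  have hen' : energy (castW ω) (fun u => (walkApprox (Z ^ 128) ω j u v : ℝ))
      ≤ η ^ 2 * mass (castW ω) (fun u => (walkApprox (Z ^ 128) ω j u v : ℝ)) := by
    refine hen.trans (mul_le_mul_of_nonneg_right ?_ hm.le)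
    rw [hη, div_pow, ← pow_mul, mul_one_div]
    gcongr
    norm_num
  have h10 : (2 : ℝ) ^ 10 ≤ (Z : ℝ) ^ 10 := pow_le_pow_left₀ (by norm_num) hZ2 10
  obtain ⟨s, hs0, hs⟩ := exists_level_of_energy_le_sq hw hws hm (η := η) (by positivity)
    (by rw [hη, div_le_one (by positivity)]; norm_num at h10; linarith) hen'
  refine hbest.le_of_exists hrw hj ⟨s, hs0, ?_⟩
  set σ' := level |(walkApprox (Z ^ 128) ω j s v : ℝ)|
    fun u => (walkApprox (Z ^ 128) ω j u v : ℝ) with hσ'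
  have hlev : σ' = fun u => (candidate Z ω j v s u : ℝ) := by
    rw [hσ', ← Int.cast_abs, level_cast]
    rfl
  -- The energy is an integer, and less than one.
  have hsmall : 2 * energy (castW ω) σ' < 1 := by
    refine hs.trans_lt ?_
    have hmass : mass (castW ω) σ' ≤ Z := by
      rw [hlev, mass_cast]
      refine le_trans ?_ hvZ
      have : cutMass ω (candidate Z ω j v s) ≤ total ω := by
        refine sum_le_sum fun u _ => sum_le_sum fun v _ => ?_
        rcases candidate_cases Z ω j _ s u with h | h | h <;> rw [h] <;>
          simp [hrw.nonneg]
      exact_mod_cast this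
    have h9 : (2 : ℝ) ^ 9 ≤ (Z : ℝ) ^ 9 := pow_le_pow_left₀ (by norm_num) hZ2 9
    calc 48 * η * mass (castW ω) σ' ≤ 48 * η * Z := by gcongr
      _ = 384 / (Z : ℝ) ^ 9 := by rw [hη]; field_simp; ring
      _ < 1 := by rw [div_lt_one (by positivity)]; norm_num at h9; linarith
  have hint : 2 * energy (castW ω) σ'
      = ((∑ x, ∑ y, ω x y * (candidate Z ω j v s x + candidate Z ω j v s y) ^ 2 : ℤ) : ℝ) := by
    rw [hlev]
    rw [energy, ← mul_assoc, show (2 : ℝ) * (1 / 2) = 1 by norm_num, one_mul]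
    push_cast
    rfl
  have hzero : 2 * energy (castW ω) σ' ≤ 0 := by
    rw [hint] at hsmall ⊢
    have h1 : (∑ x, ∑ y, ω x y * (candidate Z ω j v s x + candidate Z ω j v s y) ^ 2) < 1 := by
      exact_mod_cast hsmall
    exact_mod_cast Int.lt_add_one_iff.1 h1
  have hb : 0 ≤ ∑ x, (rowSum (castW W) x - rowSum (castW ω) x) * σ' x ^ 2 :=
    sum_nonneg fun x _ => mul_nonneg (sub_nonneg.2 (sum_le_sum fun y _ => hle x y)) (sq_nonneg _)
  rw [zero_div, zero_mul, add_zero]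
  exact hzero.trans hb

end Runs

end CutForm

namespace RAM

/-! ### Cost and correctness of programs -/

/-- Memories all of whose entries have less than `B` bits. -/
structure Bounded (B : ℕ) (m : Mem) : Prop where
  reg : ∀ x, |m.reg x| < 2 ^ B
  arr : ∀ a i j, |m.arr a i j| < 2 ^ B

lemma bits_le {z : ℤ} {b : ℕ} (h : |z| < 2 ^ b) : bits z ≤ b + 1 := by
  rw [bits, Nat.add_le_add_iff_right, Nat.size_le]
  zify
  exact h

lemma abs_lt_two_pow_bits (z : ℤ) : |z| < 2 ^ bits z := by
  have h := Nat.lt_size_self z.natAbs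
  have h2 : (2 : ℤ) ^ Nat.size z.natAbs ≤ 2 ^ bits z :=
    pow_le_pow_right₀ (by norm_num) (Nat.le_succ _)
  zify at h
  exact h.trans_le h2

/-- The number of bits of the value of an expression, as a polynomial in the number of bits of the
entries of the memory. -/
noncomputable def Expr.bitsPoly : Expr → Polynomial ℕ
  | .const c => Polynomial.C (bits c)
  | .reg _ => Polynomial.X
  | .get _ _ _ => Polynomial.X
  | .bin _ e₁ e₂ => e₁.bitsPoly + e₂.bitsPoly + 1

/-- The cost of an expression, as a polynomial in the number of bits of the entries of the
memory. -/
noncomputable def Expr.costPoly : Expr → Polynomial ℕ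
  | .const c => Polynomial.C (bits c)
  | .reg _ => Polynomial.X + 1
  | .get _ i j => i.costPoly + j.costPoly + (i.bitsPoly + 1) + (j.bitsPoly + 1) + (Polynomial.X + 1)
  | .bin _ e₁ e₂ => e₁.costPoly + e₂.costPoly + (e₁.bitsPoly + 1) * (e₂.bitsPoly + 1)

/-- The cost of a program, as a polynomial in the number `B` of bits of the entries of the memory,
for executions in which no loop is repeated more than `B` times. -/
noncomputable def Prog.costPoly : Prog → Polynomial ℕ
  | .skip => 1
  | .assign _ e => e.costPoly + 1
  | .store _ i j e => i.costPoly + j.costPoly + e.costPoly + (i.bitsPoly + 1) + (j.bitsPoly + 1) + 1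
  | .seq p q => p.costPoly + q.costPoly
  | .ite e p q => e.costPoly + (p.costPoly + q.costPoly) + 1
  | .loop e p => (Polynomial.X + 1) * (e.costPoly + p.costPoly + 1)

lemma BinOp.abs_eval_lt (op : BinOp) {x y : ℤ} {a b : ℕ} (hx : |x| < 2 ^ a) (hy : |y| < 2 ^ b) :
    |op.eval x y| < 2 ^ (a + b + 1) := by
  have ha : (1 : ℤ) ≤ 2 ^ a := one_le_pow₀ (by norm_num)
  have hb : (1 : ℤ) ≤ 2 ^ b := one_le_pow₀ (by norm_num)
  have h1 : (2 : ℤ) ^ (a + b + 1) = 2 * (2 ^ a * 2 ^ b) := by ring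
  rw [h1]
  cases op with
  | add => simp only [eval]; nlinarith [abs_add_le x y]
  | sub => simp only [eval]; nlinarith [abs_sub x y]
  | mul =>
    simp only [eval]
    rw [abs_mul]
    nlinarith [abs_nonneg x, abs_nonneg y]
  | div =>
    simp only [eval]
    have := Int.abs_ediv_le_abs x y
    nlinarith
  | lt =>
    simp only [eval]
    split_ifs
    all_goals simp
    all_goals nlinarith
  | eq =>
    simp only [eval]
    split_ifs
    all_goals simp
    all_goals nlinarith

lemma Expr.abs_eval_lt {B : ℕ} {m : Mem} (hm : Bounded B m) (e : Expr) :
    |e.eval m| < 2 ^ e.bitsPoly.eval B := by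
  induction e with
  | const c => simpa [eval, bitsPoly] using abs_lt_two_pow_bits c
  | reg x => simpa [eval, bitsPoly] using hm.reg x
  | get a i j => simpa [eval, bitsPoly] using hm.arr a _ _
  | bin op e₁ e₂ h₁ h₂ => simpa [eval, bitsPoly] using op.abs_eval_lt h₁ h₂

lemma Expr.cost_le {B : ℕ} {m : Mem} (hm : Bounded B m) (e : Expr) :
    e.cost m ≤ e.costPoly.eval B := by
  induction e with
  | const c => simp [cost, costPoly]
  | reg x => simpa [cost, costPoly] using bits_le (hm.reg x)
  | get a i j h₁ h₂ =>
    have h₃ := bits_le (i.abs_eval_lt hm)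
    have h₄ := bits_le (j.abs_eval_lt hm)
    have h₅ := bits_le (hm.arr a (i.eval m) (j.eval m))
    simp only [cost, costPoly, Polynomial.eval_add, Polynomial.eval_one, Polynomial.eval_X]
    linarith
  | bin op e₁ e₂ h₁ h₂ =>
    have h₃ := bits_le (e₁.abs_eval_lt hm)
    have h₄ := bits_le (e₂.abs_eval_lt hm)
    simp only [cost, costPoly, Polynomial.eval_add, Polynomial.eval_mul, Polynomial.eval_one]
    gcongr

/-- Whether a program contains an assignment to register `x`. -/
def Prog.writesReg (x : ℕ) : Prog → Bool
  | .skip => false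
  | .assign y _ => y == x
  | .store _ _ _ _ => false
  | .seq p q => p.writesReg x || q.writesReg x
  | .ite _ p q => p.writesReg x || q.writesReg x
  | .loop _ p => p.writesReg x

/-- Whether a program contains an assignment to an entry of array `a`. -/
def Prog.writesArr (a : ℕ) : Prog → Bool
  | .skip => false
  | .assign _ _ => false
  | .store b _ _ _ => b == a
  | .seq p q => p.writesArr a || q.writesArr a
  | .ite _ p q => p.writesArr a || q.writesArr a
  | .loop _ p => p.writesArr a

/-- The memories `m` and `m'` agree wherever `p` does not write. -/
structure Frame (p : Prog) (m m' : Mem) : Prop where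
  reg : ∀ x, p.writesReg x = false → m'.reg x = m.reg x
  arr : ∀ a, p.writesArr a = false → m'.arr a = m.arr a

lemma Frame.refl (p : Prog) (m : Mem) : Frame p m m := ⟨fun _ _ => rfl, fun _ _ => rfl⟩

lemma Frame.trans {p : Prog} {m m' m'' : Mem} (h : Frame p m m') (h' : Frame p m' m'') :
    Frame p m m'' :=
  ⟨fun x hx => (h'.reg x hx).trans (h.reg x hx), fun a ha => (h'.arr a ha).trans (h.arr a ha)⟩

lemma Frame.mono {p q : Prog} {m m' : Mem} (h : Frame p m m')
    (hr : ∀ x, q.writesReg x = false → p.writesReg x = false)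
    (ha : ∀ a, q.writesArr a = false → p.writesArr a = false) : Frame q m m' :=
  ⟨fun x hx => h.reg x (hr x hx), fun a hx => h.arr a (ha a hx)⟩

lemma Exec.frame {p : Prog} {m m' : Mem} {t : ℕ} (h : Exec p m m' t) : Frame p m m' := by
  induction h with
  | skip m => exact Frame.refl _ m
  | assign m x e =>
    refine ⟨fun y hy => if_neg ?_, fun _ _ => rfl⟩
    rintro rfl
    simp [Prog.writesReg] at hy
  | store m a i j e =>
    refine ⟨fun y hy => rfl, fun b hb => ?_⟩
    have hba : b ≠ a := by
      rintro rfl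
      simp [Prog.writesArr] at hb
    simp [Mem.setArr, hba]
  | seq _ _ h₁ h₂ =>
    refine (h₁.mono ?_ ?_).trans (h₂.mono ?_ ?_) <;> intro x hx <;>
      simp_all [Prog.writesReg, Prog.writesArr]
  | ite_true _ _ h₁ =>
    refine h₁.mono ?_ ?_ <;> intro x hx <;> simp_all [Prog.writesReg, Prog.writesArr]
  | ite_false _ _ h₁ =>
    refine h₁.mono ?_ ?_ <;> intro x hx <;> simp_all [Prog.writesReg, Prog.writesArr]
  | loop_done _ => exact Frame.refl _ _
  | loop_step _ _ _ h₁ h₂ =>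
    exact ⟨fun x hx => (h₂.reg x hx).trans (h₁.reg x hx),
      fun a ha => (h₂.arr a ha).trans (h₁.arr a ha)⟩

/-- Total correctness with resource bounds: started in `m`, if this is bounded by `B`, the program
halts within the cost that its polynomial predicts, in a memory that is bounded by `B` and
satisfies `Q`. -/
def Ensures (B : ℕ) (p : Prog) (Q : Mem → Prop) (m : Mem) : Prop :=
  Bounded B m → ∃ m' t, Exec p m m' t ∧ t ≤ p.costPoly.eval B ∧ Bounded B m' ∧ Q m'

section Rules

variable {B : ℕ} {p q : Prog} {e : Expr} {Q R : Mem → Prop} {m : Mem}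

lemma Ensures.mono (h : Ensures B p Q m) (hQ : ∀ m', Frame p m m' → Q m' → R m') :
    Ensures B p R m := fun hm => by
  obtain ⟨m', t, h₁, h₂, h₃, h₄⟩ := h hm
  exact ⟨m', t, h₁, h₂, h₃, hQ m' h₁.frame h₄⟩

lemma ensures_of_bounded (h : Bounded B m → Ensures B p Q m) : Ensures B p Q m := fun hm => h hm hm

lemma ensures_skip (h : Q m) : Ensures B .skip Q m := fun hm =>
  ⟨m, 1, .skip m, by simp [Prog.costPoly], hm, h⟩

lemma ensures_assign {x : ℕ} (hb : |e.eval m| < 2 ^ B) (h : Q (m.setReg x (e.eval m))) :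
    Ensures B (.assign x e) Q m := fun hm => by
  refine ⟨_, _, .assign m x e, ?_, ⟨fun y => ?_, hm.arr⟩, h⟩
  · simpa [Prog.costPoly] using e.cost_le hm
  · simp only [Mem.setReg]
    split_ifs
    exacts [hb, hm.reg y]

lemma ensures_store {a : ℕ} {i j : Expr} (hb : |e.eval m| < 2 ^ B)
    (h : Q (m.setArr a (i.eval m) (j.eval m) (e.eval m))) : Ensures B (.store a i j e) Q m :=
  fun hm => by
  refine ⟨_, _, .store m a i j e, ?_, ⟨hm.reg, fun b k l => ?_⟩, h⟩
  · have h₁ := e.cost_le hm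
    have h₂ := i.cost_le hm
    have h₃ := j.cost_le hm
    have h₄ := bits_le (i.abs_eval_lt hm)
    have h₅ := bits_le (j.abs_eval_lt hm)
    simp only [Prog.costPoly, Polynomial.eval_add, Polynomial.eval_one]
    linarith
  · simp only [Mem.setArr]
    split_ifs
    exacts [hb, hm.arr b k l]

lemma ensures_seq (h : Ensures B p (Ensures B q Q) m) : Ensures B (.seq p q) Q m := fun hm => by
  obtain ⟨m', t, h₁, h₂, h₃, h₄⟩ := h hm
  obtain ⟨m'', t', h₁', h₂', h₃', h₄'⟩ := h₄ h₃
  refine ⟨m'', _, .seq h₁ h₁', ?_, h₃', h₄'⟩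
  simp only [Prog.costPoly, Polynomial.eval_add]
  linarith

lemma ensures_ite (h₁ : e.eval m ≠ 0 → Ensures B p Q m) (h₂ : e.eval m = 0 → Ensures B q Q m) :
    Ensures B (.ite e p q) Q m := fun hm => by
  have hc := e.cost_le hm
  by_cases he : e.eval m = 0
  · obtain ⟨m', t, h₁, h₂, h₃, h₄⟩ := h₂ he hm
    refine ⟨m', _, .ite_false he h₁, ?_, h₃, h₄⟩
    simp only [Prog.costPoly, Polynomial.eval_add, Polynomial.eval_one]
    linarith
  · obtain ⟨m', t, h₁, h₂, h₃, h₄⟩ := h₁ he hm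
    refine ⟨m', _, .ite_true he h₁, ?_, h₃, h₄⟩
    simp only [Prog.costPoly, Polynomial.eval_add, Polynomial.eval_one]
    linarith

/-- A loop with an invariant that counts the repetitions, of which there are at most `B`. -/
lemma ensures_loop {I : ℕ → Mem → Prop} (h0 : I 0 m)
    (hstep : ∀ j m', Frame p m m' → I j m' → e.eval m' ≠ 0 → j < B ∧ Ensures B p (I (j + 1)) m') :
    Ensures B (.loop e p) (fun m' => ∃ j, I j m' ∧ e.eval m' = 0) m := by
  have key : ∀ r j m', Frame p m m' → I j m' → B ≤ j + r → Bounded B m' → ∃ m'' t,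
      Exec (.loop e p) m' m'' t ∧
      t ≤ (r + 1) * (e.costPoly.eval B + p.costPoly.eval B + 1) ∧ Bounded B m'' ∧
      ∃ j, I j m'' ∧ e.eval m'' = 0 := by
    intro r
    induction r with
    | zero =>
      intro j m' hf hI hr hm
      have hc := e.cost_le hm
      have he : e.eval m' = 0 := by
        by_contra he
        have := (hstep j m' hf hI he).1
        omega
      exact ⟨m', _, .loop_done he, by linarith, hm, j, hI, he⟩
    | succ r ih =>
      intro j m' hf hI hr hm
      have hc := e.cost_le hm
      by_cases he : e.eval m' = 0
      · exact ⟨m', _, .loop_done he, by nlinarith, hm, j, hI, he⟩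
      · obtain ⟨m₁, t₁, h₁, h₂, h₃, h₄⟩ := (hstep j m' hf hI he).2 hm
        obtain ⟨m₂, t₂, h₁', h₂', h₃', h₄'⟩ :=
          ih (j + 1) m₁ (hf.trans h₁.frame) h₄ (by omega) h₃
        exact ⟨m₂, _, .loop_step he h₁ h₁', by nlinarith, h₃', h₄'⟩
  intro hm
  obtain ⟨m', t, h₁, h₂, h₃, h₄⟩ := key B 0 m (Frame.refl p m) h0 (by omega) hm
  refine ⟨m', t, h₁, ?_, h₃, h₄⟩
  simpa [Prog.costPoly] using h₂

end Rules

instance (k : ℕ) : OfNat Expr k := ⟨.const (OfNat.ofNat k)⟩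
instance : Add Expr := ⟨.bin .add⟩
instance : Sub Expr := ⟨.bin .sub⟩
instance : Mul Expr := ⟨.bin .mul⟩
instance : Div Expr := ⟨.bin .div⟩

section Eval

variable (m : Mem)

@[simp] lemma eval_zero : (0 : Expr).eval m = 0 := rfl
@[simp] lemma eval_one : (1 : Expr).eval m = 1 := rfl
@[simp] lemma eval_two : (2 : Expr).eval m = 2 := rfl
@[simp] lemma eval_add (e f : Expr) : (e + f).eval m = e.eval m + f.eval m := rfl
@[simp] lemma eval_sub (e f : Expr) : (e - f).eval m = e.eval m - f.eval m := rfl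
@[simp] lemma eval_mul (e f : Expr) : (e * f).eval m = e.eval m * f.eval m := rfl
@[simp] lemma eval_div (e f : Expr) : (e / f).eval m = e.eval m / f.eval m := rfl
@[simp] lemma eval_lt (e f : Expr) :
    (Expr.bin .lt e f).eval m = if e.eval m < f.eval m then 1 else 0 := rfl
@[simp] lemma eval_eq (e f : Expr) :
    (Expr.bin .eq e f).eval m = if e.eval m = f.eval m then 1 else 0 := rfl
@[simp] lemma eval_reg (x : ℕ) : (Expr.reg x).eval m = m.reg x := rfl
@[simp] lemma eval_get (a : ℕ) (i j : Expr) :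
    (Expr.get a i j).eval m = m.arr a (i.eval m) (j.eval m) := rfl
@[simp] lemma setReg_reg (x y : ℕ) (z : ℤ) :
    (m.setReg x z).reg y = if y = x then z else m.reg y := rfl
@[simp] lemma setReg_arr (x : ℕ) (z : ℤ) : (m.setReg x z).arr = m.arr := rfl
@[simp] lemma setArr_reg (a : ℕ) (i j z : ℤ) : (m.setArr a i j z).reg = m.reg := rfl
@[simp] lemma setArr_arr (a : ℕ) (i j z : ℤ) (b : ℕ) (k l : ℤ) :
    (m.setArr a i j z).arr b k l = if b = a ∧ k = i ∧ l = j then z else m.arr b k l := rfl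

end Eval

/-- Run `p` for `x = 0, …, n - 1`, where register `0` holds `n`. -/
def forN (x : ℕ) (p : Prog) : Prog :=
  .seq (.assign x 0) (.loop (.bin .lt (.reg x) (.reg 0)) (.seq p (.assign x (.reg x + 1))))

section Loops

variable {n B : ℕ} {p : Prog} {m : Mem}

/-- The rule for counting loops. The invariant may rely on the frame, so that it need not mention
what the loop leaves unchanged. -/
lemma ensures_forN {x : ℕ} {I : ℕ → Mem → Prop} (hnB : n ≤ B) (hn : m.reg 0 = n) (hx : x ≠ 0)
    (h0 : p.writesReg 0 = false) (hpx : p.writesReg x = false) (hI : I 0 (m.setReg x 0))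
    (hstep : ∀ i < n, ∀ m', Frame (forN x p) m m' → m'.reg 0 = n → m'.reg x = i → I i m' →
      Ensures B p (fun m'' => I (i + 1) (m''.setReg x ((i + 1 : ℕ) : ℤ))) m') :
    Ensures B (forN x p) (I n) m := by
  have hB : (n : ℤ) < 2 ^ B := by
    have : n < 2 ^ B := hnB.trans_lt Nat.lt_two_pow_self
    exact_mod_cast this
  refine ensures_seq (ensures_assign (by simp) ?_)
  refine (ensures_loop (I := fun j m' => j ≤ n ∧ m'.reg 0 = n ∧ m'.reg x = j ∧ I j m') ?_ ?_).mono ?_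
  · refine ⟨Nat.zero_le _, ?_, ?_, hI⟩
    · simp [hx.symm, hn]
    · simp
  · rintro j m' hf ⟨hj, h1, h2, h3⟩ he
    have hjn : j < n := by
      by_contra hjn
      apply he
      simp only [eval_lt, eval_reg, h1, h2]
      rw [if_neg (by omega)]
    refine ⟨by omega, ensures_seq ((hstep j hjn m' ?_ h1 h2 h3).mono ?_)⟩
    · refine Frame.trans (m' := m.setReg x 0) ⟨fun y hy => ?_, fun _ _ => rfl⟩ (hf.mono ?_ ?_)
      · simp only [forN, Prog.writesReg, Bool.or_eq_false_iff, beq_eq_false_iff_ne] at hy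
        simp [hy.1.symm]
      · intro y hy
        simp only [forN, Prog.writesReg, Bool.or_eq_false_iff] at hy ⊢
        exact hy.2
      · intro y hy
        simp only [forN, Prog.writesArr, Bool.or_eq_false_iff] at hy ⊢
        exact hy.2
    · intro m'' hf' hI'
      have e1 : m''.reg x = j := by rw [hf'.reg x hpx, h2]
      have e0 : m''.reg 0 = n := by rw [hf'.reg 0 h0, h1]
      have e2 : (Expr.reg x + 1 : Expr).eval m'' = ((j + 1 : ℕ) : ℤ) := by simp [e1]
      refine ensures_assign ?_ ?_
      · rw [e2, abs_of_nonneg (by positivity)]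
        refine lt_of_le_of_lt ?_ hB
        exact_mod_cast hjn
      · rw [e2]
        exact ⟨hjn, by simp [hx.symm, e0], by simp, hI'⟩
  · rintro m' _ ⟨j, ⟨hj, h1, h2, h3⟩, he⟩
    have : j = n := by
      by_contra hne
      simp only [eval_lt, eval_reg, h1, h2] at he
      rw [if_pos (by omega)] at he
      simp at he
    exact this ▸ h3

end Loops

end RAM

namespace RAM

/-! ### Loops that fill arrays and accumulate sums -/

variable {n B : ℕ} {m : Mem}

lemma Frame.forN {p : Prog} {m m' : Mem} (h : Frame p m m') (x : ℕ) : Frame (forN x p) m m' := by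
  refine h.mono ?_ ?_ <;> intro y hy <;>
    simp only [RAM.forN, Prog.writesReg, Prog.writesArr, Bool.or_eq_false_iff] at hy
  exacts [hy.2.1, hy.2.1]

lemma writesReg_forN {x y : ℕ} {p : Prog} (hxy : x ≠ y) (hp : p.writesReg x = false) :
    (forN y p).writesReg x = false := by
  simp [forN, Prog.writesReg, hp, hxy.symm]

/-- A loop over two indices. -/
lemma ensures_forN_forN {x y : ℕ} {p : Prog} {I : ℕ → ℕ → Mem → Prop} (hnB : n ≤ B)
    (hn : m.reg 0 = n) (hx : x ≠ 0) (hy : y ≠ 0) (hxy : x ≠ y) (hp0 : p.writesReg 0 = false)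
    (hpx : p.writesReg x = false) (hpy : p.writesReg y = false)
    (hIx : ∀ i m' z, I i 0 m' → I i 0 (m'.setReg x z))
    (hIy : ∀ i j m' z, I i j m' → I i j (m'.setReg y z)) (hI : I 0 0 m)
    (hnext : ∀ i m', I i n m' → I (i + 1) 0 m')
    (hstep : ∀ u v : Fin n, ∀ m', Frame (forN x (forN y p)) m m' → m'.reg 0 = n → m'.reg x = u →
      m'.reg y = v → I u v m' → Ensures B p (I u (v + 1)) m') :
    Ensures B (forN x (forN y p)) (I n 0) m := by
  refine ensures_forN hnB hn hx (writesReg_forN hy.symm hp0) (writesReg_forN hxy hpx)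
    (I := fun i m' => I i 0 m') (hIx _ _ _ hI) fun i hi m' hf h0 hxi h => ?_
  refine (ensures_forN (I := fun j m'' => I i j m'') hnB h0 hy hp0 hpy (hIy _ _ _ _ h)
    fun j hj m'' hf' h0' hyj h' => ?_).mono ?_
  · refine (hstep ⟨i, hi⟩ ⟨j, hj⟩ m'' (hf.trans (hf'.forN x)) h0' ?_ hyj h').mono ?_
    · rw [hf'.reg x (writesReg_forN hxy hpx), hxi]
    · intro m₃ _ h₃
      exact hIy _ _ _ _ h₃
  · intro m'' _ h''
    exact hIx _ _ _ (hnext _ _ h'')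

/-- Store `e` in the entries `(x, 0)` of array `a`. -/
def fill1 (x a : ℕ) (e : Expr) : Prog := forN x (.store a (.reg x) 0 e)

/-- Store `e` in the entries `(x, y)` of array `a`. -/
def fill2 (x y a : ℕ) (e : Expr) : Prog := forN x (forN y (.store a (.reg x) (.reg y) e))

/-- Add the values of `e` for all `x` to register `r`. -/
def sum1 (x r : ℕ) (e : Expr) : Prog := forN x (.assign r (.reg r + e))

/-- Add the values of `e` for all `x` and `y` to register `r`. -/
def sum2 (x y r : ℕ) (e : Expr) : Prog := forN x (forN y (.assign r (.reg r + e)))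

/-- A loop whose body writes `f x` to the entry `(x, 0)` of array `a`. The body may use the old
value of this entry. -/
lemma ensures_forN_fill {x a : ℕ} {p : Prog} {f : Fin n → ℤ} (hnB : n ≤ B) (hn : m.reg 0 = n)
    (hx : x ≠ 0) (hp0 : p.writesReg 0 = false) (hpx : p.writesReg x = false)
    (hbody : ∀ (u : Fin n) (m' : Mem), Frame (forN x p) m m' → m'.reg 0 = n → m'.reg x = u →
      m'.arr a u 0 = m.arr a u 0 →
      Ensures B p (fun m'' => m''.arr a = fun (k l : ℤ) => if k = u ∧ l = 0 then f u else m'.arr a k l) m') :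
    Ensures B (forN x p) (fun m' => ∀ u : Fin n, m'.arr a u 0 = f u) m := by
  refine (ensures_forN (I := fun i m' => ∀ u : Fin n,
    m'.arr a u 0 = if (u : ℕ) < i then f u else m.arr a u 0) hnB hn hx hp0 hpx ?_ ?_).mono ?_
  · intro u
    simp
  · intro i hi m' hf h0 hxi hI
    refine (hbody ⟨i, hi⟩ m' hf h0 hxi (by simpa using hI ⟨i, hi⟩)).mono fun m'' _ h u => ?_
    rw [setReg_arr, h]
    dsimp only
    rw [hI u]
    rcases lt_trichotomy (u : ℕ) i with hu | hu | hu
    · rw [if_neg (by push_cast; omega), if_pos hu, if_pos (by omega)]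
    · have : u = ⟨i, hi⟩ := Fin.ext hu
      subst this
      simp
    · rw [if_neg (by push_cast; omega), if_neg (by omega), if_neg (by omega)]
  · intro m' _ h u
    rw [h u, if_pos u.2]

lemma ensures_fill1 {x a : ℕ} {e : Expr} {f : Fin n → ℤ} (hnB : n ≤ B) (hn : m.reg 0 = n)
    (hx : x ≠ 0) (hf : ∀ u, |f u| < 2 ^ B)
    (he : ∀ (u : Fin n) (m' : Mem), Frame (fill1 x a e) m m' → m'.reg x = u →
      m'.arr a u 0 = m.arr a u 0 → e.eval m' = f u) :
    Ensures B (fill1 x a e) (fun m' => ∀ u : Fin n, m'.arr a u 0 = f u) m := by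
  refine ensures_forN_fill hnB hn hx rfl rfl fun u m' hfr _ hxu ha => ?_
  have h := he u m' hfr hxu ha
  refine ensures_store (by rw [h]; exact hf u) ?_
  funext k l
  simp [hxu, h]

/-- A loop whose body writes `f x y` to the entry `(x, y)` of array `a`. The body may use the old
value of this entry. -/
lemma ensures_forN_forN_fill {x y a : ℕ} {p : Prog} {f : Fin n → Fin n → ℤ} (hnB : n ≤ B)
    (hn : m.reg 0 = n) (hx : x ≠ 0) (hy : y ≠ 0) (hxy : x ≠ y) (hp0 : p.writesReg 0 = false)
    (hpx : p.writesReg x = false) (hpy : p.writesReg y = false)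
    (hbody : ∀ (u v : Fin n) (m' : Mem), Frame (forN x (forN y p)) m m' → m'.reg 0 = n →
      m'.reg x = u → m'.reg y = v → m'.arr a u v = m.arr a u v →
      Ensures B p (fun m'' => m''.arr a = fun (k l : ℤ) => if k = u ∧ l = v then f u v else m'.arr a k l)
        m') :
    Ensures B (forN x (forN y p)) (fun m' => ∀ u v : Fin n, m'.arr a u v = f u v) m := by
  refine (ensures_forN_forN (I := fun i j m' => ∀ u v : Fin n, m'.arr a u v =
    if (u : ℕ) < i ∨ (u : ℕ) = i ∧ (v : ℕ) < j then f u v else m.arr a u v) hnB hn hx hy hxy hp0 hpx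
    hpy (fun i m' z h => h) (fun i j m' z h => h) ?_ ?_ ?_).mono ?_
  · intro u v
    simp
  · intro i m' h u v
    rw [h u v]
    have := v.2
    congr 1
    simp only [eq_iff_iff]
    omega
  · intro i j m' hf h0 hxi hyj hI
    refine (hbody i j m' hf h0 hxi hyj (by simpa using hI i j)).mono fun m'' _ h u v => ?_
    rw [h]
    dsimp only
    by_cases huv : u = i ∧ v = j
    · rw [if_pos (by simp [huv]), if_pos (by simp [huv]), huv.1, huv.2]
    · have h1 : ¬ ((u : ℕ) = i ∧ (v : ℕ) = j) := fun h => huv ⟨Fin.ext h.1, Fin.ext h.2⟩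
      rw [if_neg (by exact_mod_cast h1), hI u v]
      congr 1
      simp only [eq_iff_iff]
      omega
  · intro m' _ h u v
    rw [h u v, if_pos (Or.inl u.2)]

lemma ensures_fill2 {x y a : ℕ} {e : Expr} {f : Fin n → Fin n → ℤ} (hnB : n ≤ B)
    (hn : m.reg 0 = n) (hx : x ≠ 0) (hy : y ≠ 0) (hxy : x ≠ y) (hf : ∀ u v, |f u v| < 2 ^ B)
    (he : ∀ (u v : Fin n) (m' : Mem), Frame (fill2 x y a e) m m' → m'.reg x = u → m'.reg y = v →
      m'.arr a u v = m.arr a u v → e.eval m' = f u v) :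
    Ensures B (fill2 x y a e) (fun m' => ∀ u v : Fin n, m'.arr a u v = f u v) m := by
  refine ensures_forN_forN_fill hnB hn hx hy hxy rfl rfl rfl fun u v m' hfr _ hxu hyv ha => ?_
  have h := he u v m' hfr hxu hyv ha
  refine ensures_store (by rw [h]; exact hf u v) ?_
  funext k l
  simp [hxu, hyv, h]

lemma ensures_sum1 {x r : ℕ} {e : Expr} {f : Fin n → ℤ} (hnB : n ≤ B) (hn : m.reg 0 = n)
    (hx : x ≠ 0) (hr : r ≠ 0) (hrx : r ≠ x) {M : ℤ} (hf : ∀ u, |f u| ≤ M)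
    (hM : |m.reg r| + n * M < 2 ^ B)
    (he : ∀ (u : Fin n) (m' : Mem), Frame (sum1 x r e) m m' → m'.reg x = u → e.eval m' = f u) :
    Ensures B (sum1 x r e) (fun m' => m'.reg r = m.reg r + ∑ u, f u) m := by
  set g : ℕ → ℤ := fun i => if h : i < n then f ⟨i, h⟩ else 0 with hg
  have hgf : ∀ u : Fin n, g u = f u := fun u => by simp [hg]
  have hsum : ∑ i ∈ range n, g i = ∑ u, f u := by
    rw [sum_range]
    exact sum_congr rfl fun u _ => hgf u
  refine (ensures_forN (I := fun i m' => m'.reg r = m.reg r + ∑ j ∈ range i, g j) hnB hn hx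
    (by simpa [Prog.writesReg] using hr) (by simpa [Prog.writesReg] using hrx) ?_ ?_).mono ?_
  · simp [hrx]
  · intro i hi m' hfr h0 hxi hI
    have h1 : (Expr.reg r + e).eval m' = m.reg r + ∑ j ∈ range (i + 1), g j := by
      rw [eval_add, eval_reg, hI, he ⟨i, hi⟩ m' hfr hxi, sum_range_succ, ← add_assoc,
        ← hgf ⟨i, hi⟩]
    refine ensures_assign ?_ ?_
    · rw [h1]
      have h2 : |∑ j ∈ range (i + 1), g j| ≤ n * M := by
        have hM0 : 0 ≤ M := (abs_nonneg _).trans (hf ⟨i, hi⟩)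
        refine (abs_sum_le_sum_abs _ _).trans ((sum_le_card_nsmul _ _ M fun l hl => ?_).trans ?_)
        · have hl' : l < n := (mem_range.1 hl).trans_le hi
          simpa [hg, hl'] using hf ⟨l, hl'⟩
        · rw [card_range, nsmul_eq_mul]
          have : ((i + 1 : ℕ) : ℤ) ≤ n := by exact_mod_cast hi
          gcongr
      have := abs_add_le (m.reg r) (∑ j ∈ range (i + 1), g j)
      linarith
    · simp [h1, hrx]
  · intro m' _ h
    rw [h, hsum]

/-- A loop over two indices that updates a register. -/
lemma ensures_forN_forN_assign {x y r : ℕ} {e : Expr} {F : ℕ → ℕ → ℤ} (hnB : n ≤ B)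
    (hn : m.reg 0 = n) (hx : x ≠ 0) (hy : y ≠ 0) (hxy : x ≠ y) (hr : r ≠ 0) (hrx : r ≠ x)
    (hry : r ≠ y) (hF : ∀ i < n, ∀ j ≤ n, |F i j| < 2 ^ B) (hnext : ∀ i, F (i + 1) 0 = F i n)
    (h0 : m.reg r = F 0 0)
    (he : ∀ (u v : Fin n) (m' : Mem), Frame (forN x (forN y (.assign r e))) m m' → m'.reg x = u →
      m'.reg y = v → m'.reg r = F u v → e.eval m' = F u (v + 1)) :
    Ensures B (forN x (forN y (.assign r e))) (fun m' => m'.reg r = F n 0) m := by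
  refine ensures_forN_forN (I := fun i j m' => m'.reg r = F i j) hnB hn hx hy hxy
    (by simpa [Prog.writesReg] using hr) (by simpa [Prog.writesReg] using hrx)
    (by simpa [Prog.writesReg] using hry) ?_ ?_ h0 ?_ ?_
  · intro i m' z h
    simpa [hrx] using h
  · intro i j m' z h
    simpa [hry] using h
  · intro i m' h
    rw [hnext, h]
  · intro u v m' hf _ hxu hyv h
    have h1 := he u v m' hf hxu hyv h
    refine ensures_assign ?_ ?_
    · rw [h1]
      exact hF _ u.2 _ v.2
    · simp [h1]

lemma ensures_sum2 {x y r : ℕ} {e : Expr} {f : Fin n → Fin n → ℤ} (hnB : n ≤ B)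
    (hn : m.reg 0 = n) (hx : x ≠ 0) (hy : y ≠ 0) (hxy : x ≠ y) (hr : r ≠ 0) (hrx : r ≠ x)
    (hry : r ≠ y) {M : ℤ} (hf : ∀ u v, |f u v| ≤ M) (hM : |m.reg r| + n * (n * M) < 2 ^ B)
    (he : ∀ (u v : Fin n) (m' : Mem), Frame (sum2 x y r e) m m' → m'.reg x = u → m'.reg y = v →
      e.eval m' = f u v) :
    Ensures B (sum2 x y r e) (fun m' => m'.reg r = m.reg r + ∑ u, ∑ v, f u v) m := by
  set g : ℕ → ℕ → ℤ := fun i j => if h : i < n ∧ j < n then f ⟨i, h.1⟩ ⟨j, h.2⟩ else 0 with hg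
  have hgf : ∀ u v : Fin n, g u v = f u v := fun u v => by simp [hg]
  have hsum : ∑ i ∈ range n, ∑ j ∈ range n, g i j = ∑ u, ∑ v, f u v := by
    rw [sum_range]
    refine sum_congr rfl fun u _ => ?_
    rw [sum_range]
    exact sum_congr rfl fun v _ => hgf u v
  have habs : ∀ i < n, ∀ j < n, |g i j| ≤ M := fun i hi j hj => by
    simp only [hg, hi, hj, and_self, dif_pos]
    exact hf _ _
  have hrow : ∀ i < n, ∀ j ≤ n, |∑ l ∈ range j, g i l| ≤ j * M := fun i hi j hj => by
    refine (abs_sum_le_sum_abs _ _).trans ((sum_le_card_nsmul _ _ M fun l hl => ?_).trans_eq ?_)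
    · exact habs i hi l ((mem_range.1 hl).trans_le hj)
    · simp
  refine (ensures_forN_forN_assign (F := fun i j => m.reg r + ∑ k ∈ range i, ∑ l ∈ range n, g k l
    + ∑ l ∈ range j, g i l) hnB hn hx hy hxy hr hrx hry ?_ ?_ ?_ ?_).mono ?_
  · intro i hi j hj
    have hM0 : 0 ≤ M := (abs_nonneg _).trans (habs i hi i hi)
    have h1 : |∑ k ∈ range i, ∑ l ∈ range n, g k l| ≤ i * (n * M) := by
      refine (abs_sum_le_sum_abs _ _).trans
        ((sum_le_card_nsmul _ _ (n * M) fun k hk => ?_).trans_eq ?_)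
      · exact hrow k ((mem_range.1 hk).trans hi) n le_rfl
      · simp
    have h2 : (i : ℤ) * (n * M) + n * M ≤ n * (n * M) := by
      have : (i : ℤ) + 1 ≤ n := by exact_mod_cast hi
      have : 0 ≤ n * M := by positivity
      nlinarith
    have h3 : (j : ℤ) * M ≤ n * M := by
      have : (j : ℤ) ≤ n := by exact_mod_cast hj
      gcongr
    have h4 := hrow i hi j hj
    have h5 := abs_add_le (m.reg r + ∑ k ∈ range i, ∑ l ∈ range n, g k l) (∑ l ∈ range j, g i l)
    have h6 := abs_add_le (m.reg r) (∑ k ∈ range i, ∑ l ∈ range n, g k l)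
    linarith
  · intro i
    simp [sum_range_succ, add_assoc]
  · simp
  · intro u v m' hfr hxu hyv h
    have h1 := he u v m' hfr hxu hyv
    rw [eval_add, eval_reg, h, h1, sum_range_succ, hgf]
    ring
  · intro m' _ h
    rw [h, hsum]
    simp

end RAM

namespace RAM

open CutForm

/-! ### The search for the best candidate: programs and matrices

Registers: `0` holds `n`, `1` the common denominator, `2` the precision `Z`, `3` and `4` its
powers `Z ^ 32` and `Z ^ 128`, `6` the exponent of the current power of the walk matrix, `12` and
`13` sums (the cost and the mass of the current candidate), `14` and `15` the cost and the mass of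
the best candidate, `16` the current level; `5` and `7` to `11` are loop variables. Arrays: `3`
holds the weights, `4` the remaining weights, `5` the current matrix, `6` its square, `7` the
current candidate, `8` the best candidate, `9` the degrees. -/

/-- What the main loop of the algorithm needs to know about `Z` and the bound `B`. -/
structure Fits (B n : ℕ) (Z : ℤ) (W : Fin n → Fin n → ℤ) : Prop where
  card_le : n ≤ B
  two_le : 2 ≤ Z
  two_pow_le : (2 : ℤ) ^ n ≤ Z
  total_le : total W ≤ Z
  pow_le : Z ^ 400 ≤ 2 ^ B
  nonneg : ∀ u v, 0 ≤ W u v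
  symm : ∀ u v, W u v = W v u

section Bounds

variable {B n : ℕ} {Z : ℤ} {W ω : Fin n → Fin n → ℤ}

lemma Fits.pos (h : Fits B n Z W) : 0 < Z := by linarith [h.two_le]

lemma Fits.pow_lt (h : Fits B n Z W) {a : ℕ} (ha : a < 400) : Z ^ a < 2 ^ B :=
  (pow_lt_pow_right₀ (by linarith [h.two_le]) ha).trans_le h.pow_le

lemma Fits.natCast_le (h : Fits B n Z W) : (n : ℤ) ≤ Z := by
  refine le_trans ?_ h.two_pow_le
  exact_mod_cast Nat.lt_two_pow_self.le

lemma Fits.rowSum_le (h : Fits B n Z W) (hω : RemainingWeights W ω) (u : Fin n) :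
    rowSum ω u ≤ Z := by
  refine le_trans ?_ (hω.total_le.trans h.total_le)
  exact single_le_sum (f := fun u => ∑ v, ω u v)
    (fun u _ => sum_nonneg fun v _ => hω.nonneg u v) (mem_univ u)

lemma Fits.le (h : Fits B n Z W) (hω : RemainingWeights W ω) (u v : Fin n) : ω u v ≤ Z :=
  (single_le_sum (f := fun v => ω u v) (fun v _ => hω.nonneg u v) (mem_univ v)).trans
    (h.rowSum_le hω u)

lemma Fits.remainingWeights (h : Fits B n Z W) : RemainingWeights W W :=
  ⟨h.nonneg, h.symm, fun _ _ => le_rfl⟩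

lemma Fits.abs_walkApprox_le (h : Fits B n Z W) (hω : RemainingWeights W ω) {j : ℕ}
    (hj : (2 : ℤ) ^ j < 2 * Z ^ 32) (u v : Fin n) :
    |walkApprox (Z ^ 128) ω j u v| ≤ 2 * Z ^ 128 := by
  have hZ := h.two_le
  refine CutForm.abs_walkApprox_le (pow_pos h.pos _) hω.nonneg ?_ u v
  have h1 : (4 : ℤ) ^ j * n ≤ Z ^ 128 := by
    have h2 : (4 : ℤ) ^ j = 2 ^ j * 2 ^ j := by rw [← mul_pow]; norm_num
    calc (4 : ℤ) ^ j * n ≤ (Z * Z ^ 32) * (Z * Z ^ 32) * Z := by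
          rw [h2]
          have h3 : (2 : ℤ) ^ j ≤ Z * Z ^ 32 := hj.le.trans (by gcongr)
          have := h.natCast_le
          have := h.pos
          gcongr
      _ = Z ^ 67 := by ring
      _ ≤ Z ^ 128 := pow_le_pow_right₀ (by linarith) (by norm_num)
  rw [Fintype.card_fin]
  exact_mod_cast h1

end Bounds

/-- The registers and arrays that hold the parameters of the main loop: `n`, the powers of `Z`, and
the weights. -/
structure Params (n : ℕ) (Z : ℤ) (W : Fin n → Fin n → ℤ) (m : Mem) : Prop where
  card : m.reg 0 = n
  steps : m.reg 3 = Z ^ 32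
  scale : m.reg 4 = Z ^ 128
  weight : ∀ u v : Fin n, m.arr 3 u v = W u v

lemma Params.frame {n : ℕ} {Z : ℤ} {W : Fin n → Fin n → ℤ} {m m' : Mem} {p : Prog}
    (h : Params n Z W m) (hf : Frame p m m') (h0 : p.writesReg 0 = false)
    (h3 : p.writesReg 3 = false) (h4 : p.writesReg 4 = false) (ha : p.writesArr 3 = false) :
    Params n Z W m' where
  card := by rw [hf.reg 0 h0, h.card]
  steps := by rw [hf.reg 3 h3, h.steps]
  scale := by rw [hf.reg 4 h4, h.scale]
  weight := by rw [hf.arr 3 ha]; exact h.weight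

section Programs

open RAM.Expr

/-- Array `9` receives the degrees, and array `5` the start matrix. -/
def startProg : Prog :=
  .seq
    (forN 9 (.seq (.assign 12 0) (.seq (sum1 10 12 (get 4 (reg 9) (reg 10)))
      (.store 9 (reg 9) 0 (reg 12)))))
    (fill2 9 10 5 ((bin .eq (reg 9) (reg 10) * (reg 4 * get 9 (reg 9) 0)
      - reg 4 * get 4 (reg 9) (reg 10)) / (2 * get 9 (reg 9) 0)))

/-- Replace the matrix in array `5` by its square. -/
def squareProg : Prog :=
  .seq
    (forN 9 (forN 10 (.seq (.assign 12 0)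
      (.seq (sum1 11 12 (get 5 (reg 9) (reg 11) * get 5 (reg 11) (reg 10)))
        (.store 6 (reg 9) (reg 10) (reg 12 / reg 4))))))
    (fill2 9 10 5 (get 6 (reg 9) (reg 10)))

/-- Compute the candidate for the column in register `7` and the level in register `8`, with its
cost in register `12` and its mass in register `13`. For integers `s ≥ 0` and `g` the level
`[s ≤ g] - [g ≤ -s]` equals `[-s < g] - [g < s]`. -/
def candidateProg : Prog :=
  .seq (.assign 16 (get 5 (reg 8) (reg 7)))
  (.seq (.ite (bin .lt (reg 16) 0) (.assign 16 (0 - reg 16)) .skip)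
  (.seq (fill1 9 7 (bin .lt (0 - reg 16) (get 5 (reg 9) (reg 7))
    - bin .lt (get 5 (reg 9) (reg 7)) (reg 16)))
  (.seq (.assign 12 0)
  (.seq (sum2 9 10 12 (get 4 (reg 9) (reg 10) * ((get 7 (reg 9) 0 + get 7 (reg 10) 0)
      * (get 7 (reg 9) 0 + get 7 (reg 10) 0))
    - (get 3 (reg 9) (reg 10) - get 4 (reg 9) (reg 10)) * (get 7 (reg 9) 0 * get 7 (reg 9) 0)))
  (.seq (.assign 13 0)
  (sum2 9 10 13 (get 4 (reg 9) (reg 10) * (get 7 (reg 9) 0 * get 7 (reg 9) 0))))))))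

/-- Compute a candidate, and keep it in array `8` if it is better than the best one so far, whose
cost and mass are in registers `14` and `15`. -/
def updateProg : Prog :=
  .seq candidateProg
  (.ite (bin .lt 0 (reg 13) *
      (bin .eq (reg 15) 0 + bin .lt (reg 12 * reg 15) (reg 14 * reg 13)))
    (.seq (fill1 9 8 (get 7 (reg 9) 0)) (.seq (.assign 14 (reg 12)) (.assign 15 (reg 13))))
    .skip)

/-- Find the best candidate. -/
def searchProg : Prog :=
  .seq (fill1 9 8 0)
  (.seq (.assign 14 0)
  (.seq (.assign 15 0)
  (.seq startProg
  (.seq (.assign 6 1)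
  (.loop (bin .lt (reg 6) (reg 3))
    (.seq (forN 7 (forN 8 updateProg)) (.seq squareProg (.assign 6 (reg 6 + reg 6)))))))))

end Programs

section Search

variable {B n : ℕ} {Z : ℤ} {W ω : Fin n → Fin n → ℤ} {m : Mem}

lemma ensures_startProg (hB : Fits B n Z W) (hω : RemainingWeights W ω) (hm : Params n Z W m)
    (h4 : ∀ u v : Fin n, m.arr 4 u v = ω u v) :
    Ensures B startProg
      (fun m' => ∀ u v : Fin n, m'.arr 5 u v = walkApprox (Z ^ 128) ω 0 u v) m := by
  have hZ := hB.two_le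
  have hr0 : ∀ u, 0 ≤ rowSum ω u := fun u => sum_nonneg fun v _ => hω.nonneg u v
  have hZB : Z < 2 ^ B := by simpa using hB.pow_lt (a := 1) (by norm_num)
  refine ensures_seq ((ensures_forN_fill (a := 9) (f := rowSum ω) hB.card_le hm.card (by norm_num) rfl rfl
    fun u m' hf h0 hu _ => ?_).mono fun m' hf h9 => ?_)
  · refine ensures_seq (ensures_assign (by simp) (ensures_seq ((ensures_sum1 (f := fun v => ω u v)
      hB.card_le (by simpa using h0) (by norm_num) (by norm_num) (by norm_num) (M := Z)
      (fun v => ?_) ?_ fun v m'' hf' hv => ?_).mono fun m'' hf' h => ?_)))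
    · rw [abs_of_nonneg (hω.nonneg u v)]
      exact hB.le hω u v
    · have h2 := hB.pow_lt (a := 2) (by norm_num)
      have := hB.natCast_le
      simp only [setReg_reg, if_true, eval_zero, abs_zero]
      nlinarith
    · have e1 : m''.reg 9 = u := (hf'.reg 9 rfl).trans (by simpa using hu)
      have e2 : m''.arr 4 = m.arr 4 := (hf'.arr 4 rfl).trans (hf.arr 4 rfl)
      simp [e1, e2, hv, h4]
    · have h' : m''.reg 12 = rowSum ω u := by simpa [rowSum] using h
      have e1 : m''.reg 9 = u := (hf'.reg 9 rfl).trans (by simpa using hu)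
      have e2 : m''.arr 9 = m'.arr 9 := hf'.arr 9 rfl
      refine ensures_store ?_ ?_
      · rw [eval_reg, h', abs_of_nonneg (hr0 u)]
        exact (hB.rowSum_le hω u).trans_lt hZB
      · funext k l
        simp [e1, e2, h']
  · have hm' := hm.frame hf rfl rfl rfl rfl
    refine ensures_fill2 hB.card_le hm'.card (by norm_num) (by norm_num) (by norm_num) ?_ ?_
    · intro u v
      refine (hB.abs_walkApprox_le hω (by nlinarith [pow_pos hB.pos 32]) u v).trans_lt ?_
      refine lt_of_le_of_lt ?_ (hB.pow_lt (a := 129) (by norm_num))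
      rw [pow_succ' Z 128]
      gcongr
    · intro u v m'' hf' hu hv _
      have e4 : m''.arr 4 = m.arr 4 := (hf'.arr 4 rfl).trans (hf.arr 4 rfl)
      have e9 : m''.arr 9 = m'.arr 9 := hf'.arr 9 rfl
      have er : m''.reg 4 = Z ^ 128 := (hf'.reg 4 rfl).trans hm'.scale
      simp only [eval_div, eval_sub, eval_mul, eval_eq, eval_reg, eval_get, eval_two, eval_zero, hu,
        hv, e4, e9, h9, h4, er]
      simp only [walkApprox, Function.iterate_zero, id, startMatrix]
      congr 2
      by_cases huv : u = v
      · simp [huv]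
      · have : ((u : ℕ) : ℤ) ≠ (v : ℕ) := fun h => huv (Fin.ext (by exact_mod_cast h))
        rw [if_neg huv, if_neg this, zero_mul]

lemma ensures_squareProg (hB : Fits B n Z W) (hω : RemainingWeights W ω) (hm : Params n Z W m)
    {j : ℕ} (hj : (2 : ℤ) ^ j < Z ^ 32)
    (h5 : ∀ u v : Fin n, m.arr 5 u v = walkApprox (Z ^ 128) ω j u v) :
    Ensures B squareProg
      (fun m' => ∀ u v : Fin n, m'.arr 5 u v = walkApprox (Z ^ 128) ω (j + 1) u v) m := by
  have hZ := hB.two_le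
  have hx := hB.abs_walkApprox_le hω (j := j) (by linarith [pow_pos hB.pos 32])
  have hx' : ∀ u v : Fin n, |walkApprox (Z ^ 128) ω (j + 1) u v| < 2 ^ B := fun u v => by
    refine (hB.abs_walkApprox_le hω (by rw [pow_succ]; linarith) u v).trans_lt ?_
    refine lt_of_le_of_lt ?_ (hB.pow_lt (a := 129) (by norm_num))
    rw [pow_succ' Z 128]
    gcongr
  refine ensures_seq ((ensures_forN_forN_fill (a := 6) (f := walkApprox (Z ^ 128) ω (j + 1))
    hB.card_le hm.card (by norm_num) (by norm_num) (by norm_num) rfl rfl rfl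
    fun u v m' hf h0 hu hv _ => ?_).mono fun m' hf h6 => ?_)
  · refine ensures_seq (ensures_assign (by simp) (ensures_seq ((ensures_sum1
      (f := fun l => walkApprox (Z ^ 128) ω j u l * walkApprox (Z ^ 128) ω j l v)
      hB.card_le (by simpa using h0) (by norm_num) (by norm_num) (by norm_num)
      (M := (2 * Z ^ 128) * (2 * Z ^ 128))
      (fun l => ?_) ?_ fun l m'' hf' hl => ?_).mono fun m'' hf' h => ?_)))
    · rw [abs_mul]
      exact mul_le_mul (hx u l) (hx l v) (abs_nonneg _) (by positivity)
    · simp only [setReg_reg, if_true, eval_zero, abs_zero, zero_add]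
      refine lt_of_le_of_lt ?_ (hB.pow_lt (a := 259) (by norm_num))
      calc (n : ℤ) * ((2 * Z ^ 128) * (2 * Z ^ 128)) ≤ Z * ((Z * Z ^ 128) * (Z * Z ^ 128)) := by
            have := hB.natCast_le
            have := hB.pos
            gcongr
        _ = Z ^ 259 := by ring
    · have e1 : m''.reg 9 = u := (hf'.reg 9 rfl).trans (by simpa using hu)
      have e2 : m''.reg 10 = v := (hf'.reg 10 rfl).trans (by simpa using hv)
      have e5 : m''.arr 5 = m.arr 5 := (hf'.arr 5 rfl).trans (hf.arr 5 rfl)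
      simp [e1, e2, hl, e5, h5]
    · have e1 : m''.reg 9 = u := (hf'.reg 9 rfl).trans (by simpa using hu)
      have e2 : m''.reg 10 = v := (hf'.reg 10 rfl).trans (by simpa using hv)
      have e4 : m''.reg 4 = Z ^ 128 :=
        (hf'.reg 4 rfl).trans ((hf.reg 4 rfl).trans hm.scale)
      have e6 : m''.arr 6 = m'.arr 6 := hf'.arr 6 rfl
      have h' : m''.reg 12 / m''.reg 4 = walkApprox (Z ^ 128) ω (j + 1) u v := by
        rw [h, e4, walkApprox_succ]
        simp [squareMatrix]
      refine ensures_store ?_ ?_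
      · rw [eval_div, eval_reg, eval_reg, h']
        exact hx' u v
      · funext k l
        simp [e1, e2, e6, h']
  · refine ensures_fill2 hB.card_le (hm.frame hf rfl rfl rfl rfl).card (by norm_num) (by norm_num)
      (by norm_num) hx' fun u v m'' hf' hu hv _ => ?_
    have e6 : m''.arr 6 = m'.arr 6 := hf'.arr 6 rfl
    simp [hu, hv, e6, h6]

end Search

end RAM

namespace RAM

open CutForm

/-! ### The search for the best candidate: correctness -/

section Best

variable {n : ℕ} {Z : ℤ} {W ω : Fin n → Fin n → ℤ}

/-- `σ`, with cost `a` and mass `b`, is the best among the candidates that have been `tried`. -/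
structure BestAmong (Z : ℤ) (W ω : Fin n → Fin n → ℤ) (tried : ℕ → Fin n → Fin n → Prop)
    (σ : Fin n → ℤ) (a b : ℤ) : Prop where
  eq_zero_or : σ = 0 ∧ a = 0 ∧ b = 0 ∨
    (∃ j v s, σ = candidate Z ω j v s) ∧ a = cutCost W ω σ ∧ b = cutMass ω σ ∧ 0 < b
  le_of_tried : ∀ j v s, tried j v s → 0 < cutMass ω (candidate Z ω j v s) →
    0 < b ∧ a * cutMass ω (candidate Z ω j v s) ≤ cutCost W ω (candidate Z ω j v s) * b

variable {tried tried' : ℕ → Fin n → Fin n → Prop} {σ : Fin n → ℤ} {a b : ℤ}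

lemma BestAmong.mono (h : BestAmong Z W ω tried σ a b)
    (ht : ∀ j v s, tried' j v s → tried j v s) : BestAmong Z W ω tried' σ a b :=
  ⟨h.eq_zero_or, fun j v s hjvs => h.le_of_tried j v s (ht j v s hjvs)⟩

lemma bestAmong_zero (h : ∀ j v s, ¬ tried j v s) : BestAmong Z W ω tried 0 0 0 :=
  ⟨Or.inl ⟨rfl, rfl, rfl⟩, fun j v s hjvs => absurd hjvs (h j v s)⟩

lemma BestAmong.bestCandidate (h : BestAmong Z W ω (fun j _ _ => (2 : ℤ) ^ j < Z ^ 32) σ a b) :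
    BestCandidate Z W ω σ where
  eq_zero_or := h.eq_zero_or.imp (fun h => h.1) fun h => h.1
  le_of_pos j v s hj hpos := by
    obtain ⟨hb, hle⟩ := h.le_of_tried j v s hj hpos
    rcases h.eq_zero_or with ⟨_, _, h0⟩ | ⟨_, rfl, rfl, _⟩
    · omega
    · exact ⟨hb, hle⟩

/-- A better candidate replaces the best one so far. -/
lemma BestAmong.replace (h : BestAmong Z W ω tried σ a b) {j : ℕ} {v s : Fin n}
    (ht : ∀ j' v' s', tried' j' v' s' → tried j' v' s' ∨ j' = j ∧ v' = v ∧ s' = s)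
    (hpos : 0 < cutMass ω (candidate Z ω j v s))
    (hlt : b = 0 ∨
      cutCost W ω (candidate Z ω j v s) * b < a * cutMass ω (candidate Z ω j v s)) :
    BestAmong Z W ω tried' (candidate Z ω j v s) (cutCost W ω (candidate Z ω j v s))
      (cutMass ω (candidate Z ω j v s)) := by
  refine ⟨Or.inr ⟨⟨j, v, s, rfl⟩, rfl, rfl, hpos⟩, fun j' v' s' hjvs hpos' => ⟨hpos, ?_⟩⟩
  rcases ht _ _ _ hjvs with h' | ⟨rfl, rfl, rfl⟩
  · obtain ⟨hb, hle⟩ := h.le_of_tried _ _ _ h' hpos'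
    have hlt' := hlt.resolve_left hb.ne'
    refine le_of_mul_le_mul_right ?_ hb
    set A := cutCost W ω (candidate Z ω j v s)
    set M := cutMass ω (candidate Z ω j v s)
    set A' := cutCost W ω (candidate Z ω j' v' s')
    set M' := cutMass ω (candidate Z ω j' v' s')
    calc A * M' * b = A * b * M' := by ring
      _ ≤ a * M * M' := by gcongr
      _ = a * M' * M := by ring
      _ ≤ A' * b * M := by gcongr
      _ = A' * M * b := by ring
  · exact le_rfl

lemma BestAmong.keep (h : BestAmong Z W ω tried σ a b) {j : ℕ} {v s : Fin n}
    (ht : ∀ j' v' s', tried' j' v' s' → tried j' v' s' ∨ j' = j ∧ v' = v ∧ s' = s)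
    (hle : 0 < cutMass ω (candidate Z ω j v s) → b ≠ 0 ∧
      a * cutMass ω (candidate Z ω j v s) ≤ cutCost W ω (candidate Z ω j v s) * b) :
    BestAmong Z W ω tried' σ a b := by
  refine ⟨h.eq_zero_or, fun j' v' s' hjvs hpos' => ?_⟩
  rcases ht _ _ _ hjvs with h' | ⟨rfl, rfl, rfl⟩
  · exact h.le_of_tried _ _ _ h' hpos'
  · obtain ⟨hb, hle⟩ := hle hpos'
    refine ⟨?_, hle⟩
    rcases h.eq_zero_or with ⟨_, _, h0⟩ | ⟨_, _, _, h0⟩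
    · exact absurd h0 hb
    · exact h0

end Best

section Search

variable {B n : ℕ} {Z : ℤ} {W ω : Fin n → Fin n → ℤ} {m : Mem} {σ : Fin n → ℤ}

lemma Fits.abs_cost_term_le (hB : Fits B n Z W) (hω : RemainingWeights W ω)
    (hσ : ∀ u, σ u = 0 ∨ σ u = 1 ∨ σ u = -1) (u v : Fin n) :
    |ω u v * (σ u + σ v) ^ 2 - (W u v - ω u v) * σ u ^ 2| ≤ Z ^ 3 := by
  have h1 := hω.nonneg u v
  have h2 := hω.le u v
  have h3 := hB.le hB.remainingWeights u v
  have hZ := hB.two_le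
  have h4 : 4 * Z ≤ Z ^ 3 := by nlinarith [sq_nonneg Z, mul_nonneg hB.pos.le (sq_nonneg (Z - 2))]
  rw [abs_le]
  rcases hσ u with h | h | h <;> rcases hσ v with h' | h' | h' <;> rw [h, h'] <;>
    constructor <;> linarith

lemma Fits.abs_mass_term_le (hB : Fits B n Z W) (hω : RemainingWeights W ω)
    (hσ : ∀ u, σ u = 0 ∨ σ u = 1 ∨ σ u = -1) (u v : Fin n) : |ω u v * σ u ^ 2| ≤ Z ^ 3 := by
  have h1 := hω.nonneg u v
  have h2 := hω.le u v
  have h3 := hB.le hB.remainingWeights u v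
  have hZ := hB.two_le
  have h4 : 4 * Z ≤ Z ^ 3 := by nlinarith [sq_nonneg Z, mul_nonneg hB.pos.le (sq_nonneg (Z - 2))]
  rw [abs_le]
  rcases hσ u with h | h | h <;> rw [h] <;> constructor <;> linarith

lemma Fits.mul_mul_lt (hB : Fits B n Z W) : (n : ℤ) * (n * Z ^ 3) < 2 ^ B := by
  refine lt_of_le_of_lt ?_ (hB.pow_lt (a := 5) (by norm_num))
  calc (n : ℤ) * (n * Z ^ 3) ≤ Z * (Z * Z ^ 3) := by
        have := hB.natCast_le
        have := hB.pos
        gcongr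
    _ = Z ^ 5 := by ring

lemma abs_lt_two_pow_of_bounded (hB : Fits B n Z W) {z : ℤ} (h : z = 0 ∨ z = 1 ∨ z = -1) :
    |z| < 2 ^ B := by
  have h1 : (2 : ℤ) < 2 ^ B := hB.two_le.trans_lt (by simpa using hB.pow_lt (a := 1) (by norm_num))
  rcases h with rfl | rfl | rfl
  · simp
  · rw [abs_one]; linarith
  · rw [abs_neg, abs_one]; linarith

lemma ensures_candidateProg (hB : Fits B n Z W) (hω : RemainingWeights W ω) (hm : Params n Z W m)
    (h4 : ∀ u v : Fin n, m.arr 4 u v = ω u v) {j : ℕ}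
    (h5 : ∀ u v : Fin n, m.arr 5 u v = walkApprox (Z ^ 128) ω j u v) {v s : Fin n}
    (hv : m.reg 7 = v) (hs : m.reg 8 = s) :
    Ensures B candidateProg (fun m' => (∀ u : Fin n, m'.arr 7 u 0 = candidate Z ω j v s u) ∧
      m'.reg 12 = cutCost W ω (candidate Z ω j v s) ∧
      m'.reg 13 = cutMass ω (candidate Z ω j v s)) m := by
  refine ensures_of_bounded fun hbd => ?_
  set X := walkApprox (Z ^ 128) ω j with hX
  have hXB : ∀ u v, |X u v| < 2 ^ B := fun u v => by rw [← h5]; exact hbd.arr _ _ _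
  have hσ := candidate_cases Z ω j v s
  refine ensures_seq (ensures_assign ?_ ?_)
  · simpa [hv, hs, h5] using hXB s v
  set m₁ := m.setReg 16 ((Expr.get 5 (Expr.reg 8) (Expr.reg 7)).eval m) with hm₁
  have e16 : m₁.reg 16 = X s v := by simp [hm₁, hv, hs, h5]
  have f₁ : Frame (.assign 16 0) m m₁ :=
    ⟨fun x hx => if_neg fun h => by simp [h, Prog.writesReg] at hx, fun _ _ => rfl⟩
  refine ensures_seq (Ensures.mono (Q := fun m' => m'.reg 16 = |X s v|) ?_ ?_)
  · refine ensures_ite (fun h => ensures_assign ?_ ?_) fun h => ensures_skip ?_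
    · simpa [e16] using hXB s v
    · have : X s v < 0 := by simpa [e16] using h
      simp [e16, abs_of_neg this]
    · have : 0 ≤ X s v := by simpa [e16] using h
      rw [e16, abs_of_nonneg this]
  intro m₂ f₂ e₂
  refine ensures_seq ((ensures_fill1 (f := candidate Z ω j v s) hB.card_le
    (by rw [f₂.reg 0 rfl, f₁.reg 0 rfl, hm.card]) (by norm_num)
    (fun u => abs_lt_two_pow_of_bounded hB (hσ u)) ?_).mono ?_)
  · intro u m' f hu _
    have e1 : m'.reg 16 = |X s v| := (f.reg 16 rfl).trans e₂
    have e2 : m'.reg 7 = v := (f.reg 7 rfl).trans ((f₂.reg 7 rfl).trans ((f₁.reg 7 rfl).trans hv))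
    have e3 : m'.arr 5 = m.arr 5 := (f.arr 5 rfl).trans (f₂.arr 5 rfl)
    simp only [eval_sub, eval_lt, eval_zero, eval_reg, eval_get, e1, e2, e3, hu, h5, zero_sub]
    simp only [candidate, level, ← hX]
    split_ifs <;> first | rfl | (exfalso; linarith)
  intro m₃ f₃ e₃
  have p₃ : Params n Z W m₃ :=
    ((hm.frame f₁ rfl rfl rfl rfl).frame f₂ rfl rfl rfl rfl).frame f₃ rfl rfl rfl rfl
  have w₃ : ∀ u v : Fin n, m₃.arr 4 u v = ω u v := by
    rw [f₃.arr 4 rfl, f₂.arr 4 rfl]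
    exact h4
  refine ensures_seq (ensures_assign (by simp) (ensures_seq ((ensures_sum2
    (f := fun x y => ω x y * (candidate Z ω j v s x + candidate Z ω j v s y) ^ 2
      - (W x y - ω x y) * candidate Z ω j v s x ^ 2) hB.card_le (by simpa using p₃.card)
    (by norm_num) (by norm_num) (by norm_num) (by norm_num) (by norm_num) (by norm_num)
    (hB.abs_cost_term_le hω hσ) (by simpa using hB.mul_mul_lt) ?_).mono ?_)))
  · intro x y m' f hx hy
    simp [hx, hy, f.arr 4 rfl, f.arr 3 rfl, f.arr 7 rfl, w₃, p₃.weight, e₃, pow_two]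
  intro m₄ f₄ e₄
  refine ensures_seq (ensures_assign (by simp) ((ensures_sum2
    (f := fun x y => ω x y * candidate Z ω j v s x ^ 2) hB.card_le
    (by simp [f₄.reg 0 rfl, p₃.card])
    (by norm_num) (by norm_num) (by norm_num) (by norm_num) (by norm_num) (by norm_num)
    (hB.abs_mass_term_le hω hσ) (by simpa using hB.mul_mul_lt) ?_).mono ?_))
  · intro x y m' f hx hy
    simp [hx, hy, f.arr 4 rfl, f.arr 7 rfl, f₄.arr 4 rfl, f₄.arr 7 rfl, w₃, e₃, pow_two]
  intro m₅ f₅ e₅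
  refine ⟨fun u => ?_, ?_, ?_⟩
  · rw [f₅.arr 7 rfl, setReg_arr, f₄.arr 7 rfl, setReg_arr, e₃]
  · rw [f₅.reg 12 rfl]
    simpa [cutCost] using e₄
  · simpa [cutMass] using e₅

/-- The part of the memory that holds the best candidate so far. -/
structure HoldsBest (Z : ℤ) (W ω : Fin n → Fin n → ℤ) (tried : ℕ → Fin n → Fin n → Prop)
    (m : Mem) : Prop where
  exists_best : ∃ σ, (∀ u : Fin n, m.arr 8 u 0 = σ u) ∧
    BestAmong Z W ω tried σ (m.reg 14) (m.reg 15)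

lemma HoldsBest.frame {tried : ℕ → Fin n → Fin n → Prop} {m' : Mem} {p : Prog}
    (h : HoldsBest Z W ω tried m) (hf : Frame p m m') (h1 : p.writesReg 14 = false)
    (h2 : p.writesReg 15 = false) (ha : p.writesArr 8 = false) : HoldsBest Z W ω tried m' := by
  obtain ⟨σ, hσ, hb⟩ := h
  exact ⟨σ, by rwa [hf.arr 8 ha], by rwa [hf.reg 14 h1, hf.reg 15 h2]⟩

lemma HoldsBest.mono {tried tried' : ℕ → Fin n → Fin n → Prop} (h : HoldsBest Z W ω tried m)
    (ht : ∀ j v s, tried' j v s → tried j v s) : HoldsBest Z W ω tried' m := by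
  obtain ⟨σ, hσ, hb⟩ := h
  exact ⟨σ, hσ, hb.mono ht⟩

lemma eval_better_ne_zero (m : Mem) :
    (Expr.bin .lt 0 (.reg 13) * (.bin .eq (.reg 15) 0 +
      .bin .lt (.reg 12 * .reg 15) (.reg 14 * .reg 13))).eval m ≠ 0 ↔
    0 < m.reg 13 ∧ (m.reg 15 = 0 ∨ m.reg 12 * m.reg 15 < m.reg 14 * m.reg 13) := by
  change (if (0 : ℤ) < m.reg 13 then (1 : ℤ) else 0) * ((if m.reg 15 = 0 then 1 else 0) +
    if m.reg 12 * m.reg 15 < m.reg 14 * m.reg 13 then 1 else 0) ≠ 0 ↔ _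
  split_ifs <;> simp_all

lemma ensures_updateProg (hB : Fits B n Z W) (hω : RemainingWeights W ω) (hm : Params n Z W m)
    (h4 : ∀ u v : Fin n, m.arr 4 u v = ω u v) {j : ℕ}
    (h5 : ∀ u v : Fin n, m.arr 5 u v = walkApprox (Z ^ 128) ω j u v) {v s : Fin n}
    (hv : m.reg 7 = v) (hs : m.reg 8 = s) {tried tried' : ℕ → Fin n → Fin n → Prop}
    (ht : ∀ j' v' s', tried' j' v' s' → tried j' v' s' ∨ j' = j ∧ v' = v ∧ s' = s)
    (h : HoldsBest Z W ω tried m) : Ensures B updateProg (HoldsBest Z W ω tried') m := by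
  refine ensures_seq ((ensures_candidateProg hB hω hm h4 h5 hv hs).mono ?_)
  rintro m₁ f₁ ⟨e7, e12, e13⟩
  obtain ⟨σ, hσ, hbest⟩ := h.frame f₁ rfl rfl rfl
  have hc := candidate_cases Z ω j v s
  refine ensures_of_bounded fun hbd => ensures_ite (fun he => ?_) fun he => ?_
  · have he' := (eval_better_ne_zero m₁).1 he
    rw [e12, e13] at he'
    refine ensures_seq ((ensures_fill1 (f := candidate Z ω j v s) hB.card_le
      ((f₁.reg 0 rfl).trans hm.card) (by norm_num)
      (fun u => abs_lt_two_pow_of_bounded hB (hc u)) ?_).mono ?_)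
    · intro u m' f hu _
      simp [hu, f.arr 7 rfl, e7]
    intro m₂ f₂ e8
    have e12' : m₂.reg 12 = m₁.reg 12 := f₂.reg 12 rfl
    have e13' : m₂.reg 13 = m₁.reg 13 := f₂.reg 13 rfl
    refine ensures_seq (ensures_assign ?_ (ensures_assign ?_ ?_))
    · simpa [e12'] using hbd.reg 12
    · simpa [e13'] using hbd.reg 13
    · refine ⟨candidate Z ω j v s, e8, ?_⟩
      have := hbest.replace ht he'.1 he'.2
      simpa [e12', e13', e12, e13] using this
  · refine ensures_skip ⟨σ, hσ, hbest.keep ht fun hpos => ?_⟩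
    have he' := mt (eval_better_ne_zero m₁).2 (not_not.2 he)
    rw [e12, e13] at he'
    exact ⟨fun h0 => he' ⟨hpos, Or.inl h0⟩, not_lt.1 fun hlt => he' ⟨hpos, Or.inr hlt⟩⟩

lemma ensures_forN_forN_updateProg (hB : Fits B n Z W) (hω : RemainingWeights W ω)
    (hm : Params n Z W m) (h4 : ∀ u v : Fin n, m.arr 4 u v = ω u v) {j : ℕ}
    (h5 : ∀ u v : Fin n, m.arr 5 u v = walkApprox (Z ^ 128) ω j u v)
    (h : HoldsBest Z W ω (fun j' _ _ => j' < j) m) :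
    Ensures B (forN 7 (forN 8 updateProg)) (HoldsBest Z W ω fun j' _ _ => j' < j + 1) m := by
  refine (ensures_forN_forN (I := fun i l => HoldsBest Z W ω fun j' v s =>
      j' < j ∨ j' = j ∧ ((v : ℕ) < i ∨ (v : ℕ) = i ∧ (s : ℕ) < l)) hB.card_le hm.card
    (by norm_num) (by norm_num) (by norm_num) rfl rfl rfl ?_ ?_ ?_ ?_ ?_).mono ?_
  · rintro i m' z ⟨σ, h⟩
    exact ⟨σ, by simpa using h⟩
  · rintro i l m' z ⟨σ, h⟩
    exact ⟨σ, by simpa using h⟩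
  · exact h.mono fun j' v s h' => by simpa using h'
  · intro i m' h'
    refine h'.mono fun j' v s => ?_
    have := s.2
    omega
  · intro v s m' f h0 h7 h8 h'
    refine ensures_updateProg hB hω (hm.frame f rfl rfl rfl rfl)
      (by rw [f.arr 4 rfl]; exact h4) (by rw [f.arr 5 rfl]; exact h5) h7 h8 ?_ h'
    intro j' v' s' h''
    have h1 : v' = v ↔ (v' : ℕ) = v := Fin.ext_iff
    have h2 : s' = s ↔ (s' : ℕ) = s := Fin.ext_iff
    rw [h1, h2]
    omega
  · intro m' _ h'
    refine h'.mono fun j' v s => ?_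
    have := v.2
    omega

/-- The search finds the best candidate. -/
lemma ensures_searchProg (hB : Fits B n Z W) (hω : RemainingWeights W ω) (hm : Params n Z W m)
    (h4 : ∀ u v : Fin n, m.arr 4 u v = ω u v) :
    Ensures B searchProg (fun m' => ∃ σ, (∀ u : Fin n, m'.arr 8 u 0 = σ u) ∧
      BestCandidate Z W ω σ) m := by
  have hZ := hB.two_le
  refine ensures_seq ((ensures_fill1 (f := fun _ => 0) hB.card_le hm.card (by norm_num)
    (by simp) (by simp)).mono fun m₁ f₁ h8 => ?_)
  refine ensures_seq (ensures_assign (by simp) (ensures_seq (ensures_assign (by simp) ?_)))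
  set m₂ := (m₁.setReg 14 ((0 : Expr).eval m₁)).setReg 15
    ((0 : Expr).eval (m₁.setReg 14 ((0 : Expr).eval m₁))) with hm₂
  have p₁ : Params n Z W m₁ := hm.frame f₁ rfl rfl rfl rfl
  have p₂ : Params n Z W m₂ := ⟨p₁.card, p₁.steps, p₁.scale, p₁.weight⟩
  have b₂ : HoldsBest Z W ω (fun j' _ _ => j' < 0) m₂ :=
    ⟨0, h8, bestAmong_zero fun _ _ _ => Nat.not_lt_zero _⟩
  have w₂ : ∀ u v : Fin n, m₂.arr 4 u v = ω u v := by
    change ∀ u v : Fin n, m₁.arr 4 u v = ω u v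
    rw [f₁.arr 4 rfl]
    exact h4
  refine ensures_seq ((ensures_startProg hB hω p₂ w₂).mono fun m₃ f₃ h5 => ?_)
  have hB2 : (2 : ℤ) ^ 1 < 2 ^ B := by
    simpa using hZ.trans_lt (by simpa using hB.pow_lt (a := 1) (by norm_num))
  have p₃ : Params n Z W m₃ := p₂.frame f₃ rfl rfl rfl rfl
  refine ensures_seq (ensures_assign (by simp; linarith) ?_)
  refine (ensures_loop (I := fun j m' => Params n Z W m' ∧ (∀ u v : Fin n, m'.arr 4 u v = ω u v) ∧
    (∀ u v : Fin n, m'.arr 5 u v = walkApprox (Z ^ 128) ω j u v) ∧ m'.reg 6 = 2 ^ j ∧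
    HoldsBest Z W ω (fun j' _ _ => j' < j) m') ?_ ?_).mono ?_
  · refine ⟨⟨p₃.card, p₃.steps, p₃.scale, p₃.weight⟩, ?_, h5, by simp, ?_⟩
    · change ∀ u v : Fin n, m₃.arr 4 u v = ω u v
      rw [f₃.arr 4 rfl]
      exact w₂
    · obtain ⟨σ, hσ⟩ := b₂.frame f₃ rfl rfl rfl
      exact ⟨σ, by simpa using hσ⟩
  · rintro j m' _ ⟨p', w', x', t', b'⟩ he
    have hj : (2 : ℤ) ^ j < Z ^ 32 := by
      simp only [eval_lt, eval_reg, p'.steps, t'] at he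
      by_contra hc
      rw [if_neg hc] at he
      exact he rfl
    refine ⟨?_, ?_⟩
    · have := hj.trans (hB.pow_lt (a := 32) (by norm_num))
      exact (pow_lt_pow_iff_right₀ (by norm_num : (1 : ℤ) < 2)).1 this
    refine ensures_seq ((ensures_forN_forN_updateProg hB hω p' w' x' b').mono fun m₄ f₄ b₄ => ?_)
    have p₄ := p'.frame f₄ rfl rfl rfl rfl
    have w₄ : ∀ u v : Fin n, m₄.arr 4 u v = ω u v := by rw [f₄.arr 4 rfl]; exact w'
    refine ensures_seq ((ensures_squareProg hB hω p₄ hj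
      (by rw [f₄.arr 5 rfl]; exact x')).mono fun m₅ f₅ x₅ => ?_)
    have p₅ := p₄.frame f₅ rfl rfl rfl rfl
    have w₅ : ∀ u v : Fin n, m₅.arr 4 u v = ω u v := by rw [f₅.arr 4 rfl]; exact w₄
    have t₅ : m₅.reg 6 = 2 ^ j := by rw [f₅.reg 6 rfl, f₄.reg 6 rfl, t']
    have hval : (Expr.reg 6 + Expr.reg 6).eval m₅ = 2 ^ (j + 1) := by
      simp only [eval_add, eval_reg, t₅]
      ring
    refine ensures_assign ?_ ?_
    · rw [hval, abs_of_nonneg (by positivity)]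
      refine lt_of_le_of_lt ?_ (hB.pow_lt (a := 33) (by norm_num))
      rw [pow_succ, pow_succ Z]
      gcongr
    · rw [hval]
      refine ⟨⟨p₅.card, p₅.steps, p₅.scale, p₅.weight⟩, w₅, x₅, by simp, ?_⟩
      obtain ⟨σ, hσ⟩ := b₄.frame f₅ rfl rfl rfl
      exact ⟨σ, by simpa using hσ⟩
  · rintro m' _ ⟨j, ⟨p', w', x', t', b'⟩, he⟩
    obtain ⟨σ, hσ, hb⟩ := b'
    refine ⟨σ, hσ, (hb.mono fun j' v s hj' => ?_).bestCandidate⟩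
    simp only [eval_lt, eval_reg, p'.steps, t'] at he
    by_contra hc
    have : (2 : ℤ) ^ j ≤ 2 ^ j' := pow_le_pow_right₀ (by norm_num) (not_lt.1 hc)
    rw [if_pos (by linarith)] at he
    simp at he

end Search

end RAM

/-! ### Integer weights -/

namespace WGraph

open CutForm

variable {n : ℕ} (G : WGraph n)

/-- A common denominator of the weights. -/
def commonDen : ℕ := ∏ u, ∏ v, (G.w u v).den

/-- The weights, scaled by the common denominator. -/
def intWeight (u v : Fin n) : ℤ := (G.w u v).num * G.commonDen / (G.w u v).den

/-- The number `Z` in powers of which the accuracy of the computations is measured: a bound on the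
total weight, and exponential in `n` since the columns of the powers of the walk matrix may be as
small as that. -/
def precision : ℤ := 2 ^ n + total G.intWeight + 1

lemma commonDen_pos : 0 < G.commonDen :=
  prod_pos fun u _ => prod_pos fun v _ => (G.w u v).pos

lemma intWeight_eq (u v : Fin n) : (G.intWeight u v : ℚ) = G.commonDen * G.w u v := by
  have hd : (G.w u v).den ∣ G.commonDen :=
    (dvd_prod_of_mem (fun v => (G.w u v).den) (mem_univ v)).trans
      (dvd_prod_of_mem (fun u => ∏ v, (G.w u v).den) (mem_univ u))
  obtain ⟨c, hc⟩ := hd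
  have h0 : ((G.w u v).den : ℤ) ≠ 0 := by exact_mod_cast (G.w u v).den_nz
  have h0' : ((G.w u v).den : ℚ) ≠ 0 := by exact_mod_cast (G.w u v).den_nz
  have h1 : G.intWeight u v = (G.w u v).num * c := by
    rw [intWeight, hc]
    push_cast
    rw [mul_left_comm, Int.mul_ediv_cancel_left _ h0]
  have h2 : (G.w u v : ℚ) * (G.w u v).den = (G.w u v).num := Rat.mul_den_eq_num _
  rw [h1, hc]
  push_cast
  rw [← h2]
  ring

lemma intWeight_nonneg (u v : Fin n) : 0 ≤ G.intWeight u v := by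
  have h : (0 : ℚ) ≤ G.intWeight u v := by
    rw [intWeight_eq]
    exact mul_nonneg (Nat.cast_nonneg _) (G.nonneg u v)
  exact_mod_cast h

lemma intWeight_symm (u v : Fin n) : G.intWeight u v = G.intWeight v u := by
  rw [intWeight, intWeight, G.symm]

lemma size_num_add_size_den_le (u v : Fin n) :
    Nat.size (G.w u v).num.natAbs + Nat.size (G.w u v).den ≤ G.size :=
  (single_le_sum (f := fun v => Nat.size (G.w u v).num.natAbs + Nat.size (G.w u v).den)
    (fun _ _ => Nat.zero_le _) (mem_univ v)).trans
  (single_le_sum (f := fun u => ∑ v, (Nat.size (G.w u v).num.natAbs + Nat.size (G.w u v).den))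
    (fun _ _ => Nat.zero_le _) (mem_univ u))

lemma num_natAbs_le (u v : Fin n) : (G.w u v).num.natAbs ≤ 2 ^ G.size :=
  (Nat.lt_size_self _).le.trans (Nat.pow_le_pow_right (by norm_num)
    ((Nat.le_add_right _ _).trans (G.size_num_add_size_den_le u v)))

lemma den_le (u v : Fin n) : (G.w u v).den ≤ 2 ^ G.size :=
  (Nat.lt_size_self _).le.trans (Nat.pow_le_pow_right (by norm_num)
    ((Nat.le_add_left _ _).trans (G.size_num_add_size_den_le u v)))

lemma mul_self_le_size : n * n ≤ G.size := by
  have h : ∑ _u : Fin n, ∑ _v : Fin n, 1 ≤ G.size := by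
    refine sum_le_sum fun u _ => sum_le_sum fun v _ => ?_
    have := Nat.size_pos.2 (G.w u v).pos
    omega
  simpa using h

lemma commonDen_le : G.commonDen ≤ 2 ^ G.size := by
  have h : G.commonDen ≤ ∏ u, ∏ v, 2 ^ Nat.size (G.w u v).den :=
    prod_le_prod' fun u _ => prod_le_prod' fun v _ => (Nat.lt_size_self _).le
  refine h.trans ?_
  simp only [prod_pow_eq_pow_sum]
  exact Nat.pow_le_pow_right (by norm_num)
    (sum_le_sum fun u _ => sum_le_sum fun v _ => Nat.le_add_left _ _)

lemma intWeight_le (u v : Fin n) : G.intWeight u v ≤ 2 ^ (2 * G.size) := by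
  have h0 : 0 ≤ (G.w u v).num := Rat.num_nonneg.2 (G.nonneg u v)
  have h1 : (G.w u v).num ≤ 2 ^ G.size := by
    have := G.num_natAbs_le u v
    zify at this
    rwa [abs_of_nonneg h0] at this
  have h2 : (G.commonDen : ℤ) ≤ 2 ^ G.size := by exact_mod_cast G.commonDen_le
  calc G.intWeight u v ≤ (G.w u v).num * G.commonDen :=
        Int.ediv_le_self _ (mul_nonneg h0 (Int.natCast_nonneg _))
    _ ≤ 2 ^ G.size * 2 ^ G.size := by gcongr
    _ = _ := by ring

lemma total_intWeight_le : total G.intWeight ≤ 2 ^ (3 * G.size) := by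
  have h1 : total G.intWeight ≤ ∑ _u : Fin n, ∑ _v : Fin n, 2 ^ (2 * G.size) :=
    sum_le_sum fun u _ => sum_le_sum fun v _ => G.intWeight_le u v
  have h2 : ((n * n : ℕ) : ℤ) ≤ 2 ^ G.size := by
    exact_mod_cast G.mul_self_le_size.trans Nat.lt_two_pow_self.le
  refine h1.trans ?_
  simp only [sum_const, card_univ, Fintype.card_fin, nsmul_eq_mul]
  calc (n : ℤ) * (n * 2 ^ (2 * G.size)) = ((n * n : ℕ) : ℤ) * 2 ^ (2 * G.size) := by
        push_cast; ring
    _ ≤ 2 ^ G.size * 2 ^ (2 * G.size) := by gcongr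
    _ = _ := by ring

lemma total_intWeight_nonneg : 0 ≤ total G.intWeight :=
  sum_nonneg fun u _ => sum_nonneg fun v _ => G.intWeight_nonneg u v

lemma le_size : n ≤ G.size := (Nat.le_mul_self n).trans G.mul_self_le_size

lemma precision_le : G.precision ≤ 2 ^ (3 * G.size + 2) := by
  have h1 := G.total_intWeight_le
  have h2 : (2 : ℤ) ^ n ≤ 2 ^ (3 * G.size) :=
    pow_le_pow_right₀ (by norm_num) (G.le_size.trans (by omega))
  have h3 : (1 : ℤ) ≤ 2 ^ (3 * G.size) := one_le_pow₀ (by norm_num)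
  rw [precision, pow_add]
  linarith

/-- A bound on the number of bits of all numbers that occur: the precision has at most
`3 * G.size + 2` bits, and no number exceeds its `400`-th power. -/
def bitBound : ℕ := 1200 * G.size + 800

lemma fits : RAM.Fits G.bitBound n G.precision G.intWeight where
  card_le := by
    have := G.le_size
    unfold bitBound
    omega
  two_le := by
    have h1 := G.total_intWeight_nonneg
    have h2 : (1 : ℤ) ≤ 2 ^ n := one_le_pow₀ (by norm_num)
    unfold precision
    linarith
  two_pow_le := by
    have h1 := G.total_intWeight_nonneg
    unfold precision
    linarith
  total_le := by
    have h2 : (1 : ℤ) ≤ 2 ^ n := one_le_pow₀ (by norm_num)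
    unfold precision
    linarith
  pow_le := by
    have h0 : 0 ≤ G.precision := by
      have h1 := G.total_intWeight_nonneg
      unfold precision
      positivity
    calc G.precision ^ 400 ≤ (2 ^ (3 * G.size + 2)) ^ 400 := pow_le_pow_left₀ h0 G.precision_le _
      _ = 2 ^ G.bitBound := by rw [← pow_mul, bitBound]; congr 1; ring
  nonneg := G.intWeight_nonneg
  symm := G.intWeight_symm

lemma two_pow_size_lt : (2 : ℤ) ^ G.size < 2 ^ G.bitBound :=
  pow_lt_pow_right₀ (by norm_num) (by unfold bitBound; omega)

end WGraph

namespace RAM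

open CutForm

/-! ### The program -/

section Programs

open RAM.Expr

/-- Weights in arrays `3` and `4`, and powers of the precision in registers `3` and `4`. -/
def prepareProg : Prog :=
  .seq (.assign 1 1)
  (.seq (forN 9 (forN 10 (.assign 1 (reg 1 * get 1 (reg 9) (reg 10)))))
  (.seq (fill2 9 10 3 (get 0 (reg 9) (reg 10) * reg 1 / get 1 (reg 9) (reg 10)))
  (.seq (fill2 9 10 4 (get 3 (reg 9) (reg 10)))
  (.seq (.assign 2 1)
  (.seq (forN 9 (.assign 2 (reg 2 + reg 2)))
  (.seq (sum2 9 10 2 (get 3 (reg 9) (reg 10)))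
  (.seq (.assign 2 (reg 2 + 1))
  (.seq (.assign 3 (reg 2 * reg 2))
  (.seq (.assign 3 (reg 3 * reg 3))
  (.seq (.assign 3 (reg 3 * reg 3))
  (.seq (.assign 3 (reg 3 * reg 3))
  (.seq (.assign 3 (reg 3 * reg 3))
  (.assign 4 (reg 3 * reg 3 * (reg 3 * reg 3)))))))))))))))

/-- Find the best candidate, record its positive part in array `2`, and remove its support. -/
def stepProg : Prog :=
  .seq searchProg
  (.seq (fill1 9 2 (1 - (1 - get 2 (reg 9) 0) * (1 - bin .eq (get 8 (reg 9) 0) 1)))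
  (fill2 9 10 4 (get 4 (reg 9) (reg 10) *
    (bin .eq (get 8 (reg 9) 0) 0 * bin .eq (get 8 (reg 10) 0) 0))))

/-- The whole algorithm. -/
def cutProg : Prog := .seq prepareProg (forN 5 stepProg)

end Programs

section Main

variable {B n : ℕ} {Z : ℤ} {W ω : Fin n → Fin n → ℤ} {m : Mem}

lemma ensures_stepProg (hB : Fits B n Z W) {i : ℕ} {S : Finset (Fin n)} (hrun : Run Z W i ω S)
    (hm : Params n Z W m) (h4 : ∀ u v : Fin n, m.arr 4 u v = ω u v)
    (h2 : ∀ u : Fin n, m.arr 2 u 0 = if u ∈ S then 1 else 0) :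
    Ensures B stepProg (fun m' => ∃ ω' S', Run Z W (i + 1) ω' S' ∧
      (∀ u v : Fin n, m'.arr 4 u v = ω' u v) ∧
      ∀ u : Fin n, m'.arr 2 u 0 = if u ∈ S' then 1 else 0) m := by
  have hω := hrun.remainingWeights hB.nonneg hB.symm
  refine ensures_seq ((ensures_searchProg hB hω hm h4).mono ?_)
  rintro m₁ f₁ ⟨σ, e8, hσ⟩
  have p₁ := hm.frame f₁ rfl rfl rfl rfl
  refine ensures_seq ((ensures_fill1
    (f := fun u => if u ∈ S ∪ ({u | σ u = 1} : Finset (Fin n)) then 1 else 0) hB.card_le p₁.card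
    (by norm_num) ?_ ?_).mono fun m₂ f₂ e2 => ?_)
  · intro u
    refine abs_lt_two_pow_of_bounded hB ?_
    split_ifs <;> simp
  · intro u m' f hu ha
    have e1 : m'.arr 2 u 0 = if u ∈ S then 1 else 0 := by rw [ha, f₁.arr 2 rfl, h2]
    have e2 : m'.arr 8 u 0 = σ u := by rw [f.arr 8 rfl, e8]
    simp only [eval_sub, eval_mul, eval_eq, eval_one, eval_zero, eval_get, eval_reg, hu, e1, e2,
      mem_union, mem_filter, mem_univ, true_and]
    by_cases h1 : u ∈ S <;> by_cases h2 : σ u = 1 <;> simp [h1, h2]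
  · refine (ensures_fill2 (f := removeSupport ω σ) hB.card_le ((f₂.reg 0 rfl).trans p₁.card)
      (by norm_num) (by norm_num) (by norm_num) ?_ ?_).mono fun m₃ f₃ e4 => ?_
    · intro u v
      rw [abs_of_nonneg (removeSupport_nonneg hω.nonneg u v)]
      refine (removeSupport_le hω.nonneg u v).trans_lt ((hB.le hω u v).trans_lt ?_)
      simpa using hB.pow_lt (a := 1) (by norm_num)
    · intro u v m' f hu hv ha
      have e1 : m'.arr 4 u v = ω u v := by rw [ha, f₂.arr 4 rfl, f₁.arr 4 rfl, h4]
      have e2 : ∀ u : Fin n, m'.arr 8 u 0 = σ u := by rw [f.arr 8 rfl, f₂.arr 8 rfl]; exact e8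
      simp only [eval_mul, eval_eq, eval_zero, eval_get, eval_reg, hu, hv, e1, e2, removeSupport]
      by_cases h1 : σ u = 0 <;> by_cases h2 : σ v = 0 <;> simp [h1, h2]
    · exact ⟨_, _, hrun.step hσ, e4, by rw [f₃.arr 2 rfl]; exact e2⟩

lemma ensures_forN_stepProg (hB : Fits B n Z W) (hm : Params n Z W m)
    (h4 : ∀ u v : Fin n, m.arr 4 u v = W u v) (h2 : ∀ u : Fin n, m.arr 2 u 0 = 0) :
    Ensures B (forN 5 stepProg) (fun m' => ∃ ω S, Run Z W n ω S ∧
      ∀ u : Fin n, m'.arr 2 u 0 = if u ∈ S then 1 else 0) m := by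
  refine (ensures_forN (I := fun i m' => ∃ ω S, Run Z W i ω S ∧
      (∀ u v : Fin n, m'.arr 4 u v = ω u v) ∧
      ∀ u : Fin n, m'.arr 2 u 0 = if u ∈ S then 1 else 0) hB.card_le hm.card (by norm_num) rfl rfl
    ?_ ?_).mono ?_
  · exact ⟨W, ∅, .start, h4, by simpa using h2⟩
  · rintro i _ m' f _ _ ⟨ω, S, hrun, h4', h2'⟩
    exact ensures_stepProg hB hrun (hm.frame f rfl rfl rfl rfl) h4' h2'
  · rintro m' _ ⟨ω, S, hrun, _, h⟩
    exact ⟨ω, S, hrun, h⟩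

lemma add_mul_mul_le_pow {a b c : ℤ} (ha : 0 ≤ a) (hac : a ≤ c) (hbc : b ≤ c) (hc : 2 ≤ c) :
    b + a * (a * c) ≤ c ^ 4 := by
  have h1 : a * (a * c) ≤ c * (c * c) := by gcongr
  have h2 : c ≤ c * (c * c) := by nlinarith
  nlinarith [mul_nonneg (by linarith : 0 ≤ c) (sq_nonneg c)]

variable (G : WGraph n)

lemma input_arr (a : ℕ) (u v : Fin n) : (input G).arr a u v =
    if a = 0 then (G.w u v).num else if a = 1 then ((G.w u v).den : ℤ) else 0 := by
  have hu := u.2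
  have hv := v.2
  simp [input]

lemma bounded_input : Bounded G.bitBound (input G) where
  reg x := by
    simp only [input]
    split_ifs
    · have h : n < 2 ^ G.bitBound := G.fits.card_le.trans_lt Nat.lt_two_pow_self
      rw [abs_of_nonneg (Int.natCast_nonneg n)]
      exact_mod_cast h
    · simp
  arr a i j := by
    simp only [input]
    split_ifs with h h0 h1
    · refine lt_of_le_of_lt ?_ G.two_pow_size_lt
      have := G.num_natAbs_le ⟨i.toNat, by omega⟩ ⟨j.toNat, by omega⟩
      zify at this
      exact this
    · refine lt_of_le_of_lt ?_ G.two_pow_size_lt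
      rw [abs_of_nonneg (by positivity)]
      exact_mod_cast G.den_le ⟨i.toNat, by omega⟩ ⟨j.toNat, by omega⟩
    · simp
    · simp

lemma ensures_commonDen {m : Mem} (h0 : m.reg 0 = n) (h1 : m.reg 1 = 1)
    (ha : ∀ u v : Fin n, m.arr 1 u v = (G.w u v).den) :
    Ensures G.bitBound
      (forN 9 (forN 10 (.assign 1 (.reg 1 * .get 1 (.reg 9) (.reg 10)))))
      (fun m' => m'.reg 1 = G.commonDen) m := by
  set g : ℕ → ℕ → ℕ := fun i j => if h : i < n ∧ j < n then (G.w ⟨i, h.1⟩ ⟨j, h.2⟩).den else 1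
    with hg
  have hg1 : ∀ i j, 1 ≤ g i j := fun i j => by
    simp only [hg]
    split_ifs
    exacts [(G.w _ _).pos, le_rfl]
  have hgd : ∀ u v : Fin n, g u v = (G.w u v).den := fun u v => by simp [hg]
  have hprod : ∏ i ∈ range n, ∏ j ∈ range n, g i j = G.commonDen := by
    rw [prod_range]
    refine prod_congr rfl fun u _ => ?_
    rw [prod_range]
    exact prod_congr rfl fun v _ => hgd u v
  refine (ensures_forN_forN_assign (F := fun i j =>
      (((∏ k ∈ range i, ∏ l ∈ range n, g k l) * ∏ l ∈ range j, g i l : ℕ) : ℤ)) G.fits.card_le h0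
    (by norm_num) (by norm_num) (by norm_num) (by norm_num) (by norm_num) (by norm_num)
    ?_ ?_ ?_ ?_).mono ?_
  · intro i hi j hj
    rw [abs_of_nonneg (by positivity)]
    refine lt_of_le_of_lt ?_ G.two_pow_size_lt
    have h2 : (∏ k ∈ range i, ∏ l ∈ range n, g k l) * ∏ l ∈ range j, g i l ≤ G.commonDen := by
      calc _ ≤ (∏ k ∈ range i, ∏ l ∈ range n, g k l) * ∏ l ∈ range n, g i l :=
            Nat.mul_le_mul_left _ (prod_le_prod_of_subset_of_one_le' (range_mono hj)
              fun l _ _ => hg1 i l)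
        _ = ∏ k ∈ range (i + 1), ∏ l ∈ range n, g k l := (prod_range_succ _ _).symm
        _ ≤ ∏ k ∈ range n, ∏ l ∈ range n, g k l :=
            prod_le_prod_of_subset_of_one_le' (range_mono hi)
              fun k _ _ => one_le_prod' fun l _ => hg1 k l
        _ = _ := hprod
    exact_mod_cast h2.trans G.commonDen_le
  · intro i
    simp [prod_range_succ]
  · simpa using h1
  · intro u v m' f hu hv hr
    have e1 : m'.arr 1 u v = (G.w u v).den := by rw [f.arr 1 rfl, ha]
    simp only [eval_mul, eval_reg, eval_get, hu, hv, hr, e1, ← hgd, prod_range_succ]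
    push_cast
    ring
  · intro m' _ h
    rw [h, hprod]
    simp

lemma ensures_prepareProg :
    Ensures G.bitBound prepareProg (fun m' => Params n G.precision G.intWeight m' ∧
      (∀ u v : Fin n, m'.arr 4 u v = G.intWeight u v) ∧ ∀ u : Fin n, m'.arr 2 u 0 = 0)
      (input G) := by
  have hB := G.fits
  have hZ := hB.two_le
  have hZB : G.precision < 2 ^ G.bitBound := by simpa using hB.pow_lt (a := 1) (by norm_num)
  have hWB : ∀ u v, |G.intWeight u v| < 2 ^ G.bitBound := fun u v => by
    rw [abs_of_nonneg (G.intWeight_nonneg u v)]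
    exact (hB.le hB.remainingWeights u v).trans_lt hZB
  have h1B : (1 : ℤ) < 2 ^ G.bitBound := by linarith
  refine ensures_seq (ensures_assign (by simpa using h1B) ?_)
  set m₀ := (input G).setReg 1 ((1 : Expr).eval (input G)) with hm₀
  have r₀ : m₀.reg 0 = n := rfl
  have a₀ : m₀.arr = (input G).arr := rfl
  refine ensures_seq ((ensures_commonDen G r₀ rfl fun u v => ?_).mono fun m₁ f₁ e1 => ?_)
  · rw [a₀, input_arr]
    simp
  have r₁ : m₁.reg 0 = n := (f₁.reg 0 rfl).trans r₀
  refine ensures_seq ((ensures_fill2 (f := G.intWeight) hB.card_le r₁ (by norm_num) (by norm_num)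
    (by norm_num) hWB fun u v m' f hu hv _ => ?_).mono fun m₂ f₂ e3 => ?_)
  · have h0 : m'.arr 0 u v = (G.w u v).num := by
      rw [f.arr 0 rfl, f₁.arr 0 rfl, a₀, input_arr, if_pos rfl]
    have h1 : m'.arr 1 u v = (G.w u v).den := by
      rw [f.arr 1 rfl, f₁.arr 1 rfl, a₀, input_arr, if_neg (by norm_num), if_pos rfl]
    have h2 : m'.reg 1 = G.commonDen := (f.reg 1 rfl).trans e1
    simp [hu, hv, h0, h1, h2, WGraph.intWeight]
  have r₂ : m₂.reg 0 = n := (f₂.reg 0 rfl).trans r₁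
  refine ensures_seq ((ensures_fill2 (f := G.intWeight) hB.card_le r₂ (by norm_num) (by norm_num)
    (by norm_num) hWB fun u v m' f hu hv _ => ?_).mono fun m₃ f₃ e4 => ?_)
  · simp [hu, hv, f.arr 3 rfl, e3]
  have r₃ : m₃.reg 0 = n := (f₃.reg 0 rfl).trans r₂
  have w₃ : ∀ u v : Fin n, m₃.arr 3 u v = G.intWeight u v := by rw [f₃.arr 3 rfl]; exact e3
  refine ensures_seq (ensures_assign (by simpa using h1B) (ensures_seq ((ensures_forN
    (I := fun i m' => m'.reg 2 = 2 ^ i) hB.card_le (by simpa using r₃) (by norm_num) rfl rfl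
    (by simp) fun i hi m' f _ _ h => ensures_assign ?_ ?_).mono fun m₄ f₄ e2 => ?_)))
  · have h2 : (Expr.reg 2 + Expr.reg 2).eval m' = 2 ^ (i + 1) := by
      rw [eval_add, eval_reg, h]; ring
    rw [h2, abs_of_nonneg (by positivity)]
    exact ((pow_le_pow_right₀ (by norm_num) hi).trans hB.two_pow_le).trans_lt hZB
  · have h2 : (Expr.reg 2 + Expr.reg 2).eval m' = 2 ^ (i + 1) := by
      rw [eval_add, eval_reg, h]; ring
    simp [h2]
  have r₄ : m₄.reg 0 = n := by rw [f₄.reg 0 rfl]; simpa using r₃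
  have w₄ : ∀ u v : Fin n, m₄.arr 3 u v = G.intWeight u v := by
    rw [f₄.arr 3 rfl]; exact w₃
  refine ensures_seq ((ensures_sum2 (f := G.intWeight) (M := G.precision) hB.card_le r₄
    (by norm_num) (by norm_num) (by norm_num) (by norm_num) (by norm_num) (by norm_num)
    (fun u v => ?_) ?_ fun u v m' f hu hv => ?_).mono fun m₅ f₅ e2' => ?_)
  · rw [abs_of_nonneg (G.intWeight_nonneg u v)]
    exact hB.le hB.remainingWeights u v
  · rw [e2, abs_of_nonneg (by positivity)]
    refine lt_of_le_of_lt ?_ (hB.pow_lt (a := 4) (by norm_num))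
    have h1 := hB.natCast_le
    have h2 := hB.two_pow_le
    exact add_mul_mul_le_pow (Int.natCast_nonneg n) h1 h2 hZ
  · simp [hu, hv, f.arr 3 rfl, w₄]
  have e5 : (Expr.reg 2 + 1).eval m₅ = G.precision := by
    rw [eval_add, eval_reg, eval_one, e2', e2]
    rfl
  refine ensures_seq (ensures_assign ?_ ?_)
  · rw [e5, abs_of_nonneg hB.pos.le]
    exact hZB
  rw [e5]
  have hpow : ∀ a, a < 400 → |G.precision ^ a| < 2 ^ G.bitBound := fun a ha => by
    rw [abs_of_nonneg (pow_nonneg hB.pos.le a)]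
    exact hB.pow_lt ha
  -- Register `3` runs through the powers `2`, `4`, `8`, `16`, `32` of the precision.
  have hsq : ∀ (a : ℕ) (m' : Mem) (p : Prog) (Q : Mem → Prop), a < 200 →
      m'.reg 3 = G.precision ^ a →
      Ensures G.bitBound p Q (m'.setReg 3 (G.precision ^ (2 * a))) →
      Ensures G.bitBound (.seq (.assign 3 (.reg 3 * .reg 3)) p) Q m' := fun a m' p Q ha h hp => by
    have hval : (Expr.reg 3 * Expr.reg 3).eval m' = G.precision ^ (2 * a) := by
      rw [eval_mul, eval_reg, h]; ring
    refine ensures_seq (ensures_assign ?_ ?_)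
    · rw [hval]
      exact hpow _ (by omega)
    · rwa [hval]
  have e6 : (Expr.reg 2 * Expr.reg 2).eval (m₅.setReg 2 G.precision) = G.precision ^ 2 := by
    simp only [eval_mul, eval_reg, setReg_reg, if_true]
    ring
  refine ensures_seq (ensures_assign ?_ ?_)
  · rw [e6]
    exact hpow _ (by norm_num)
  rw [e6]
  refine hsq 2 _ _ _ (by norm_num) rfl (hsq 4 _ _ _ (by norm_num) rfl
    (hsq 8 _ _ _ (by norm_num) rfl (hsq 16 _ _ _ (by norm_num) rfl (ensures_assign ?_ ?_))))
  · have hval : G.precision ^ 32 * G.precision ^ 32 * (G.precision ^ 32 * G.precision ^ 32)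
        = G.precision ^ 128 := by ring
    simpa [hval] using hpow 128 (by norm_num)
  · refine ⟨⟨?_, ?_, ?_, ?_⟩, ?_, ?_⟩
    · simpa [f₅.reg 0 rfl] using r₄
    · simp
    · simp only [setReg_reg, eval_mul, eval_reg, if_true]
      ring
    · simpa [f₅.arr 3 rfl] using w₄
    · have : m₅.arr 4 = m₃.arr 4 := (f₅.arr 4 rfl).trans (f₄.arr 4 rfl)
      simpa [this] using e4
    · have : m₅.arr 2 = (input G).arr 2 := (f₅.arr 2 rfl).trans ((f₄.arr 2 rfl).trans
        ((f₃.arr 2 rfl).trans ((f₂.arr 2 rfl).trans (f₁.arr 2 rfl))))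
      intro u
      simp [this, input]

/-- The program computes the result of a run, in polynomial time. -/
theorem ensures_cutProg :
    Ensures G.bitBound cutProg (fun m' => ∃ ω, Run G.precision G.intWeight n ω (output n m'))
      (input G) := by
  refine ensures_seq ((ensures_prepareProg G).mono ?_)
  rintro m' _ ⟨hp, h4, h2⟩
  refine (ensures_forN_stepProg G.fits hp h4 h2).mono ?_
  rintro m'' _ ⟨ω, S, hrun, h⟩
  have : output n m'' = S := by
    ext u
    simp [output, h]
  exact ⟨ω, this ▸ hrun⟩

end Main

end RAM

/-! ### The fraction of the edges that is cut -/

namespace WGraph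

open CutForm

variable {n : ℕ} (G : WGraph n)

lemma sum_sum_eq_two_mul_totalWeight : ∑ u, ∑ v, G.w u v = 2 * G.totalWeight := by
  have h1 : ∑ u, ∑ v, (if v < u then G.w u v else 0) = G.totalWeight := by
    rw [totalWeight, sum_comm]
    exact sum_congr rfl fun u _ => sum_congr rfl fun v _ => by rw [G.symm]
  rw [two_mul]
  nth_rewrite 1 [← h1]
  rw [totalWeight, ← sum_add_distrib]
  refine sum_congr rfl fun u _ => ?_
  rw [← sum_add_distrib]
  refine sum_congr rfl fun v _ => ?_
  rcases lt_trichotomy u v with h | h | h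
  · rw [if_neg h.asymm, if_pos h, zero_add]
  · rw [h, if_neg (lt_irrefl v), G.loopless, add_zero]
  · rw [if_pos h, if_neg h.asymm, add_zero]

lemma total_intWeight : (total G.intWeight : ℚ) = 2 * G.commonDen * G.totalWeight := by
  rw [mul_right_comm, ← sum_sum_eq_two_mul_totalWeight]
  simp only [total, Int.cast_sum, intWeight_eq, ← mul_sum]
  ring

lemma uncut_intWeight (S : Finset (Fin n)) :
    (uncut G.intWeight S : ℚ) = total G.intWeight - 2 * G.commonDen * G.cutWeight S := by
  have hite : ∀ (T : Finset (Fin n)) (f : Fin n → ℚ),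
      ∑ u ∈ T, f u = ∑ u, if u ∈ T then f u else 0 := fun T f => by simp
  have h1 : G.cutWeight S = ∑ u, ∑ v, if u ∈ S ∧ v ∉ S then G.w u v else 0 := by
    rw [cutWeight, hite]
    refine sum_congr rfl fun u _ => ?_
    by_cases hu : u ∈ S
    · rw [if_pos hu, hite]
      simp [hu]
    · simp [hu]
  have h2 : G.cutWeight S = ∑ u, ∑ v, if v ∈ S ∧ u ∉ S then G.w u v else 0 := by
    rw [h1, sum_comm]
    exact sum_congr rfl fun u _ => sum_congr rfl fun v _ => by rw [G.symm]
  have h3 : 2 * (G.commonDen : ℚ) * G.cutWeight S = G.commonDen * (G.cutWeight S + G.cutWeight S) := by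
    ring
  rw [h3]
  nth_rewrite 1 [h1]
  rw [h2, ← sum_add_distrib, mul_sum, uncut, total]
  push_cast
  rw [← sum_sub_distrib]
  refine sum_congr rfl fun u _ => ?_
  rw [← sum_add_distrib, mul_sum, ← sum_sub_distrib]
  refine sum_congr rfl fun v _ => ?_
  rw [intWeight_eq]
  by_cases hu : u ∈ S <;> by_cases hv : v ∈ S <;> simp [hu, hv]

lemma totalWeight_pos (hn : 0 < n) : 0 < G.totalWeight := by
  obtain ⟨u, hu⟩ := G.no_isolated ⟨0, hn⟩
  have h1 : 0 < G.w u ⟨0, hn⟩ := lt_of_le_of_ne (G.nonneg _ _) hu.symm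
  have h2 : G.w u ⟨0, hn⟩ ≤ ∑ u, ∑ v, G.w u v :=
    (single_le_sum (f := fun v => G.w u v) (fun v _ => G.nonneg u v) (mem_univ _)).trans
      (single_le_sum (f := fun u => ∑ v, G.w u v)
        (fun u _ => sum_nonneg fun v _ => G.nonneg u v) (mem_univ _))
  have h3 := G.sum_sum_eq_two_mul_totalWeight
  linarith

lemma cutFraction_eq (hn : 0 < n) (S : Finset (Fin n)) :
    (G.cutFraction S : ℝ) = 1 - uncut G.intWeight S / total G.intWeight := by
  have h1 := G.totalWeight_pos hn
  have h2 : (0 : ℚ) < G.commonDen := by exact_mod_cast G.commonDen_pos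
  have h3 : G.cutFraction S = 1 - uncut G.intWeight S / total G.intWeight := by
    rw [uncut_intWeight, total_intWeight, cutFraction]
    field_simp
    ring
  rw [h3]
  push_cast
  rfl

/-- The spectral bound for the cut that a run produces. -/
theorem cutFraction_ge_of_run {ω : Fin n → Fin n → ℤ} {S : Finset (Fin n)}
    (hrun : Run G.precision G.intWeight n ω S) {k : ℕ} {ε : ℝ} (hk : 1 ≤ k) (hkn : k < n)
    (hlam : G.lam (n - k) < 2) (hε : 0 ≤ ε) (hopt : 1 - ε ≤ (G.optCutFraction : ℝ)) :
    1 - (240 * (144 * (2 ^ 16 + 1)) + 8) * (k : ℝ)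
        * max 1 (Real.log ((2 - G.lam (n - k)) / ((k : ℝ) * ε))) * (ε / (2 - G.lam (n - k)))
      ≤ (G.cutFraction S : ℝ) := by
  have hn : 0 < n := by omega
  have hk' : (1 : ℝ) ≤ k := by exact_mod_cast hk
  have hB := G.fits
  replace hrun : Run G.precision G.intWeight (Fintype.card (Fin n)) ω S := by
    rwa [Fintype.card_fin]
  set α := 2 - G.lam (n - k) with hα
  have hα0 : 0 < α := by linarith
  have hα2 : α ≤ 2 := G.two_sub_lam_le_two hkn
  set M := max 1 (Real.log (α / ((k : ℝ) * ε))) with hM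
  have hM1 : 1 ≤ M := le_max_left _ _
  have htot : (0 : ℚ) < total G.intWeight := by
    rw [total_intWeight]
    have h1 := G.totalWeight_pos hn
    have h2 : (0 : ℚ) < G.commonDen := by exact_mod_cast G.commonDen_pos
    positivity
  have htot' : 0 < total G.intWeight := by exact_mod_cast htot
  set τ : ℝ := (total G.intWeight : ℝ) with hτ
  have hτ0 : 0 < τ := by rw [hτ]; exact_mod_cast htot'
  rw [G.cutFraction_eq hn]
  set U : ℝ := (uncut G.intWeight S : ℝ) with hU
  have hUτ : U ≤ τ := by
    have : uncut G.intWeight S ≤ total G.intWeight := by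
      refine sum_le_sum fun u _ => sum_le_sum fun v _ => ?_
      split_ifs
      exacts [le_rfl, G.intWeight_nonneg u v]
    rw [hU, hτ]
    exact_mod_cast this
  suffices h : U ≤ (240 * (144 * (2 ^ 16 + 1)) + 8) * (k : ℝ) * M * (ε / α) * τ by
    have : U / τ ≤ (240 * (144 * (2 ^ 16 + 1)) + 8) * (k : ℝ) * M * (ε / α) := by
      rwa [div_le_iff₀ hτ0]
    linarith
  have hterm : 0 ≤ (240 * (144 * (2 ^ 16 + 1)) + 8) * (k : ℝ) * M * (ε / α) * τ := by positivity
  obtain ⟨T, -, hT⟩ := exists_mem_eq_sup' (⟨∅, mem_univ _⟩ : (univ : Finset (Finset (Fin n))).Nonempty)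
    G.cutFraction
  have hTε : (uncut G.intWeight T : ℝ) ≤ ε * τ := by
    rw [optCutFraction, hT, G.cutFraction_eq hn, ← hτ] at hopt
    rw [← div_le_iff₀ hτ0]
    linarith
  have hT0 : 0 ≤ uncut G.intWeight T := sum_nonneg fun u _ => sum_nonneg fun v _ => by
    split_ifs
    exacts [G.intWeight_nonneg u v, le_rfl]
  have hZn : (2 : ℤ) ^ Fintype.card (Fin n) ≤ G.precision := by
    rw [Fintype.card_fin]
    exact hB.two_pow_le
  rcases hT0.eq_or_lt with hT0 | hT0
  · have h1 := hrun.uncut_eq_zero hZn hB.total_le hB.nonneg hB.symm htot' hT0.symm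
    have h2 : U ≤ 0 := by rw [hU]; exact_mod_cast h1
    exact h2.trans hterm
  have hετ : 1 ≤ ε * τ := by
    refine le_trans ?_ hTε
    exact_mod_cast hT0
  have hε0 : 0 < ε := by
    by_contra! h
    nlinarith
  set r := k * ε / α with hr
  have hr0 : 0 < r := by positivity
  have hterm' : (240 * (144 * (2 ^ 16 + 1)) + 8) * (k : ℝ) * M * (ε / α) * τ
      = (240 * (144 * (2 ^ 16 + 1)) + 8) * (r * τ * M) := by
    rw [hr]; ring
  rw [hterm']
  have hrτ : 0 < r * τ := by positivity
  have hrτM : r * τ ≤ r * τ * M := le_mul_of_one_le_right hrτ.le hM1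
  rcases le_or_gt (8 * r) 1 with hr8 | hr8
  · have hspec : FewSlowParts (castW G.intWeight) k (α / 2) := by
      have h1 := (G.fewSlowParts hkn).const_mul (c := G.commonDen)
        (by exact_mod_cast G.commonDen_pos)
      have h2 : castW G.intWeight = fun u v => (G.commonDen : ℝ) * G.realW u v := by
        funext u v
        have h3 := G.intWeight_eq u v
        rw [castW, realW]
        exact_mod_cast congrArg (fun q : ℚ => (q : ℝ)) h3
      rw [h2]
      exact h1
    have h4 : 4 * k * (2 * (ε * τ)) / α = 8 * r * τ := by rw [hr]; ring
    -- `uncut` counts ordered pairs, hence the factors `2`.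
    have key := hrun.uncut_le_of_fewSlowParts hZn hB.total_le hB.nonneg hB.symm hk hα0 hα2 hspec
      (E := 2 * (ε * τ)) (by linarith) (by linarith) (by rw [h4, ← hτ]; nlinarith)
    rw [h4, ← hτ, ← hU] at key
    have h5 : k * (2 * (ε * τ)) / α = 2 * (r * τ) := by rw [hr]; ring
    have h6 : τ / (8 * r * τ) = 1 / (8 * r) := by field_simp
    have h7 : Real.log (1 / (8 * r)) ≤ M := by
      refine le_trans (Real.log_le_log (by positivity) ?_) (le_max_right _ _)
      have h8 : α / (k * ε) = 1 / r := by rw [hr]; field_simp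
      rw [h8]
      exact one_div_le_one_div_of_le hr0 (by linarith)
    rw [h5, h6] at key
    calc U ≤ 2 * (30 * (144 * (2 ^ 16 + 1)) * (2 * (r * τ))) * (1 + Real.log (1 / (8 * r)))
          + 8 * r * τ := key
      _ ≤ 2 * (30 * (144 * (2 ^ 16 + 1)) * (2 * (r * τ))) * (2 * M) + 8 * (r * τ * M) := by
          gcongr ?_ * ?_ + ?_
          · linarith
          · linarith
      _ = _ := by ring
  · -- The claimed bound is at least the total weight.
    nlinarith

end WGraph

theorem theorem1p5 :
    ∃ (P : RAM.Prog) (p : Polynomial ℕ) (C : ℝ), 0 < C ∧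
      ∀ (n : ℕ) (G : WGraph n), ∃ (m : RAM.Mem) (t : ℕ),
        RAM.Exec P (RAM.input G) m t ∧ t ≤ p.eval G.size ∧
        ∀ (k : ℕ) (ε : ℝ), 1 ≤ k → k < n → G.lam (n - k) < 2 → 0 ≤ ε →
          1 - ε ≤ (G.optCutFraction : ℝ) →
          1 - C * (k : ℝ) * max 1 (Real.log ((2 - G.lam (n - k)) / ((k : ℝ) * ε)))
              * (ε / (2 - G.lam (n - k)))
            ≤ (G.cutFraction (RAM.output n m) : ℝ) := by
  refine ⟨RAM.cutProg, RAM.cutProg.costPoly.comp (1200 * Polynomial.X + 800),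
    240 * (144 * (2 ^ 16 + 1)) + 8, by norm_num, fun n G => ?_⟩
  obtain ⟨m, t, hexec, ht, -, ω, hrun⟩ := RAM.ensures_cutProg G (RAM.bounded_input G)
  refine ⟨m, t, hexec, ?_, fun k ε hk hkn hlam hε hopt =>
    G.cutFraction_ge_of_run hrun hk hkn hlam hε hopt⟩
  simpa [Polynomial.eval_comp, WGraph.bitBound] using ht
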